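/- Setting. Let $f:\mathbb R\to\mathbb R$ be a $C^3$ flux that is either concave-convex ($uf''(u)>0$ for $u\ne0$, $f'''(0)\neq0$, $f'(u)\to+\infty$ as $|u|\to\infty$) or convex-concave ($uf''(u)<0$ for $u\ne0$, $f'''(0)\ne0$, $f'(u)\to-\infty$ as $|u|\to\infty$), and such that $f'\ge0$ on $\mathbb R$ or $f'\le0$ on $\mathbb R$. Its regions of convexity are $(-\infty,0]$ and $[0,\infty)$. An entropy pair is a pair $(U,F)$ with $U$ strictly convex and differentiable and $F'=U'f'$; fix one such pair. For $u\ne0$, $\varphi^\natural(u)\neq u$ is the state $v$ such that the line through $(u,f(u))$ and $(v,f(v))$ is tangent to the graph of $f$ at $v$; $\varphi^{-\natural}$ is the inverse of $\varphi^\natural$; and $\varphi_0^\flat(u)\ne u$ is the state $v$ with zero entropy dissipation, $-\sigma(u,v)(U(v)-U(u))+F(v)-F(u)=0$, where $\sigma(a,b)=\frac{f(b)-f(a)}{b-a}$. Let $\varphi^\flat$ be a kinetic function: a (strictly) decreasing Lipschitz map with $\varphi^\flat_0<\varphi^\flat\le\varphi^\natural$ for $u>0$ and $\varphi^\natural\le\varphi^\flat<\varphi_0^\flat$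 for $u<0$ (concave-convex case), respectively $\varphi^\flat_0<\varphi^\flat\le\varphi^{-\natural}$ for $u<0$ and $\varphi^{-\natural}\le\varphi^\flat<\varphi_0^\flat$ for $u>0$ (convex-concave case). Let $\varphi^{-\flat}$ be the inverse of $\varphi^\flat$. The scheme. Let $\Delta t,\Delta x>0$, and let $u_j$ be the value in the cell $[(j-1)\Delta x,j\Delta x)$. Put $L_j=\varphi^{-\flat}(u_{j+1})$, $R_j=\varphi^{\flat}(u_{j-1})$, $d_j=\frac{R_j-u_j}{R_j-L_j}$. Reconstruction is triggered in cell $j$ if $L_j\ne R_j$ and $0\le d_j\le1$; then $u_{j,l}=L_j$, $u_{j,r}=R_j$. Otherwise $u_{j,l}=u_{j,r}=u_j$. One step of a conservative scheme is $u_j\mapsto u_j-\frac{\Delta t}{\Delta x}(f_{j+1/2}-f_{j-1/2})$. The upwind scheme has $f_{j+1/2}=f(u_j)$ if $f'\ge0$, and $f_{j+1/2}=f(u_{j+1})$ if $f'\le0$. The reconstruction scheme uses, if $f'\geq 0$, $$\Delta t\,f_{j+1/2}=\min(\tau,\Delta t)f(u_{j,r})+\max(\Delta t-\tau,0)f(u_{j,l}),\qquad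 \tau=\frac{1-d_j}{\sigma(u_{j,l},u_{j,r})}\Delta x,$$ when reconstruction is triggered in cell $j$ and $f_{j+1/2}=f(u_j)$ otherwise; and, if $f'\le0$, $$\Delta t\,f_{j-1/2}=\min(\tau,\Delta t)f(u_{j,l})+\max(\Delta t-\tau,0)f(u_{j,r}),\qquad \tau=\frac{d_j}{-\sigma(u_{j,l},u_{j,r})}\Delta x,$$ when reconstruction is triggered in cell $j$ and $f_{j-1/2}=f(u_j)$ otherwise. The CFL condition holds in cell $j$ if $\frac{\Delta t}{\Delta x}|f'(v)|\le1$ for $v\in\{u_j,u_{j,l},u_{j,r}\}$. Theorem (classical solutions). 1. Suppose that $u_{j-2},\dots,u_{j+2}$ lie in the same region of convexity of $f$. Then in each of the cells $i\in\{j-1,j,j+1\}$ with $u_i\neq0$ no reconstruction is triggered. If the CFL condition holds in these three cells, then the new value $u_j^{\rm new}$ given by the reconstruction scheme equals the one given by the upwind scheme. Hence $\min(u_{j-1},u_j,u_{j+1})\le u_j^{\rm new}\le\max(u_{j-1},u_j,u_{j+1})$ and, for every entropy pair $(V,G)$, $V(u_j^{\rm new})\le V(u_j)-\frac{\Delta t}{\Delta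 x}(G_{j+1/2}-G_{j-1/2})$, where $G_{j+1/2}=G(u_j)$ if $f'\ge0$ and $G_{j+1/2}=G(u_{j+1})$ if $f'\le0$. 2. If all $u_i$, $i\in\mathbb Z$, lie in the same region of convexity and the CFL condition holds in every cell, one step of the reconstruction scheme does not increase the total variation (in $[0,\infty]$) of $(u_i)_{i\in\mathbb Z}$. 3. Let $u_0\in L^\infty(\mathbb R)$ and let $\Delta t_k,\Delta x_k>0$ tend to $0$ as $k\to\infty$. For each $k$ let $(u^n_j)$ be the discrete solution of the reconstruction scheme started from the averages of $u_0$ over the cells. Suppose that, for each $k$, the whole discrete solution $(u^n_j)_{n\in\mathbb N,\,j\in\mathbb Z}$ lies in one region of convexity of $f$, and that the CFL condition holds in all cells at all time steps. Then $\partial_tu+\partial_xf(u)=0$, $u(\cdot,0)=u_0$, has a unique classical solution $u\in L^\infty(\mathbb R\times(0,\infty))$, that is, a weak solution satisfying, in the sense of distributions with initial data, $\partial_tV(u)+\partial_xG(u)\le0$ for all entropy pairs $(V,G)$; and the functions equal to $u^n_j$ on $[(j-1)\Delta x_k,j\Delta x_k)\times[n\Delta t_k,(n+1)\Delta t_k)$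 converge to $u$ in $L^1(K)$, as $k\to\infty$, for every compact $K\subset\mathbb R\times[0,\infty)$. -/

import Mathlib

open Set Filter Topology MeasureTheory
open scoped ENNReal ContDiff

noncomputable section

namespace ReconScheme

/-! ### Flux functions, entropies, kinetic functions -/

/-- Concave-convex flux. -/
structure ConcaveConvex (f : ℝ → ℝ) : Prop where
  contDiff : ContDiff ℝ 3 f
  sign : ∀ u : ℝ, u ≠ 0 → 0 < u * iteratedDeriv 2 f u
  nondegenerate : iteratedDeriv 3 f 0 ≠ 0
  limit : Tendsto (deriv f) (cocompact ℝ) atTop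

/-- Convex-concave flux. -/
structure ConvexConcave (f : ℝ → ℝ) : Prop where
  contDiff : ContDiff ℝ 3 f
  sign : ∀ u : ℝ, u ≠ 0 → u * iteratedDeriv 2 f u < 0
  nondegenerate : iteratedDeriv 3 f 0 ≠ 0
  limit : Tendsto (deriv f) (cocompact ℝ) atBot

/-- For both kinds of flux the inflection point `0` separates the two regions of convexity:
`f` is convex on one of the half-lines `(-∞, 0]`, `[0, ∞)` and concave on the other. -/
def convexityRegions : Set (Set ℝ) := {Iic 0, Ici 0}

/-- `(U, F)` is a strictly convex entropy pair for the flux `f`: `F' = U' f'`. -/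
structure IsEntropyPair (f U F : ℝ → ℝ) : Prop where
  strictConvex : StrictConvexOn ℝ univ U
  differentiable : Differentiable ℝ U
  hasDerivAt_flux : ∀ u : ℝ, HasDerivAt F (deriv U u * deriv f u) u

/-- The Rankine-Hugoniot speed of the discontinuity from `a` (left) to `b` (right). -/
def speed (f : ℝ → ℝ) (a b : ℝ) : ℝ := (f b - f a) / (b - a)

/-- The entropy dissipation `E(a, b)` of the discontinuity from `a` (left) to `b` (right). -/
def dissipation (f U F : ℝ → ℝ) (a b : ℝ) : ℝ :=
  -speed f a b * (U b - U a) + (F b - F a)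

/-- `v = φ^♮(u)`, for `u ≠ 0`: the line through `(u, f u)` and `(v, f v)`, with `v ≠ u`, is tangent
to the graph of `f` at `v`. (For the fluxes above and `u ≠ 0` there is exactly one such `v`.) -/
def IsTangentState (f : ℝ → ℝ) (u v : ℝ) : Prop :=
  v ≠ u ∧ deriv f v = (f u - f v) / (u - v)

/-- `v = φ₀^♭(u)`, for `u ≠ 0`: the state `v ≠ u` with vanishing entropy dissipation. (For the fluxes
above and `u ≠ 0` there is exactly one such `v`.) -/
def IsZeroDissipationState (f U F : ℝ → ℝ) (u v : ℝ) : Prop :=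
  v ≠ u ∧ dissipation f U F u v = 0

/-- Kinetic functions `φ = φ^♭` of a concave-convex flux: decreasing and Lipschitz, with
`φ₀^♭ < φ^♭ ≤ φ^♮` on `u > 0` and `φ^♮ ≤ φ^♭ < φ₀^♭` on `u < 0`. -/
structure IsKineticConcaveConvex (f U F φ : ℝ → ℝ) : Prop where
  strictAnti : StrictAnti φ
  lipschitz : ∃ K, LipschitzWith K φ
  pos : ∀ u : ℝ, 0 < u → ∃ v₀ v₁ : ℝ, IsZeroDissipationState f U F u v₀ ∧
    IsTangentState f u v₁ ∧ v₀ < φ u ∧ φ u ≤ v₁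
  neg : ∀ u : ℝ, u < 0 → ∃ v₀ v₁ : ℝ, IsZeroDissipationState f U F u v₀ ∧
    IsTangentState f u v₁ ∧ v₁ ≤ φ u ∧ φ u < v₀

/-- Kinetic functions `φ = φ^♭` of a convex-concave flux: decreasing and Lipschitz, with
`φ₀^♭ < φ^♭ ≤ φ^{-♮}` on `u < 0` and `φ^{-♮} ≤ φ^♭ < φ₀^♭` on `u > 0`. Here `φ^{-♮}` is the
inverse of `φ^♮`, so that `v₁ = φ^{-♮}(u)` reads `u = φ^♮(v₁)`. -/
structure IsKineticConvexConcave (f U F φ : ℝ → ℝ) : Prop where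
  strictAnti : StrictAnti φ
  lipschitz : ∃ K, LipschitzWith K φ
  neg : ∀ u : ℝ, u < 0 → ∃ v₀ v₁ : ℝ, IsZeroDissipationState f U F u v₀ ∧
    IsTangentState f v₁ u ∧ v₀ < φ u ∧ φ u ≤ v₁
  pos : ∀ u : ℝ, 0 < u → ∃ v₀ v₁ : ℝ, IsZeroDissipationState f U F u v₀ ∧
    IsTangentState f v₁ u ∧ v₁ ≤ φ u ∧ φ u < v₀

/-! ### The reconstruction scheme

In a grid function `u : ℤ → ℝ` the value `u j` belongs to the cell `[(j - 1) Δx, j Δx)`, whose right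
interface `j Δx` is denoted `j + 1/2`. -/

/-- `φ^{-♭}(u_{j+1})`. A kinetic function is a bijection of `ℝ`, so `invFun` is its inverse. -/
def kineticLeft (φ : ℝ → ℝ) (u : ℤ → ℝ) (j : ℤ) : ℝ := Function.invFun φ (u (j + 1))

/-- `φ^♭(u_{j-1})`. -/
def kineticRight (φ : ℝ → ℝ) (u : ℤ → ℝ) (j : ℤ) : ℝ := φ (u (j - 1))

/-- The relative position `d_j` of the reconstructed discontinuity in cell `j`. -/
def position (φ : ℝ → ℝ) (u : ℤ → ℝ) (j : ℤ) : ℝ :=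
  (kineticRight φ u j - u j) / (kineticRight φ u j - kineticLeft φ u j)

/-- The reconstruction is triggered in cell `j`: the number `d_j` makes sense and is in `[0, 1]`. -/
def Reconstructs (φ : ℝ → ℝ) (u : ℤ → ℝ) (j : ℤ) : Prop :=
  kineticLeft φ u j ≠ kineticRight φ u j ∧ 0 ≤ position φ u j ∧ position φ u j ≤ 1

open Classical in
/-- The left state `u_{j,l}` in cell `j`, which is `u_j` if there is no reconstruction. -/
def leftState (φ : ℝ → ℝ) (u : ℤ → ℝ) (j : ℤ) : ℝ :=
  if Reconstructs φ u j then kineticLeft φ u j else u j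

open Classical in
/-- The right state `u_{j,r}` in cell `j`, which is `u_j` if there is no reconstruction. -/
def rightState (φ : ℝ → ℝ) (u : ℤ → ℝ) (j : ℤ) : ℝ :=
  if Reconstructs φ u j then kineticRight φ u j else u j

open Classical in
/-- The flux through the right interface of cell `j`, for a non-decreasing `f`. -/
def outFluxRight (f φ : ℝ → ℝ) (dt dx : ℝ) (u : ℤ → ℝ) (j : ℤ) : ℝ :=
  if Reconstructs φ u j then
    let τ := (1 - position φ u j) / speed f (leftState φ u j) (rightState φ u j) * dx
    (min τ dt * f (rightState φ u j) + max (dt - τ) 0 * f (leftState φ u j)) / dt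
  else f (u j)

open Classical in
/-- The flux through the left interface of cell `j`, for a non-increasing `f`. -/
def outFluxLeft (f φ : ℝ → ℝ) (dt dx : ℝ) (u : ℤ → ℝ) (j : ℤ) : ℝ :=
  if Reconstructs φ u j then
    let τ := position φ u j / (-speed f (leftState φ u j) (rightState φ u j)) * dx
    (min τ dt * f (leftState φ u j) + max (dt - τ) 0 * f (rightState φ u j)) / dt
  else f (u j)

open Classical in
/-- The numerical flux `f_{j+1/2}` of the reconstruction scheme, for a monotone flux `f`. -/
def reconstructionFlux (f φ : ℝ → ℝ) (dt dx : ℝ) (u : ℤ → ℝ) (j : ℤ) : ℝ :=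
  if ∀ v : ℝ, 0 ≤ deriv f v then outFluxRight f φ dt dx u j else outFluxLeft f φ dt dx u (j + 1)

open Classical in
/-- The upwind numerical value at the interface `j + 1/2` of a function `g` of the state, for a monotone
flux `f`: `g (u_j)` if `f' ≥ 0`, and `g (u_{j+1})` if `f' ≤ 0`. -/
def upwindValue (f g : ℝ → ℝ) (u : ℤ → ℝ) (j : ℤ) : ℝ :=
  if ∀ v : ℝ, 0 ≤ deriv f v then g (u j) else g (u (j + 1))

/-- One step of the conservative scheme with numerical fluxes `g j = f_{j+1/2}`. -/
def conservativeStep (dt dx : ℝ) (g : ℤ → ℝ) (u : ℤ → ℝ) (j : ℤ) : ℝ :=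
  u j - dt / dx * (g j - g (j - 1))

/-- One step of the reconstruction scheme. -/
def reconstructionStep (f φ : ℝ → ℝ) (dt dx : ℝ) (u : ℤ → ℝ) : ℤ → ℝ :=
  conservativeStep dt dx (reconstructionFlux f φ dt dx u) u

/-- One step of the upwind scheme. -/
def upwindStep (f : ℝ → ℝ) (dt dx : ℝ) (u : ℤ → ℝ) : ℤ → ℝ :=
  conservativeStep dt dx (upwindValue f f u) u

/-- The CFL restriction for the three states `u_j`, `u_{j,l}`, `u_{j,r}` of cell `j`. -/
def CFLAt (f φ : ℝ → ℝ) (dt dx : ℝ) (u : ℤ → ℝ) (j : ℤ) : Prop :=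
  dt / dx * |deriv f (u j)| ≤ 1 ∧ dt / dx * |deriv f (leftState φ u j)| ≤ 1 ∧
    dt / dx * |deriv f (rightState φ u j)| ≤ 1

/-- The averages of the initial data over the cells. -/
def cellAverage (u₀ : ℝ → ℝ) (dx : ℝ) (j : ℤ) : ℝ :=
  (1 / dx) * ∫ x in (((j : ℝ) - 1) * dx)..((j : ℝ) * dx), u₀ x

/-- The discrete solution `u^n_j` of the reconstruction scheme with initial data `u₀`. -/
def discreteSolution (f φ : ℝ → ℝ) (u₀ : ℝ → ℝ) (dt dx : ℝ) : ℕ → ℤ → ℝ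
  | 0 => cellAverage u₀ dx
  | n + 1 => reconstructionStep f φ dt dx (discreteSolution f φ u₀ dt dx n)

/-- The piecewise constant function of `p = (x, t)` equal to `w n j` for `x` in
`[(j - 1) dx, j dx)` and `t` in `[n dt, (n + 1) dt)`. -/
def piecewiseConstant (dt dx : ℝ) (w : ℕ → ℤ → ℝ) (p : ℝ × ℝ) : ℝ :=
  w ⌊p.2 / dt⌋₊ (⌊p.1 / dx⌋ + 1)

/-! ### Classical (Kruzhkov) entropy solutions -/

/-- The open upper half-plane of the points `(x, t)`, `t > 0`. -/
def halfPlane : Set (ℝ × ℝ) := {p | 0 < p.2}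

/-- `u` is the classical solution of `u_t + f(u)_x = 0`, `u(x, 0) = u₀(x)`: a bounded function that is
a weak solution and satisfies the inequality `U(u)_t + F(u)_x ≤ 0` for every strictly
convex entropy pair, all in the sense of distributions with the initial data included. -/
structure IsClassicalSolution (f : ℝ → ℝ) (u₀ : ℝ → ℝ) (u : ℝ × ℝ → ℝ) : Prop where
  bounded : MemLp u ⊤ (volume.restrict halfPlane)
  weak : ∀ ψ : ℝ × ℝ → ℝ, ContDiff ℝ ∞ ψ → HasCompactSupport ψ →
    (∫ p in halfPlane, (u p * fderiv ℝ ψ p (0, 1) + f (u p) * fderiv ℝ ψ p (1, 0)))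
      + ∫ x : ℝ, u₀ x * ψ (x, 0) = 0
  entropy : ∀ U F : ℝ → ℝ, IsEntropyPair f U F →
    ∀ ψ : ℝ × ℝ → ℝ, ContDiff ℝ ∞ ψ → HasCompactSupport ψ → (∀ p, 0 ≤ ψ p) →
    0 ≤ (∫ p in halfPlane, (U (u p) * fderiv ℝ ψ p (0, 1) + F (u p) * fderiv ℝ ψ p (1, 0)))
      + ∫ x : ℝ, U (u₀ x) * ψ (x, 0)

end ReconScheme

end

noncomputable section

namespace ReconScheme

/-! ### Shape of the flux -/

/-! One step of the scheme. A kinetic function reverses signs, since its bounds `φ^♮` and `φ₀^♭` do: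
on a half-line `f'` is strictly monotone, so a chord contained in it is not tangent at an endpoint
and has nonzero dissipation. If the neighbouring values lie in one region of convexity, `L_j` and
`R_j` therefore lie on the other side of `0` from `u_j`. Now `0 ≤ d_j ≤ 1` says that `u_j = d_j L_j
+ (1 - d_j) R_j`, which forces `u_j = 0`. In that case one of `L_j`, `R_j` is `0` and the
reconstructed front sits at an end of the cell; the CFL condition prevents it from crossing the
cell, and the flux is `f 0`, the upwind flux. Under CFL the upwind update is an average of `u_j` and
its upstream neighbour, and a monotone function of the latter; this yields the maximum principle,
the decay of the variation and the discrete entropy inequalities. Both signs of `f'` are treated at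
once through the increasing flux `g = ± f` (`UpwindData`).

Convergence. No bound on the variation is available, because `u₀` is only bounded. The notion used
instead is `AsymptoticSolution`: a uniformly bounded sequence that satisfies the entropy
inequalities up to errors tending to `0`, uniformly over bounded entropies and test functions. The
discrete solutions form such a sequence (`discrete_entropy`), and so does a constant sequence made
of a classical solution. The central result is `comparison`: two asymptotic solutions `u_k`, `v_m`
with the same initial data satisfy `∫ |u_k - v_m| ≤ θ` on a half-ball, for large `k` and then for
`m` eventually along an ultrafilter.

The proof of `comparison` is Kruzhkov's doubling of variables. The usual passage to the diagonal
relies on continuity of translations in `L¹` for one of the two functions, uniformly in the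
sequence, and this is not known here. It is replaced by `Undoubles`. For a product `α(u(p))
β(v_m(q))` the factor `β(v_m)` has a weak limit `B`, and along the ultrafilter only translations of
the single function `B` matter; the resulting bound does not depend on `u`. Lipschitz functions of
`(u, v)` are uniform limits of finite sums of such products. The size of the kernel can thus be
fixed before `k` and `m`.

Comparing the sequence with itself shows that it is Cauchy in `L¹_loc`; its limit satisfies all
entropy inequalities, and hence also the weak equation, since the entropies `± a` are limits of
strictly convex ones. Comparing with a classical solution gives uniqueness and convergence of the
whole sequence. -/

theorem ConvexConcave.neg {f : ℝ → ℝ} (hf : ConvexConcave f) : ConcaveConvex (-f) where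
  contDiff := hf.contDiff.neg
  sign u hu := by
    have := hf.sign u hu
    rw [iteratedDeriv_neg]
    linarith
  nondegenerate := by
    rw [iteratedDeriv_neg]
    exact neg_ne_zero.2 hf.nondegenerate
  limit := by
    have : deriv (-f) = fun x => -deriv f x := by
      ext x
      exact deriv.neg
    rw [this]
    exact tendsto_neg_atBot_atTop.comp hf.limit

theorem deriv_neg_fun (f : ℝ → ℝ) (x : ℝ) : deriv (-f) x = -deriv f x := deriv.neg

namespace ConcaveConvex

variable {f : ℝ → ℝ}

theorem differentiable (hf : ConcaveConvex f) : Differentiable ℝ f :=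
  hf.contDiff.differentiable (by norm_num)

theorem hasDerivAt (hf : ConcaveConvex f) (x : ℝ) : HasDerivAt f (deriv f x) x :=
  (hf.differentiable x).hasDerivAt

theorem continuous_deriv (hf : ConcaveConvex f) : Continuous (deriv f) :=
  hf.contDiff.continuous_deriv (by norm_num)

theorem strictMonoOn_deriv (hf : ConcaveConvex f) : StrictMonoOn (deriv f) (Ici 0) := by
  refine strictMonoOn_of_deriv_pos (convex_Ici 0) hf.continuous_deriv.continuousOn ?_
  intro x hx
  rw [interior_Ici, mem_Ioi] at hx
  have := hf.sign x hx.ne'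
  rw [iteratedDeriv_succ, iteratedDeriv_one] at this
  exact pos_of_mul_pos_right this hx.le

theorem strictAntiOn_deriv (hf : ConcaveConvex f) : StrictAntiOn (deriv f) (Iic 0) := by
  refine strictAntiOn_of_deriv_neg (convex_Iic 0) hf.continuous_deriv.continuousOn ?_
  intro x hx
  rw [interior_Iic, mem_Iio] at hx
  have := hf.sign x hx.ne
  rw [iteratedDeriv_succ, iteratedDeriv_one] at this
  exact neg_of_mul_pos_right this hx.le

theorem deriv_zero_lt (hf : ConcaveConvex f) (h0 : ∀ v, 0 ≤ deriv f v) {u : ℝ} (hu : u ≠ 0) :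
    0 < deriv f u := by
  rcases lt_or_gt_of_ne hu with h | h
  · exact (h0 0).trans_lt (hf.strictAntiOn_deriv h.le self_mem_Iic h)
  · exact (h0 0).trans_lt (hf.strictMonoOn_deriv self_mem_Ici h.le h)

theorem exists_deriv_pos (hf : ConcaveConvex f) : ∃ v, 0 < deriv f v :=
  (hf.limit.eventually_gt_atTop 0).exists

/-- On a region of convexity, `f'` increases with the distance to the inflection point. -/
theorem deriv_le_of_mem (hf : ConcaveConvex f) {S : Set ℝ} (hS : S ∈ convexityRegions) {a b s : ℝ}
    (ha : a ∈ S) (hb : b ∈ S) (hs : s ∈ uIcc a b) : deriv f s ≤ max (deriv f a) (deriv f b) := by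
  rw [mem_uIcc] at hs
  rcases hS with rfl | rfl
  · simp only [mem_Iic] at ha hb
    rcases hs with hs | hs
    · exact le_max_of_le_left (hf.strictAntiOn_deriv.antitoneOn ha (hs.2.trans hb) hs.1)
    · exact le_max_of_le_right (hf.strictAntiOn_deriv.antitoneOn hb (hs.2.trans ha) hs.1)
  · simp only [mem_Ici] at ha hb
    rcases hs with hs | hs
    · exact le_max_of_le_right (hf.strictMonoOn_deriv.monotoneOn (ha.trans hs.1) hb hs.2)
    · exact le_max_of_le_left (hf.strictMonoOn_deriv.monotoneOn (hb.trans hs.1) ha hs.2)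

theorem deriv_bound_of_mem (hf : ConcaveConvex f) {S : Set ℝ} (hS : S ∈ convexityRegions)
    {a b s c : ℝ} (hc : 0 ≤ c) (ha : a ∈ S) (hb : b ∈ S) (hs : s ∈ uIcc a b)
    (ca : c * deriv f a ≤ 1) (cb : c * deriv f b ≤ 1) : c * deriv f s ≤ 1 := by
  rcases le_max_iff.1 (hf.deriv_le_of_mem hS ha hb hs) with h | h
  · exact (mul_le_mul_of_nonneg_left h hc).trans ca
  · exact (mul_le_mul_of_nonneg_left h hc).trans cb

end ConcaveConvex

/-! ### Entropy dissipation -/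

theorem speed_comm (f : ℝ → ℝ) (a b : ℝ) : speed f a b = speed f b a := by
  unfold speed
  rw [← neg_sub (f a), ← neg_sub a, neg_div_neg_eq]

theorem speed_neg (f : ℝ → ℝ) (a b : ℝ) : speed (-f) a b = -speed f a b := by
  simp only [speed, Pi.neg_apply]
  ring

theorem dissipation_comm (f U F : ℝ → ℝ) (a b : ℝ) :
    dissipation f U F a b = -dissipation f U F b a := by
  simp only [dissipation, speed_comm f a b]
  ring

theorem dissipation_neg (f U F : ℝ → ℝ) (a b : ℝ) :
    dissipation (-f) U (-F) a b = -dissipation f U F a b := by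
  simp only [dissipation, speed_neg, Pi.neg_apply]
  ring

theorem IsEntropyPair.neg {f U F : ℝ → ℝ} (h : IsEntropyPair f U F) : IsEntropyPair (-f) U (-F) where
  strictConvex := h.strictConvex
  differentiable := h.differentiable
  hasDerivAt_flux u := by
    rw [deriv_neg_fun]
    simpa using (h.hasDerivAt_flux u).neg

theorem IsEntropyPair.strictMono_deriv {f U F : ℝ → ℝ} (h : IsEntropyPair f U F) :
    StrictMono (deriv U) := by
  have := h.strictConvex.strictMonoOn_deriv (fun x _ => h.differentiable x)
  exact strictMonoOn_univ.1 this

theorem IsEntropyPair.hasDerivAt {f U F : ℝ → ℝ} (h : IsEntropyPair f U F) (x : ℝ) :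
    HasDerivAt U (deriv U x) x := (h.differentiable x).hasDerivAt

/-- A discontinuity for which `f' - σ` changes sign exactly once, from `-` to `+`, has positive
dissipation. -/
theorem dissipation_pos_of_sign {f U F : ℝ → ℝ} (hU : IsEntropyPair f U F) (hf : Differentiable ℝ f)
    {a b s : ℝ} (hab : a < b)
    (hs : ∀ x ∈ Ioo a b, x ≠ s → 0 < (deriv f x - speed f a b) * (x - s)) :
    0 < dissipation f U F a b := by
  set σ := speed f a b with hσ
  -- The dissipation is the integral of `U' (f' - σ)` over `[a, b]`. As `f' - σ` has integral zero,
  -- `U'` may be replaced by `U' - U' s`, and the integrand becomes positive.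
  have hd : ∀ x, HasDerivAt (fun x => F x - σ * U x - deriv U s * (f x - σ * x))
      ((deriv U x - deriv U s) * (deriv f x - σ)) x := by
    intro x
    have h1 := (hU.hasDerivAt_flux x).sub ((hU.hasDerivAt x).const_mul σ)
    have h2 := ((hf x).hasDerivAt.sub ((hasDerivAt_id x).const_mul σ)).const_mul (deriv U s)
    exact (h1.sub h2).congr_deriv (by ring)
  have key : ∀ x ∈ Ioo a b, x ≠ s → 0 < (deriv U x - deriv U s) * (deriv f x - σ) := by
    intro x hx hxs
    have h1 := hs x hx hxs
    rcases lt_or_gt_of_ne hxs with h | h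
    · have h2 := hU.strictMono_deriv h
      have h3 : deriv f x - σ < 0 := by nlinarith
      nlinarith
    · have h2 := hU.strictMono_deriv h
      have h3 : 0 < deriv f x - σ := by nlinarith
      nlinarith
  set h := fun x => F x - σ * U x - deriv U s * (f x - σ * x) with hh
  have hcont : Continuous h := continuous_iff_continuousAt.2 fun x => (hd x).continuousAt
  have sm : ∀ c d, a ≤ c → c < d → d ≤ b → (s ≤ c ∨ d ≤ s) → h c < h d := by
    intro c d hc hcd hd' hs'
    refine (strictMonoOn_of_deriv_pos (convex_Icc c d) hcont.continuousOn ?_)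
      (left_mem_Icc.2 hcd.le) (right_mem_Icc.2 hcd.le) hcd
    intro x hx
    rw [interior_Icc] at hx
    rw [(hd x).deriv]
    refine key x ⟨hc.trans_lt hx.1, hx.2.trans_le hd'⟩ ?_
    rintro rfl
    rcases hs' with h | h
    · exact absurd hx.1 (not_lt.2 h)
    · exact absurd hx.2 (not_lt.2 h)
  have hlt : h a < h b := by
    by_cases h1 : s ≤ a
    · exact sm a b le_rfl hab le_rfl (Or.inl h1)
    by_cases h2 : b ≤ s
    · exact sm a b le_rfl hab le_rfl (Or.inr h2)
    push Not at h1 h2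
    exact (sm a s le_rfl h1 h2.le (Or.inr le_rfl)).trans (sm s b h1.le h2 le_rfl (Or.inl le_rfl))
  have hσ' : σ * (b - a) = f b - f a := div_mul_cancel₀ _ (sub_pos.2 hab).ne'
  have : h b - h a = dissipation f U F a b := by
    simp only [hh, dissipation, ← hσ]
    linear_combination deriv U s * hσ'
  linarith

/-- The single sign change of `f' - σ` is at the mean value point of the chord. -/
theorem dissipation_pos_of_strictMonoOn {f U F : ℝ → ℝ} (hU : IsEntropyPair f U F)
    (hf : Differentiable ℝ f) {a b : ℝ} (hab : a < b) (hm : StrictMonoOn (deriv f) (Icc a b)) :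
    0 < dissipation f U F a b := by
  obtain ⟨s, hs, hs'⟩ := exists_deriv_eq_slope f hab hf.continuous.continuousOn hf.differentiableOn
  refine dissipation_pos_of_sign hU hf (s := s) hab fun x hx hxs => ?_
  have e : speed f a b = deriv f s := hs'.symm
  rw [e]
  rcases lt_or_gt_of_ne hxs with h | h
  · have := hm (Ioo_subset_Icc_self hx) (Ioo_subset_Icc_self hs) h
    nlinarith
  · have := hm (Ioo_subset_Icc_self hs) (Ioo_subset_Icc_self hx) h
    nlinarith

theorem dissipation_ne_zero_of_strictMonoOn {f U F : ℝ → ℝ} (hU : IsEntropyPair f U F)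
    (hf : Differentiable ℝ f) {a b : ℝ} (hab : a ≠ b) (hm : StrictMonoOn (deriv f) (uIcc a b)) :
    dissipation f U F a b ≠ 0 := by
  rcases lt_or_gt_of_ne hab with h | h
  · rw [uIcc_of_le h.le] at hm
    exact (dissipation_pos_of_strictMonoOn hU hf h hm).ne'
  · rw [uIcc_of_ge h.le] at hm
    rw [dissipation_comm]
    exact neg_ne_zero.2 (dissipation_pos_of_strictMonoOn hU hf h hm).ne'

theorem uIcc_subset_region {S : Set ℝ} (hS : S ∈ convexityRegions) {a b : ℝ} (ha : a ∈ S)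
    (hb : b ∈ S) : uIcc a b ⊆ S := by
  rcases hS with rfl | rfl
  · exact ordConnected_Iic.uIcc_subset ha hb
  · exact ordConnected_Ici.uIcc_subset ha hb

/-- Zero-dissipation states are thereby confined to the opposite half-line. The concave half is
reduced to the convex one by changing the sign of `f` and `F`. -/
theorem ConcaveConvex.dissipation_ne_zero {f U F : ℝ → ℝ} (hf : ConcaveConvex f)
    (hU : IsEntropyPair f U F) {S : Set ℝ} (hS : S ∈ convexityRegions) {a b : ℝ} (ha : a ∈ S)
    (hb : b ∈ S) (hab : a ≠ b) : dissipation f U F a b ≠ 0 := by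
  have hsub := uIcc_subset_region hS ha hb
  rcases hS with rfl | rfl
  · have h := dissipation_ne_zero_of_strictMonoOn hU.neg hf.differentiable.neg hab (by
      intro x hx y hy hxy
      rw [deriv_neg_fun, deriv_neg_fun]
      exact neg_lt_neg (hf.strictAntiOn_deriv (hsub hx) (hsub hy) hxy))
    rw [dissipation_neg] at h
    exact fun h0 => h (by rw [h0, neg_zero])
  · exact dissipation_ne_zero_of_strictMonoOn hU hf.differentiable hab
      (hf.strictMonoOn_deriv.mono hsub)

/-- A tangent state lies in the other region of convexity. -/
theorem ConcaveConvex.not_isTangentState {f : ℝ → ℝ} (hf : ConcaveConvex f) {S : Set ℝ}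
    (hS : S ∈ convexityRegions) {a b : ℝ} (ha : a ∈ S) (hb : b ∈ S) : ¬ IsTangentState f a b := by
  rintro ⟨hne, ht⟩
  have hsub := uIcc_subset_region hS ha hb
  -- Tangency at `b` and the mean value theorem give two points with the same derivative, against
  -- injectivity of `f'` on the half-line.
  have hex : ∃ s ∈ uIcc a b, s ≠ b ∧ deriv f s = deriv f b := by
    rcases lt_or_gt_of_ne hne with h | h
    · obtain ⟨s, hs, hs'⟩ := exists_deriv_eq_slope f h hf.differentiable.continuous.continuousOn
        hf.differentiable.differentiableOn
      exact ⟨s, by rw [uIcc_of_ge h.le]; exact Ioo_subset_Icc_self hs, hs.1.ne', by rw [hs', ht]⟩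
    · obtain ⟨s, hs, hs'⟩ := exists_deriv_eq_slope f h hf.differentiable.continuous.continuousOn
        hf.differentiable.differentiableOn
      refine ⟨s, by rw [uIcc_of_le h.le]; exact Ioo_subset_Icc_self hs, hs.2.ne, ?_⟩
      rw [hs', ht, ← neg_sub (f b), ← neg_sub b, neg_div_neg_eq]
  obtain ⟨s, hs, hsb, hd⟩ := hex
  rcases hS with rfl | rfl
  · exact hsb (hf.strictAntiOn_deriv.injOn (hsub hs) hb hd)
  · exact hsb (hf.strictMonoOn_deriv.injOn (hsub hs) hb hd)

/-- Chords that end in a bounded set and start far away are steep. -/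
theorem ConcaveConvex.exists_lt_speed {f : ℝ → ℝ} (hf : ConcaveConvex f)
    (h0 : ∀ v, 0 ≤ deriv f v) (V C : ℝ) :
    ∃ B > V, 0 < B ∧ ∀ u v, B ≤ |u| → |v| ≤ V → C < speed f u v := by
  wlog hC : 0 ≤ C generalizing C
  · obtain ⟨B, h1, h2, h3⟩ := this 0 le_rfl
    exact ⟨B, h1, h2, fun u v hu hv => (not_le.1 hC).trans (h3 u v hu hv)⟩
  obtain ⟨A₀, hA₀⟩ : ∃ A₀ : ℝ, ∀ x, A₀ ≤ |x| → C + 1 ≤ deriv f x := by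
    have := hf.limit.eventually_ge_atTop (C + 1)
    rw [← Metric.cobounded_eq_cocompact, ← comap_norm_atTop, eventually_comap] at this
    obtain ⟨A₀, hA₀⟩ := eventually_atTop.1 this
    exact ⟨A₀, fun x hx => hA₀ _ hx x rfl⟩
  set A := max (max A₀ V) 0 with hA
  have hAV : V ≤ A := (le_max_right _ _).trans (le_max_left _ _)
  have hA0 : 0 ≤ A := le_max_right _ _
  have hAA : A₀ ≤ A := (le_max_left _ _).trans (le_max_left _ _)
  have hmono : Monotone f := monotone_of_deriv_nonneg hf.differentiable h0
  have hmul : 0 ≤ C * A := mul_nonneg hC hA0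
  -- Beyond `A` the slope is at least `C + 1`, so for `u > 0` the rise of the chord is at least `(C
  -- + 1) (u - A)`, while its length is at most `u + A`. The first exceeds `C (u + A)` once `u > 2 C
  -- A + A`.
  refine ⟨2 * (C * A) + A + 1, by linarith, by linarith, ?_⟩
  intro u v hu hv
  have hv' := abs_le.1 hv
  rcases le_or_gt 0 u with h | h
  · rw [abs_of_nonneg h] at hu
    have h1 : (C + 1) * (u - A) ≤ f u - f A := by
      refine Convex.mul_sub_le_image_sub_of_le_deriv (convex_Ici A)
        hf.differentiable.continuous.continuousOn hf.differentiable.differentiableOn ?_ A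
        self_mem_Ici u (by rw [mem_Ici]; linarith) (by linarith)
      intro x hx
      rw [interior_Ici, mem_Ioi] at hx
      exact hA₀ x (hAA.trans (hx.le.trans (le_abs_self x)))
    have h2 := hmono (show v ≤ A by linarith)
    rw [speed_comm, speed, lt_div_iff₀ (by linarith)]
    nlinarith
  · rw [abs_of_neg h] at hu
    have h1 : (C + 1) * (-A - u) ≤ f (-A) - f u := by
      refine Convex.mul_sub_le_image_sub_of_le_deriv (convex_Iic (-A))
        hf.differentiable.continuous.continuousOn hf.differentiable.differentiableOn ?_ u
        (by rw [mem_Iic]; linarith) (-A) self_mem_Iic (by linarith)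
      intro x hx
      rw [interior_Iic, mem_Iio] at hx
      exact hA₀ x (hAA.trans ((le_neg.1 hx.le).trans (neg_le_abs x)))
    have h2 := hmono (show -A ≤ v by linarith)
    rw [speed, lt_div_iff₀ (by linarith)]
    nlinarith

theorem ConcaveConvex.deriv_le_of_abs_le {f : ℝ → ℝ} (hf : ConcaveConvex f) {V s : ℝ}
    (hs : |s| ≤ V) : deriv f s ≤ max (deriv f V) (deriv f (-V)) := by
  have hs' := abs_le.1 hs
  rcases le_total 0 s with h | h
  · exact le_max_of_le_left (hf.strictMonoOn_deriv.monotoneOn h (h.trans hs'.2) hs'.2)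
  · exact le_max_of_le_right (hf.strictAntiOn_deriv.antitoneOn (hs'.1.trans h) h hs'.1)

/-! ### Kinetic functions -/

/-- The properties of a kinetic function on which the scheme relies. -/
structure IsSignReversing (φ : ℝ → ℝ) : Prop where
  strictAnti : StrictAnti φ
  neg_of_pos : ∀ u, 0 < u → φ u < 0
  pos_of_neg : ∀ u, u < 0 → 0 < φ u
  surjective : Function.Surjective φ

theorem IsSignReversing.of_unbounded {φ : ℝ → ℝ} (h1 : StrictAnti φ) (hc : Continuous φ)
    (h2 : ∀ u, 0 < u → φ u < 0) (h3 : ∀ u, u < 0 → 0 < φ u)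
    (h4 : ∀ V : ℝ, 0 < V → (∃ u, φ u < -V) ∧ ∃ u, V < φ u) : IsSignReversing φ where
  strictAnti := h1
  neg_of_pos := h2
  pos_of_neg := h3
  surjective w := by
    obtain ⟨⟨u, hu⟩, ⟨v, hv⟩⟩ := h4 (|w| + 1) (by positivity)
    have := abs_le.1 (le_refl |w|)
    exact mem_range_of_exists_le_of_exists_ge hc ⟨u, by linarith⟩ ⟨v, by linarith⟩

/-- Here `φ` is at least as far from `0` as `φ^♮`, on the same side. The state `φ^♮(u)` is unbounded
as `|u|` grows: the chords from a far `u` to a bounded set are steeper than `f'` is on that set, so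
none is tangent there. -/
theorem IsKineticConcaveConvex.isSignReversing {f U F φ : ℝ → ℝ} (hf : ConcaveConvex f)
    (h0 : ∀ v, 0 ≤ deriv f v) (hφ : IsKineticConcaveConvex f U F φ) : IsSignReversing φ := by
  have hneg : ∀ u v, 0 < u → IsTangentState f u v → v < 0 := fun u v hu h =>
    not_le.1 fun hv => hf.not_isTangentState (S := Ici 0) (by simp [convexityRegions]) hu.le hv h
  have hpos : ∀ u v, u < 0 → IsTangentState f u v → 0 < v := fun u v hu h =>
    not_le.1 fun hv => hf.not_isTangentState (S := Iic 0) (by simp [convexityRegions]) hu.le hv h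
  obtain ⟨K, hK⟩ := hφ.lipschitz
  have far : ∀ V : ℝ, 0 < V → ∃ B > 0, ∀ u v, B ≤ |u| → IsTangentState f u v → V < |v| := by
    intro V hV
    obtain ⟨B, -, hB, h⟩ := hf.exists_lt_speed h0 V (max (deriv f V) (deriv f (-V)))
    refine ⟨B, hB, fun u v hu hv => not_le.1 fun hv' => ?_⟩
    have h1 := h u v hu hv'
    have h2 := hf.deriv_le_of_abs_le hv'
    rw [hv.2] at h2
    rw [speed_comm, speed] at h1
    linarith
  refine .of_unbounded hφ.strictAnti hK.continuous ?_ ?_ ?_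
  · intro u hu
    obtain ⟨v₀, v₁, -, h1, -, h2⟩ := hφ.pos u hu
    exact h2.trans_lt (hneg u v₁ hu h1)
  · intro u hu
    obtain ⟨v₀, v₁, -, h1, h2, -⟩ := hφ.neg u hu
    exact (hpos u v₁ hu h1).trans_le h2
  · intro V hV
    obtain ⟨B, hB, h⟩ := far V hV
    constructor
    · obtain ⟨v₀, v₁, -, h1, -, h2⟩ := hφ.pos B hB
      have h3 := h B v₁ (le_abs_self B) h1
      rw [abs_of_neg (hneg B v₁ hB h1)] at h3
      exact ⟨B, by linarith⟩
    · obtain ⟨v₀, v₁, -, h1, h2, -⟩ := hφ.neg (-B) (by linarith)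
      have h3 := h (-B) v₁ (by rw [abs_neg]; exact le_abs_self B) h1
      rw [abs_of_pos (hpos (-B) v₁ (by linarith) h1)] at h3
      exact ⟨-B, by linarith⟩

/-- This makes `φ₀^♭` unbounded. The chord from a far `u` to a bounded `v` is steeper than `f'` on
`[-V, V]`, so the equation `f' = σ` has exactly one solution between `u` and `v`, on the side of
`u`, although the segment crosses the inflection point. -/
theorem ConcaveConvex.exists_dissipation_ne_zero {f U F : ℝ → ℝ} (hf : ConcaveConvex f)
    (h0 : ∀ v, 0 ≤ deriv f v) (hU : IsEntropyPair f U F) (V : ℝ) :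
    ∃ B > 0, ∀ u v, B ≤ |u| → |v| ≤ V → u * v ≤ 0 → dissipation f U F u v ≠ 0 := by
  obtain ⟨B, hBV, hB, h⟩ := hf.exists_lt_speed h0 V (max (deriv f V) (deriv f (-V)))
  refine ⟨B, hB, fun u v hu hv huv => ?_⟩
  have hσ := h u v hu hv
  have hlow : ∀ s, |s| ≤ V → deriv f s < speed f u v := fun s hs =>
    (hf.deriv_le_of_abs_le hs).trans_lt hσ
  have hv' := abs_le.1 hv
  rcases le_or_gt 0 u with hu0 | hu0
  · rw [abs_of_nonneg hu0] at hu
    have hvn : v ≤ 0 := by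
      by_contra hh
      nlinarith
    have hvu : v < u := by linarith
    obtain ⟨s, hs, hs'⟩ := exists_deriv_eq_slope f hvu hf.differentiable.continuous.continuousOn
        hf.differentiable.differentiableOn
    have e : speed f u v = deriv f s := by rw [hs', speed_comm]; rfl
    -- The mean value point cannot be in `[-V, V]`, where `f' < σ`. To the right of it `f'` is
    -- increasing.
    have hs0 : V < s := by
      by_contra hh
      have := hlow s (abs_le.2 ⟨by linarith [hs.1], not_lt.1 hh⟩)
      linarith
    rw [dissipation_comm]
    refine neg_ne_zero.2 (dissipation_pos_of_sign hU hf.differentiable (s := s) hvu ?_).ne'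
    intro x hx hxs
    rw [speed_comm, e]
    rcases lt_or_gt_of_ne hxs with h | h
    · have : deriv f x < deriv f s := by
        rcases le_total 0 x with hx0 | hx0
        · exact hf.strictMonoOn_deriv hx0 (hx0.trans h.le) h
        · rw [← e]
          exact hlow x (abs_le.2 ⟨by linarith [hx.1], by linarith⟩)
      nlinarith
    · have : deriv f s < deriv f x := hf.strictMonoOn_deriv (by rw [mem_Ici]; linarith)
        (by rw [mem_Ici]; linarith) h
      nlinarith
  · rw [abs_of_neg hu0] at hu
    have hvn : 0 ≤ v := by
      by_contra hh
      nlinarith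
    have hvu : u < v := by linarith
    obtain ⟨s, hs, hs'⟩ := exists_deriv_eq_slope f hvu hf.differentiable.continuous.continuousOn
        hf.differentiable.differentiableOn
    have e : speed f u v = deriv f s := by rw [hs']; rfl
    have hs0 : s < -V := by
      by_contra hh
      have := hlow s (abs_le.2 ⟨not_lt.1 hh, by linarith [hs.2]⟩)
      linarith
    have hd : 0 < dissipation (-f) U (-F) u v := by
      refine dissipation_pos_of_sign hU.neg hf.differentiable.neg (s := s) hvu ?_
      intro x hx hxs
      rw [speed_neg, deriv_neg_fun, e]
      rcases lt_or_gt_of_ne hxs with h | h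
      · have : deriv f s < deriv f x := hf.strictAntiOn_deriv (by rw [mem_Iic]; linarith)
          (by rw [mem_Iic]; linarith) h
        nlinarith
      · have : deriv f x < deriv f s := by
          rcases le_total x 0 with hx0 | hx0
          · exact hf.strictAntiOn_deriv (h.le.trans hx0) hx0 h
          · rw [← e]
            exact hlow x (abs_le.2 ⟨by linarith, by linarith [hx.2]⟩)
        nlinarith
    rw [dissipation_neg] at hd
    exact fun h => by rw [h] at hd; simp at hd

/-- In the convex-concave case the bound of `φ` nearer to `0` is `φ₀^♭`, so both the sign and the
unboundedness come from the entropy dissipation rather than from tangency. Everything is done for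
`-f`, which is concave-convex. -/
theorem IsKineticConvexConcave.isSignReversing {f U F φ : ℝ → ℝ} (hU : IsEntropyPair f U F)
    (hf : ConcaveConvex (-f)) (h0 : ∀ v, 0 ≤ deriv (-f) v)
    (hφ : IsKineticConvexConcave f U F φ) : IsSignReversing φ := by
  have hz : ∀ {u v}, IsZeroDissipationState f U F u v → dissipation (-f) U (-F) u v = 0 := by
    intro u v h
    rw [dissipation_neg, h.2, neg_zero]
  have hneg : ∀ u v, 0 < u → IsZeroDissipationState f U F u v → v < 0 := fun u v hu h =>
    not_le.1 fun hv => hf.dissipation_ne_zero hU.neg (S := Ici 0) (by simp [convexityRegions])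
      hu.le hv h.1.symm (hz h)
  have hpos : ∀ u v, u < 0 → IsZeroDissipationState f U F u v → 0 < v := fun u v hu h =>
    not_le.1 fun hv => hf.dissipation_ne_zero hU.neg (S := Iic 0) (by simp [convexityRegions])
      hu.le hv h.1.symm (hz h)
  obtain ⟨K, hK⟩ := hφ.lipschitz
  refine .of_unbounded hφ.strictAnti hK.continuous ?_ ?_ ?_
  · intro u hu
    obtain ⟨v₀, v₁, h1, -, -, h2⟩ := hφ.pos u hu
    exact h2.trans (hneg u v₀ hu h1)
  · intro u hu
    obtain ⟨v₀, v₁, h1, -, h2, -⟩ := hφ.neg u hu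
    exact (hpos u v₀ hu h1).trans h2
  · intro V hV
    obtain ⟨B, hB, h⟩ := hf.exists_dissipation_ne_zero h0 hU.neg V
    constructor
    · obtain ⟨v₀, v₁, h1, -, -, h2⟩ := hφ.pos B hB
      refine ⟨B, not_le.1 fun hle => ?_⟩
      have h3 := hneg B v₀ hB h1
      exact h B v₀ (le_abs_self B) (abs_le.2 ⟨by linarith, by linarith⟩) (by nlinarith) (hz h1)
    · obtain ⟨v₀, v₁, h1, -, h2, -⟩ := hφ.neg (-B) (by linarith)
      refine ⟨-B, not_le.1 fun hle => ?_⟩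
      have h3 := hpos (-B) v₀ (by linarith) h1
      exact h (-B) v₀ (by rw [abs_neg]; exact le_abs_self B) (abs_le.2 ⟨by linarith, by linarith⟩)
        (by nlinarith) (hz h1)

/-! ### One step of the upwind scheme -/

theorem ConcaveConvex.speed_pos {g : ℝ → ℝ} (hg : ConcaveConvex g) (h0 : ∀ v, 0 ≤ deriv g v)
    {a b : ℝ} (hab : a ≠ b) : 0 < speed g a b := by
  have hm : StrictMono g := by
    have h1 : StrictMonoOn g (Iic 0) := strictMonoOn_of_deriv_pos (convex_Iic 0)
      hg.differentiable.continuous.continuousOn fun x hx => by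
        rw [interior_Iic, mem_Iio] at hx
        exact hg.deriv_zero_lt h0 hx.ne
    have h2 : StrictMonoOn g (Ici 0) := strictMonoOn_of_deriv_pos (convex_Ici 0)
      hg.differentiable.continuous.continuousOn fun x hx => by
        rw [interior_Ici, mem_Ioi] at hx
        exact hg.deriv_zero_lt h0 hx.ne'
    exact h1.Iic_union_Ici h2
  rcases lt_or_gt_of_ne hab with h | h
  · exact div_pos (sub_pos.2 (hm h)) (sub_pos.2 h)
  · rw [speed_comm]
    exact div_pos (sub_pos.2 (hm h)) (sub_pos.2 h)

/-- The CFL condition concerns `f'` only at the states themselves. Inside one region the largest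
slope on a segment is at an end, so the mean value theorem extends the bound to chords. -/
theorem ConcaveConvex.mul_speed_le_one {g : ℝ → ℝ} (hg : ConcaveConvex g) {S : Set ℝ}
    (hS : S ∈ convexityRegions) {c a b : ℝ} (hc : 0 ≤ c) (ha : a ∈ S) (hb : b ∈ S)
    (ca : c * deriv g a ≤ 1) (cb : c * deriv g b ≤ 1) : c * speed g a b ≤ 1 := by
  wlog hab : a ≤ b generalizing a b
  · rw [speed_comm]
    exact this hb ha cb ca (le_of_not_ge hab)
  rcases hab.eq_or_lt with rfl | hab
  · simp [speed]
  obtain ⟨s, hs, hs'⟩ := exists_deriv_eq_slope g hab hg.differentiable.continuous.continuousOn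
    hg.differentiable.differentiableOn
  rw [speed, ← hs']
  refine hg.deriv_bound_of_mem hS hc ha hb ?_ ca cb
  rw [uIcc_of_le hab.le]
  exact Ioo_subset_Icc_self hs

/-- The upwind update of `b`, with upstream value `a`, is an average of `a` and `b`. -/
theorem ConcaveConvex.upwind_eq {g : ℝ → ℝ} (hg : ConcaveConvex g) (h0 : ∀ v, 0 ≤ deriv g v)
    {S : Set ℝ} (hS : S ∈ convexityRegions) {c a b : ℝ} (hc : 0 ≤ c) (ha : a ∈ S) (hb : b ∈ S)
    (ca : c * deriv g a ≤ 1) (cb : c * deriv g b ≤ 1) :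
    ∃ θ : ℝ, 0 ≤ θ ∧ θ ≤ 1 ∧ b - c * (g b - g a) = b - θ * (b - a) := by
  rcases eq_or_ne a b with rfl | hab
  · exact ⟨0, le_rfl, zero_le_one, by simp⟩
  · refine ⟨c * speed g a b, mul_nonneg hc (hg.speed_pos h0 hab).le,
      hg.mul_speed_le_one hS hc ha hb ca cb, ?_⟩
    rw [mul_assoc, speed, div_mul_cancel₀ _ (sub_ne_zero.2 hab.symm)]

theorem ConcaveConvex.upwind_mem_uIcc {g : ℝ → ℝ} (hg : ConcaveConvex g) (h0 : ∀ v, 0 ≤ deriv g v)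
    {S : Set ℝ} (hS : S ∈ convexityRegions) {c a b : ℝ} (hc : 0 ≤ c) (ha : a ∈ S) (hb : b ∈ S)
    (ca : c * deriv g a ≤ 1) (cb : c * deriv g b ≤ 1) : b - c * (g b - g a) ∈ uIcc a b := by
  obtain ⟨θ, h1, h2, h3⟩ := hg.upwind_eq h0 hS hc ha hb ca cb
  rw [h3, mem_uIcc]
  rcases le_total a b with h | h
  · exact Or.inl ⟨by nlinarith, by nlinarith⟩
  · exact Or.inr ⟨by nlinarith, by nlinarith⟩

/-- Let the upstream value `x` vary from `a` to `b`. At `x = b` there is equality. The derivative in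
`x` is `c g'(x)` times the difference of `V'` at the updated value and at `x`; as the updated value
is between `x` and `b`, this derivative has the sign that makes the quantity grow towards `x = b`.
-/
theorem ConcaveConvex.upwind_entropy {g V G : ℝ → ℝ} (hg : ConcaveConvex g)
    (h0 : ∀ v, 0 ≤ deriv g v) (hV : IsEntropyPair g V G)
    {S : Set ℝ} (hS : S ∈ convexityRegions) {c a b : ℝ} (hc : 0 ≤ c) (ha : a ∈ S) (hb : b ∈ S)
    (ca : c * deriv g a ≤ 1) (cb : c * deriv g b ≤ 1) :
    V (b - c * (g b - g a)) ≤ V b - c * (G b - G a) := by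
  set h := fun x => V (b - c * (g b - g x)) + c * (G b - G x) with hh
  have hd : ∀ x, HasDerivAt h (c * deriv g x * (deriv V (b - c * (g b - g x)) - deriv V x)) x := by
    intro x
    have h1 : HasDerivAt (fun x => b - c * (g b - g x)) (c * deriv g x) x :=
      ((((hg.hasDerivAt x).const_sub (g b)).const_mul c).const_sub b).congr_deriv (by ring)
    have h2 := (hV.hasDerivAt (b - c * (g b - g x))).comp x h1
    have h3 := ((hV.hasDerivAt_flux x).const_sub (G b)).const_mul c
    exact (h2.add h3).congr_deriv (by ring)
  have hcont : Continuous h := continuous_iff_continuousAt.2 fun x => (hd x).continuousAt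
  have hmem : ∀ x ∈ uIcc a b, b - c * (g b - g x) ∈ uIcc x b := fun x hx =>
    hg.upwind_mem_uIcc h0 hS hc (uIcc_subset_region hS ha hb hx) hb
      (hg.deriv_bound_of_mem hS hc ha hb hx ca cb) cb
  have hle : h a ≤ h b := by
    rcases le_total a b with hab | hab
    · refine monotoneOn_of_deriv_nonneg (convex_Icc a b) hcont.continuousOn
        (fun x _ => (hd x).differentiableAt.differentiableWithinAt) ?_
        (left_mem_Icc.2 hab) (right_mem_Icc.2 hab) hab
      intro x hx
      have hx' := interior_subset hx
      have hm := hmem x (by rwa [uIcc_of_le hab])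
      rw [uIcc_of_le hx'.2] at hm
      rw [(hd x).deriv]
      exact mul_nonneg (mul_nonneg hc (h0 x)) (sub_nonneg.2 (hV.strictMono_deriv.monotone hm.1))
    · refine antitoneOn_of_deriv_nonpos (convex_Icc b a) hcont.continuousOn
        (fun x _ => (hd x).differentiableAt.differentiableWithinAt) ?_
        (left_mem_Icc.2 hab) (right_mem_Icc.2 hab) hab
      intro x hx
      have hx' := interior_subset hx
      have hm := hmem x (by rwa [uIcc_of_ge hab])
      rw [uIcc_of_ge hx'.1] at hm
      rw [(hd x).deriv]
      exact mul_nonpos_of_nonneg_of_nonpos (mul_nonneg hc (h0 x))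
        (sub_nonpos.2 (hV.strictMono_deriv.monotone hm.2))
  simp only [hh, sub_self, mul_zero, sub_zero, add_zero] at hle
  linarith

/-! ### The reconstruction in a region of convexity -/

section Reconstruction

variable {φ : ℝ → ℝ} {u : ℤ → ℝ} {i : ℤ} {S : Set ℝ}

theorem IsSignReversing.map_zero (hφ : IsSignReversing φ) : φ 0 = 0 := by
  obtain ⟨v, hv⟩ := hφ.surjective 0
  rcases lt_trichotomy v 0 with h | h | h
  · exact absurd (hφ.pos_of_neg v h) (by rw [hv]; exact lt_irrefl 0)
  · rw [← h, hv, h]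
  · exact absurd (hφ.neg_of_pos v h) (by rw [hv]; exact lt_irrefl 0)

theorem IsSignReversing.nonpos_of_nonneg (hφ : IsSignReversing φ) {v : ℝ} (hv : 0 ≤ v) :
    φ v ≤ 0 := by
  have := hφ.strictAnti.antitone hv
  rwa [hφ.map_zero] at this

theorem IsSignReversing.nonneg_of_nonpos (hφ : IsSignReversing φ) {v : ℝ} (hv : v ≤ 0) :
    0 ≤ φ v := by
  have := hφ.strictAnti.antitone hv
  rwa [hφ.map_zero] at this

/-- Both states of the reconstruction are images, under `φ` or its inverse, of neighbours of `u i`,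
and so have the opposite weak sign. -/
theorem IsSignReversing.kinetic_sign (hφ : IsSignReversing φ) (hS : S ∈ convexityRegions)
    (hl : u (i - 1) ∈ S) (hc : u i ∈ S) (hr : u (i + 1) ∈ S) :
    (kineticLeft φ u i ≤ 0 ∧ kineticRight φ u i ≤ 0 ∧ 0 ≤ u i) ∨
      (0 ≤ kineticLeft φ u i ∧ 0 ≤ kineticRight φ u i ∧ u i ≤ 0) := by
  have hinv : φ (kineticLeft φ u i) = u (i + 1) := Function.invFun_eq (hφ.surjective _)
  rcases hS with rfl | rfl
  · refine Or.inr ⟨not_lt.1 fun h => ?_, hφ.nonneg_of_nonpos hl, hc⟩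
    have := hφ.pos_of_neg _ h
    rw [hinv] at this
    exact not_lt.2 hr this
  · refine Or.inl ⟨not_lt.1 fun h => ?_, hφ.nonpos_of_nonneg hl, hc⟩
    have := hφ.neg_of_pos _ h
    rw [hinv] at this
    exact not_lt.2 hr this

theorem Reconstructs.position_mul (h : Reconstructs φ u i) :
    position φ u i * (kineticRight φ u i - kineticLeft φ u i) = kineticRight φ u i - u i :=
  div_mul_cancel₀ _ (sub_ne_zero.2 h.1.symm)

/-- A position in `[0, 1]` would make `u i` a convex combination of two numbers of the opposite weak
sign. -/
theorem IsSignReversing.not_reconstructs (hφ : IsSignReversing φ) (hS : S ∈ convexityRegions)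
    (hl : u (i - 1) ∈ S) (hc : u i ∈ S) (hr : u (i + 1) ∈ S) (h0 : u i ≠ 0) :
    ¬ Reconstructs φ u i := by
  intro h
  have h1 := h.position_mul
  obtain ⟨-, h2, h3⟩ := h
  rcases hφ.kinetic_sign hS hl hc hr with ⟨a, b, c⟩ | ⟨a, b, c⟩
  · have : 0 < u i := lt_of_le_of_ne c h0.symm
    nlinarith
  · have : u i < 0 := lt_of_le_of_ne c h0
    nlinarith

/-- Zero is an extreme point of the half-line that contains both states. It can be a convex
combination of two distinct states only if it is one of them and carries all the weight. -/
theorem IsSignReversing.position_of_zero (hφ : IsSignReversing φ) (hS : S ∈ convexityRegions)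
    (hl : u (i - 1) ∈ S) (hc : u i ∈ S) (hr : u (i + 1) ∈ S) (h0 : u i = 0)
    (h : Reconstructs φ u i) :
    (position φ u i = 0 ∧ kineticRight φ u i = 0) ∨
      (position φ u i = 1 ∧ kineticLeft φ u i = 0) := by
  have h1 := h.position_mul
  rw [h0, sub_zero] at h1
  obtain ⟨hne, h2, h3⟩ := h
  rcases h2.eq_or_lt with h2 | h2
  · rw [← h2, zero_mul] at h1
    exact Or.inl ⟨h2.symm, h1.symm⟩
  rcases h3.eq_or_lt with h3 | h3
  · rw [h3] at h1
    exact Or.inr ⟨h3, by linarith⟩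
  exfalso
  rcases hφ.kinetic_sign hS hl hc hr with ⟨a, b, -⟩ | ⟨a, b, -⟩
  · have hR : kineticRight φ u i = 0 := by nlinarith
    have hL : kineticLeft φ u i = 0 := by nlinarith
    exact hne (hL.trans hR.symm)
  · have hR : kineticRight φ u i = 0 := by nlinarith
    have hL : kineticLeft φ u i = 0 := by nlinarith
    exact hne (hL.trans hR.symm)

theorem exists_region (a : ℝ) : ∃ S ∈ convexityRegions, a ∈ S ∧ (0 : ℝ) ∈ S := by
  rcases le_total a 0 with h | h
  · exact ⟨Iic 0, by simp [convexityRegions], h, self_mem_Iic⟩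
  · exact ⟨Ici 0, by simp [convexityRegions], h, self_mem_Ici⟩

/-- A front that starts at the far end of the cell does not cross it in one time step. -/
theorem le_div_speed_mul {g : ℝ → ℝ} (hg : ConcaveConvex g) (h0 : ∀ v, 0 ≤ deriv g v)
    {dt dx a b : ℝ} (hdt : 0 < dt) (hdx : 0 < dx) (hab : a ≠ b) (h : a = 0 ∨ b = 0)
    (ca : dt / dx * deriv g a ≤ 1) (cb : dt / dx * deriv g b ≤ 1) :
    dt ≤ 1 / speed g a b * dx := by
  -- One of the states is the inflection point, which belongs to both regions; the two states thus
  -- share a region and the chord bound applies.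
  have hs : dt / dx * speed g a b ≤ 1 := by
    rcases h with rfl | rfl
    · obtain ⟨S, hS, h1, h2⟩ := exists_region b
      exact hg.mul_speed_le_one hS (by positivity) h2 h1 ca cb
    · obtain ⟨S, hS, h1, h2⟩ := exists_region a
      exact hg.mul_speed_le_one hS (by positivity) h1 h2 ca cb
  have hp := hg.speed_pos h0 hab
  rw [div_mul_eq_mul_div, one_mul, le_div_iff₀ hp]
  rwa [div_mul_eq_mul_div, div_le_one hdx] at hs

/-- Only `u i = 0` needs an argument. If `d = 0`, the front starts at the left end with right state
`0` and does not arrive within `dt`, so the flux is `f 0`. If `d = 1`, the front leaves at once (`τ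
= 0`) and the left state `0` gives the flux. -/
theorem outFluxRight_eq {f : ℝ → ℝ} {dt dx : ℝ} (hf : ConcaveConvex f) (h0 : ∀ v, 0 ≤ deriv f v)
    (hφ : IsSignReversing φ) (hdt : 0 < dt) (hdx : 0 < dx) (hS : S ∈ convexityRegions)
    (hl : u (i - 1) ∈ S) (hc : u i ∈ S) (hr : u (i + 1) ∈ S) (hcfl : CFLAt f φ dt dx u i) :
    outFluxRight f φ dt dx u i = f (u i) := by
  unfold outFluxRight
  split_ifs with h
  swap
  · rfl
  have hz : u i = 0 := by
    by_contra h0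
    exact hφ.not_reconstructs hS hl hc hr h0 h
  obtain ⟨-, c1, c2⟩ := hcfl
  rw [leftState, if_pos h, abs_of_nonneg (h0 _)] at c1
  rw [rightState, if_pos h, abs_of_nonneg (h0 _)] at c2
  simp only [leftState, rightState, if_pos h]
  rcases hφ.position_of_zero hS hl hc hr hz h with ⟨h1, h2⟩ | ⟨h1, h2⟩
  · have hτ := le_div_speed_mul hf h0 hdt hdx h.1 (Or.inr h2) c1 c2
    rw [h1, sub_zero, min_eq_right hτ, max_eq_right (sub_nonpos.2 hτ), h2, hz]
    field_simp
    ring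
  · rw [h1, h2, sub_self, zero_div, zero_mul, min_eq_left hdt.le, sub_zero, max_eq_left hdt.le, hz]
    field_simp
    ring

/-- The mirror image: for leftward fronts it is `d = 0` that gives `τ = 0`, with the right state `0`
in the flux, and `d = 1` that gives a front too slow to cross the cell. -/
theorem outFluxLeft_eq {f : ℝ → ℝ} {dt dx : ℝ} (hf : ConcaveConvex (-f))
    (h0 : ∀ v, 0 ≤ deriv (-f) v)
    (hφ : IsSignReversing φ) (hdt : 0 < dt) (hdx : 0 < dx) (hS : S ∈ convexityRegions)
    (hl : u (i - 1) ∈ S) (hc : u i ∈ S) (hr : u (i + 1) ∈ S) (hcfl : CFLAt f φ dt dx u i) :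
    outFluxLeft f φ dt dx u i = f (u i) := by
  unfold outFluxLeft
  split_ifs with h
  swap
  · rfl
  have hz : u i = 0 := by
    by_contra h0
    exact hφ.not_reconstructs hS hl hc hr h0 h
  obtain ⟨-, c1, c2⟩ := hcfl
  have habs : ∀ v, |deriv f v| = deriv (-f) v := by
    intro v
    have := h0 v
    rw [deriv_neg_fun] at this ⊢
    exact abs_of_nonpos (by linarith)
  rw [leftState, if_pos h, habs] at c1
  rw [rightState, if_pos h, habs] at c2
  simp only [leftState, rightState, if_pos h]
  rw [← speed_neg]
  rcases hφ.position_of_zero hS hl hc hr hz h with ⟨h1, h2⟩ | ⟨h1, h2⟩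
  · rw [h1, h2, zero_div, zero_mul, min_eq_left hdt.le, sub_zero, max_eq_left hdt.le, hz]
    field_simp
    ring
  · have hτ := le_div_speed_mul hf h0 hdt hdx h.1 (Or.inl h2) c1 c2
    rw [h1, min_eq_right hτ, max_eq_right (sub_nonpos.2 hτ), h2, hz]
    field_simp
    ring

/-- A monotone flux for which the scheme transports values by `a` cells, `a ∈ {0, 1}` being the index
shift of the upwind cell, together with the monotone increasing flux `g = ± f`. -/
structure UpwindData (f φ : ℝ → ℝ) (g : ℝ → ℝ) (ς : ℝ) (a : ℤ) : Prop where
  kinetic : IsSignReversing φ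
  concaveConvex : ConcaveConvex g
  nonneg : ∀ v, 0 ≤ deriv g v
  cases : (g = f ∧ ς = 1 ∧ a = 0 ∧ ∀ v, 0 ≤ deriv f v) ∨
    (g = -f ∧ ς = -1 ∧ a = 1 ∧ ¬ ∀ v, 0 ≤ deriv f v)

/-! ### Both wind directions reduced to one increasing flux -/

variable {f g : ℝ → ℝ} {ς : ℝ} {a : ℤ}

/-- The behaviour of `f'` at infinity decides which of the two monotonicity assumptions can hold:
`f' ≥ 0` in the concave-convex case, `f' ≤ 0` in the convex-concave case. -/
theorem exists_upwindData {U F : ℝ → ℝ} (hUF : IsEntropyPair f U F)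
    (hf : (ConcaveConvex f ∧ IsKineticConcaveConvex f U F φ) ∨
      (ConvexConcave f ∧ IsKineticConvexConcave f U F φ))
    (hmono : (∀ v : ℝ, 0 ≤ deriv f v) ∨ (∀ v : ℝ, deriv f v ≤ 0)) :
    ∃ g ς a, UpwindData f φ g ς a := by
  rcases hf with ⟨hf, hφ⟩ | ⟨hf, hφ⟩
  · have h0 : ∀ v, 0 ≤ deriv f v := by
      rcases hmono with h | h
      · exact h
      · obtain ⟨v, hv⟩ := hf.exists_deriv_pos
        exact absurd (h v) (not_le.2 hv)
    exact ⟨f, 1, 0, hφ.isSignReversing hf h0, hf, h0, Or.inl ⟨rfl, rfl, rfl, h0⟩⟩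
  · obtain ⟨v, hv⟩ := hf.neg.exists_deriv_pos
    rw [deriv_neg_fun] at hv
    have h0 : ∀ v, 0 ≤ deriv (-f) v := by
      rcases hmono with h | h
      · exact absurd (h v) (by linarith)
      · intro v
        rw [deriv_neg_fun]
        linarith [h v]
    exact ⟨-f, -1, 1, hφ.isSignReversing hUF hf.neg h0, hf.neg, h0,
      Or.inr ⟨rfl, rfl, rfl, fun h => by linarith [h v]⟩⟩

namespace UpwindData

/-- For `a = 0` the index `j + 2 * a - 1` is `j - 1`, for `a = 1` it is `j + 1`; the sign `ς` makes
the difference always read "cell minus upstream cell". -/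
theorem upwindValue_sub (h : UpwindData f φ g ς a) (G : ℝ → ℝ) (u : ℤ → ℝ) (j : ℤ) :
    upwindValue f G u j - upwindValue f G u (j - 1) =
      ς * (G (u j) - G (u (j + 2 * a - 1))) := by
  rcases h.cases with ⟨-, rfl, rfl, hf⟩ | ⟨-, rfl, rfl, hf⟩
  · simp [upwindValue, hf]
  · simp only [upwindValue, if_neg hf]
    ring_nf

theorem upwindValue_eq (h : UpwindData f φ g ς a) (G : ℝ → ℝ) (u : ℤ → ℝ) (j : ℤ) :
    upwindValue f G u j = G (u (j + a)) := by
  rcases h.cases with ⟨-, rfl, rfl, hf⟩ | ⟨-, rfl, rfl, hf⟩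
  · simp [upwindValue, hf]
  · simp only [upwindValue, if_neg hf]

theorem flux_eq (h : UpwindData f φ g ς a) (v : ℝ) : g v = ς * f v := by
  rcases h.cases with ⟨rfl, rfl, rfl, hf⟩ | ⟨rfl, rfl, rfl, hf⟩ <;> simp

theorem abs_deriv (h : UpwindData f φ g ς a) (v : ℝ) : |deriv f v| = deriv g v := by
  have h0 := h.nonneg v
  rcases h.cases with ⟨rfl, rfl, rfl, hf⟩ | ⟨rfl, rfl, rfl, hf⟩
  · exact abs_of_nonneg h0
  · rw [deriv_neg_fun] at h0 ⊢
    exact abs_of_nonpos (by linarith)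

theorem entropyPair (h : UpwindData f φ g ς a) {V G : ℝ → ℝ} (hV : IsEntropyPair f V G) :
    IsEntropyPair g V (fun v => ς * G v) := by
  rcases h.cases with ⟨rfl, rfl, rfl, hf⟩ | ⟨rfl, rfl, rfl, hf⟩
  · simpa using hV
  · have : (fun v => -1 * G v) = -G := by ext; simp
    rw [this]
    exact hV.neg

/-- The index of the upstream cell of cell `j` is `j + 2 * a - 1`. -/
theorem upstream_eq (h : UpwindData f φ g ς a) (j : ℤ) :
    j + 2 * a - 1 = j - 1 ∨ j + 2 * a - 1 = j + 1 := by
  rcases h.cases with ⟨-, -, rfl, -⟩ | ⟨-, -, rfl, -⟩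
  · left; ring
  · right; ring

theorem upwindStep_eq (h : UpwindData f φ g ς a) (dt dx : ℝ) (u : ℤ → ℝ) (j : ℤ) :
    upwindStep f dt dx u j = u j - dt / dx * (g (u j) - g (u (j + 2 * a - 1))) := by
  rw [upwindStep, conservativeStep, h.upwindValue_sub, h.flux_eq, h.flux_eq]
  ring

theorem reconstructionStep_eq (h : UpwindData f φ g ς a) {dt dx : ℝ} (hdt : 0 < dt) (hdx : 0 < dx)
    {j : ℤ} (hS : S ∈ convexityRegions) (hu : ∀ i, j - 2 ≤ i → i ≤ j + 2 → u i ∈ S)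
    (hcfl : ∀ i, j - 1 ≤ i → i ≤ j + 1 → CFLAt f φ dt dx u i) :
    reconstructionStep f φ dt dx u j = upwindStep f dt dx u j := by
  simp only [reconstructionStep, upwindStep, conservativeStep, reconstructionFlux, upwindValue]
  have hg := h.concaveConvex
  have h0 := h.nonneg
  rcases h.cases with ⟨rfl, rfl, rfl, hf⟩ | ⟨rfl, rfl, rfl, hf⟩
  · have key : ∀ i, j - 1 ≤ i → i ≤ j + 1 → outFluxRight g φ dt dx u i = g (u i) := fun i h1 h2 =>
      outFluxRight_eq hg h0 h.kinetic hdt hdx hS (hu _ (by lia) (by lia)) (hu _ (by lia) (by lia))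
        (hu _ (by lia) (by lia)) (hcfl i h1 h2)
    rw [if_pos hf, if_pos hf, if_pos hf, if_pos hf, key j (by lia) (by lia),
      key (j - 1) (by lia) (by lia)]
  · have key : ∀ i, j - 1 ≤ i → i ≤ j + 1 → outFluxLeft f φ dt dx u i = f (u i) := fun i h1 h2 =>
      outFluxLeft_eq hg h0 h.kinetic hdt hdx hS (hu _ (by lia) (by lia)) (hu _ (by lia) (by lia))
        (hu _ (by lia) (by lia)) (hcfl i h1 h2)
    rw [if_neg hf, if_neg hf, if_neg hf, if_neg hf, key (j + 1) (by lia) (by lia),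
      key (j - 1 + 1) (by lia) (by lia)]

theorem one_step (h : UpwindData f φ g ς a) {dt dx : ℝ} (hdt : 0 < dt) (hdx : 0 < dx)
    {j : ℤ} (hS : S ∈ convexityRegions) (hu : ∀ i, j - 2 ≤ i → i ≤ j + 2 → u i ∈ S)
    (hcfl : ∀ i, j - 1 ≤ i → i ≤ j + 1 → CFLAt f φ dt dx u i) :
    reconstructionStep f φ dt dx u j ∈ uIcc (u (j + 2 * a - 1)) (u j) ∧
      ∀ V G : ℝ → ℝ, IsEntropyPair f V G → V (reconstructionStep f φ dt dx u j) ≤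
        V (u j) - dt / dx * (upwindValue f G u j - upwindValue f G u (j - 1)) := by
  have hc : 0 ≤ dt / dx := by positivity
  have h1 : ∀ i, j - 1 ≤ i → i ≤ j + 1 → dt / dx * deriv g (u i) ≤ 1 := by
    intro i h1 h2
    rw [← h.abs_deriv]
    exact (hcfl i h1 h2).1
  have hj : j - 1 ≤ j + 2 * a - 1 ∧ j + 2 * a - 1 ≤ j + 1 := by
    rcases h.upstream_eq j with e | e <;> rw [e] <;> constructor <;> lia
  rw [h.reconstructionStep_eq hdt hdx hS hu hcfl, h.upwindStep_eq]
  refine ⟨h.concaveConvex.upwind_mem_uIcc h.nonneg hS hc (hu _ (by lia) (by lia))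
    (hu _ (by lia) (by lia)) (h1 _ hj.1 hj.2) (h1 _ (by lia) (by lia)), fun V G hV => ?_⟩
  refine (h.concaveConvex.upwind_entropy h.nonneg (h.entropyPair hV) hS hc (hu _ (by lia) (by lia))
    (hu _ (by lia) (by lia)) (h1 _ hj.1 hj.2) (h1 _ (by lia) (by lia))).trans (le_of_eq ?_)
  rw [h.upwindValue_sub]
  ring

theorem max_principle (h : UpwindData f φ g ς a) {dt dx : ℝ} (hdt : 0 < dt) (hdx : 0 < dx)
    {j : ℤ} (hS : S ∈ convexityRegions) (hu : ∀ i, j - 2 ≤ i → i ≤ j + 2 → u i ∈ S)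
    (hcfl : ∀ i, j - 1 ≤ i → i ≤ j + 1 → CFLAt f φ dt dx u i) :
    min (min (u (j - 1)) (u j)) (u (j + 1)) ≤ reconstructionStep f φ dt dx u j ∧
      reconstructionStep f φ dt dx u j ≤ max (max (u (j - 1)) (u j)) (u (j + 1)) := by
  have := (h.one_step hdt hdx hS hu hcfl).1
  rcases h.upstream_eq j with e | e <;> rw [e, uIcc, mem_Icc] at this
  · exact ⟨(min_le_left _ _).trans this.1, this.2.trans (le_max_left _ _)⟩
  · constructor
    · exact (le_min (min_le_right _ _) ((min_le_left _ _).trans (min_le_right _ _))).trans this.1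
    · exact this.2.trans (max_le (le_max_right _ _) ((le_max_right _ _).trans (le_max_left _ _)))

end UpwindData

end Reconstruction

/-! ### Total variation of sequences -/

theorem eVariationOn_int_le_tsum (u : ℤ → ℝ) :
    eVariationOn u univ ≤ ∑' j : ℤ, edist (u j) (u (j + 1)) := by
  have path : ∀ (a : ℤ) (n : ℕ), edist (u a) (u (a + n)) ≤
      ∑ j ∈ Finset.Ico a (a + n), edist (u j) (u (j + 1)) := by
    intro a n
    induction n with
    | zero => simp
    | succ n ih =>
      have : Finset.Ico a (a + (n + 1 : ℕ)) = insert (a + n) (Finset.Ico a (a + n)) := by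
        ext x
        simp only [Finset.mem_Ico, Finset.mem_insert]
        push_cast
        lia
      rw [this, Finset.sum_insert (by simp)]
      refine (edist_triangle _ (u (a + n)) _).trans
        ((add_le_add ih (le_of_eq ?_)).trans_eq (add_comm _ _))
      push_cast
      rw [add_assoc]
  have path' : ∀ a b : ℤ, a ≤ b → edist (u a) (u b) ≤
      ∑ j ∈ Finset.Ico a b, edist (u j) (u (j + 1)) := by
    intro a b hab
    have := path a (b - a).toNat
    rwa [Int.toNat_of_nonneg (by lia), add_sub_cancel] at this
  refine iSup_le fun p => ?_
  obtain ⟨n, s, hs, -⟩ := p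
  have main : ∀ n : ℕ, ∑ i ∈ Finset.range n, edist (u (s (i + 1))) (u (s i)) ≤
      ∑ j ∈ Finset.Ico (s 0) (s n), edist (u j) (u (j + 1)) := by
    intro n
    induction n with
    | zero => simp
    | succ n ih =>
      rw [Finset.sum_range_succ, edist_comm,
        ← Finset.Ico_union_Ico_eq_Ico (hs (Nat.zero_le n)) (hs (Nat.le_succ n)),
        Finset.sum_union (Finset.Ico_disjoint_Ico_consecutive _ _ _)]
      exact add_le_add ih (path' _ _ (hs (Nat.le_succ n)))
  exact (main n).trans (ENNReal.sum_le_tsum _)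

theorem tsum_le_eVariationOn_int (u : ℤ → ℝ) :
    ∑' j : ℤ, edist (u j) (u (j + 1)) ≤ eVariationOn u univ := by
  rw [ENNReal.tsum_eq_iSup_sum]
  refine iSup_le fun s => ?_
  -- A finite set of indices lies in `[-N, N]`, so its jumps are among those of the monotone walk
  -- from `-N` to `N + 1`.
  obtain ⟨N, hN⟩ : ∃ N : ℕ, ∀ j ∈ s, |j| ≤ N := by
    refine ⟨s.sup Int.natAbs, fun j hj => ?_⟩
    have := Finset.le_sup (f := Int.natAbs) hj
    rw [Int.abs_eq_natAbs]
    exact_mod_cast this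
  have hmono : Monotone fun i : ℕ => (-N + i : ℤ) := fun i k hik => by
    simp only
    lia
  refine le_trans ?_ (eVariationOn.sum_le (f := u) (n := 2 * N + 1) hmono fun i => mem_univ _)
  have hsub : s ⊆ (Finset.range (2 * N + 1)).image fun i : ℕ => (-N + i : ℤ) := by
    intro j hj
    have := abs_le.1 (hN j hj)
    exact Finset.mem_image.2 ⟨(j + N).toNat, Finset.mem_range.2 (by lia), by lia⟩
  refine (Finset.sum_le_sum_of_subset hsub).trans ?_
  rw [Finset.sum_image (by intro x _ y _ h; simpa using h)]
  refine Finset.sum_le_sum fun i _ => le_of_eq ?_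
  rw [edist_comm]
  push_cast
  rw [add_assoc]

theorem eVariationOn_int (u : ℤ → ℝ) :
    eVariationOn u univ = ∑' j : ℤ, edist (u j) (u (j + 1)) :=
  le_antisymm (eVariationOn_int_le_tsum u) (tsum_le_eVariationOn_int u)

theorem edist_add_edist_of_mem_uIcc {x y z : ℝ} (h : y ∈ uIcc x z) :
    edist x y + edist y z = edist x z := by
  simp only [edist_dist, Real.dist_eq]
  rw [← ENNReal.ofReal_add (abs_nonneg _) (abs_nonneg _)]
  congr 1
  rcases mem_uIcc.1 h with h | h
  · rw [abs_of_nonpos (by linarith), abs_of_nonpos (by linarith), abs_of_nonpos (by linarith)]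
    ring
  · rw [abs_of_nonneg (by linarith), abs_of_nonneg (by linarith), abs_of_nonneg (by linarith)]
    ring

/-- Replacing each value by one between it and its left neighbour does not increase the variation. -/
theorem eVariationOn_le_of_mem_uIcc (u w : ℤ → ℝ) (h : ∀ j, w j ∈ uIcc (u (j - 1)) (u j)) :
    eVariationOn w univ ≤ eVariationOn u univ := by
  rw [eVariationOn_int, eVariationOn_int]
  calc ∑' j : ℤ, edist (w j) (w (j + 1))
      ≤ ∑' j : ℤ, (edist (w j) (u j) + edist (u j) (w (j + 1))) :=
        ENNReal.tsum_le_tsum fun j => edist_triangle _ _ _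
    _ = ∑' j : ℤ, edist (w j) (u j) + ∑' j : ℤ, edist (u j) (w (j + 1)) := ENNReal.tsum_add
    -- Shifting one of the two sums brings `w (j + 1)` together with both `u j` and `u (j + 1)`,
    -- between which it lies. No finiteness is involved, the sums being in `[0, ∞]`.
    _ = ∑' j : ℤ, edist (w (j + 1)) (u (j + 1)) + ∑' j : ℤ, edist (u j) (w (j + 1)) := by
        rw [← (Equiv.addRight (1 : ℤ)).tsum_eq fun j => edist (w j) (u j)]
        rfl
    _ = ∑' j : ℤ, edist (u j) (u (j + 1)) := by
        rw [← ENNReal.tsum_add]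
        refine tsum_congr fun j => ?_
        have := h (j + 1)
        rw [add_sub_cancel_right] at this
        rw [add_comm, edist_add_edist_of_mem_uIcc this]

theorem UpwindData.variation_le {f φ g : ℝ → ℝ} {ς : ℝ} {a : ℤ} (h : UpwindData f φ g ς a)
    {dt dx : ℝ} (hdt : 0 < dt) (hdx : 0 < dx) {u : ℤ → ℝ} {S : Set ℝ} (hS : S ∈ convexityRegions)
    (hu : ∀ i, u i ∈ S) (hcfl : ∀ i, CFLAt f φ dt dx u i) :
    eVariationOn (reconstructionStep f φ dt dx u) univ ≤ eVariationOn u univ := by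
  have hm := fun j => (h.one_step (j := j) hdt hdx hS (fun i _ _ => hu i) fun i _ _ => hcfl i).1
  rcases h.cases with ⟨-, -, ha, -⟩ | ⟨-, -, ha, -⟩ <;> rw [ha] at hm
  · refine eVariationOn_le_of_mem_uIcc _ _ fun j => ?_
    have := hm j
    rwa [mul_zero, add_zero] at this
  -- When the upstream cell is on the right, the same argument applies to the shifted sequence,
  -- which has the same variation.
  · have := eVariationOn_le_of_mem_uIcc (fun j => u (j + 1)) (reconstructionStep f φ dt dx u) fun j => by
      have := hm j
      rw [uIcc_comm] at this
      convert this using 2 <;> ring_nf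
    refine this.trans (le_of_eq ?_)
    rw [eVariationOn_int, eVariationOn_int,
      ← (Equiv.addRight (1 : ℤ)).tsum_eq fun j => edist (u j) (u (j + 1))]
    rfl

/-! ### Translations and weak limits -/

/-- Translations are continuous in `L¹`. -/
theorem exists_lintegral_translate_le {E : Type*} [NormedAddCommGroup E] [NormedSpace ℝ E]
    [FiniteDimensional ℝ E] [MeasurableSpace E] [BorelSpace E] (μ : Measure E) [μ.IsAddHaarMeasure]
    {B : E → ℝ} (hB : Integrable B μ) {δ : ℝ} (hδ : 0 < δ) :
    ∃ r > 0, ∀ h : E, ‖h‖ ≤ r → ∫⁻ p, ‖B (p + h) - B p‖ₑ ∂μ ≤ ENNReal.ofReal δ := by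
  have : ProperSpace E := FiniteDimensional.proper ℝ E
  obtain ⟨g, hgc, hg, hcont, hint⟩ := hB.exists_hasCompactSupport_lintegral_sub_le
    (ε := ENNReal.ofReal (δ / 3)) (by simpa using hδ)
  -- This compact set contains the supports of `g` and of its translates by at most `1`, so uniform
  -- continuity of `g` becomes an `L¹` bound.
  set K := Metric.cthickening 1 (tsupport g) with hK
  have hKc : IsCompact K := hgc.isCompact.cthickening
  have hKf : μ K ≠ ⊤ := hKc.measure_lt_top.ne
  set η := δ / 3 / ((μ K).toReal + 1) with hη
  have hη0 : 0 < η := by positivity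
  obtain ⟨r, hr, hunif⟩ := Metric.uniformContinuous_iff.1
    (hgc.uniformContinuous_of_continuous hcont) η hη0
  refine ⟨min 1 (r / 2), by positivity, fun h hh => ?_⟩
  have h1 : ‖h‖ ≤ 1 := hh.trans (min_le_left _ _)
  have h2 : ‖h‖ < r := (hh.trans (min_le_right _ _)).trans_lt (by linarith)
  have hgle : ∫⁻ p, ‖g (p + h) - g p‖ₑ ∂μ ≤ ENNReal.ofReal (δ / 3) := by
    calc ∫⁻ p, ‖g (p + h) - g p‖ₑ ∂μ ≤ ∫⁻ p, K.indicator (fun _ => ENNReal.ofReal η) p ∂μ := by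
          refine lintegral_mono fun p => ?_
          by_cases hp : p ∈ K
          · rw [indicator_of_mem hp, ← ofReal_norm, ← dist_eq_norm]
            refine ENNReal.ofReal_le_ofReal (hunif ?_).le
            rwa [dist_eq_norm, add_sub_cancel_left]
          · have e1 : g p = 0 := image_eq_zero_of_notMem_tsupport fun hm =>
              hp (Metric.self_subset_cthickening _ hm)
            have e2 : g (p + h) = 0 := image_eq_zero_of_notMem_tsupport fun hm =>
              hp (Metric.mem_cthickening_of_dist_le p (p + h) 1 _ hm (by
                rw [dist_eq_norm, sub_add_cancel_left, norm_neg]; exact h1))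
            simp [e1, e2]
      _ = ENNReal.ofReal η * μ K := by
          rw [lintegral_indicator hKc.measurableSet, setLIntegral_const]
      _ ≤ ENNReal.ofReal (δ / 3) := by
          rw [← ENNReal.ofReal_toReal hKf, ← ENNReal.ofReal_mul hη0.le]
          refine ENNReal.ofReal_le_ofReal ?_
          rw [hη, div_mul_eq_mul_div, div_le_iff₀ (by positivity)]
          nlinarith [ENNReal.toReal_nonneg (a := μ K)]
  have hm1 : AEMeasurable (fun p => ‖B (p + h) - g (p + h)‖ₑ) μ :=
    ((hB.sub hint).comp_add_right h).aestronglyMeasurable.enorm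
  have hm2 : AEMeasurable (fun p => ‖g (p + h) - g p‖ₑ) μ :=
    ((hint.comp_add_right h).sub hint).aestronglyMeasurable.enorm
  calc ∫⁻ p, ‖B (p + h) - B p‖ₑ ∂μ
      ≤ ∫⁻ p, (‖B (p + h) - g (p + h)‖ₑ + ‖g (p + h) - g p‖ₑ + ‖B p - g p‖ₑ) ∂μ := by
        refine lintegral_mono fun p => ?_
        have e : B (p + h) - B p = (B (p + h) - g (p + h)) + (g (p + h) - g p) + (g p - B p) := by
          ring
        rw [e]
        refine (enorm_add_le _ _).trans (add_le_add (enorm_add_le _ _) (le_of_eq ?_))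
        rw [← enorm_neg, neg_sub]
    _ = (∫⁻ p, ‖B (p + h) - g (p + h)‖ₑ ∂μ + ∫⁻ p, ‖g (p + h) - g p‖ₑ ∂μ)
          + ∫⁻ p, ‖B p - g p‖ₑ ∂μ := by
        rw [lintegral_add_left' (hm1.fun_add hm2), lintegral_add_left' hm1]
    _ ≤ (ENNReal.ofReal (δ / 3) + ENNReal.ofReal (δ / 3)) + ENNReal.ofReal (δ / 3) := by
        refine add_le_add (add_le_add ?_ hgle) hg
        rw [lintegral_add_right_eq_self (fun p => ‖B p - g p‖ₑ) h]
        exact hg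
    _ = ENNReal.ofReal δ := by
        rw [← ENNReal.ofReal_add (by positivity) (by positivity),
          ← ENNReal.ofReal_add (by positivity) (by positivity)]
        congr 1
        ring

theorem integrable_of_measurable_of_bound {α : Type*} [MeasurableSpace α] {μ : Measure α}
    [IsFiniteMeasure μ] {f : α → ℝ} (hf : Measurable f) {C : ℝ} (hC : ∀ x, |f x| ≤ C) :
    Integrable f μ :=
  Integrable.of_bound hf.aestronglyMeasurable C (ae_of_all _ hC)

/-- Bounded sequences have weak limits along ultrafilters. -/
theorem exists_weak_limit {α : Type*} [MeasurableSpace α] (μ : Measure α) [IsFiniteMeasure μ]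
    {b : ℕ → α → ℝ} (hb : ∀ m, Measurable (b m)) {C : ℝ} (hC : ∀ m x, |b m x| ≤ C)
    (𝒱 : Ultrafilter ℕ) :
    ∃ B : α → ℝ, Measurable B ∧ Integrable B μ ∧ ∀ A : α → ℝ, Measurable A →
      ∀ C' : ℝ, (∀ x, |A x| ≤ C') →
      Tendsto (fun m => ∫ x, A x * b m x ∂μ) 𝒱 (𝓝 (∫ x, A x * B x ∂μ)) := by
  have hmem : ∀ m, MemLp (b m) 2 μ := fun m =>
    MemLp.of_bound (hb m).aestronglyMeasurable C (ae_of_all _ (hC m))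
  set x : ℕ → Lp ℝ 2 μ := fun m => (hmem m).toLp (b m) with hx
  obtain ⟨R, hR⟩ : ∃ R : ℝ, ∀ m, ‖x m‖ ≤ R := by
    refine ⟨(measureUnivNNReal μ : ℝ) ^ (ENNReal.toReal 2)⁻¹ * max C 0, fun m => ?_⟩
    have h1 : ∀ᵐ y ∂μ, ‖x m y‖ ≤ max C 0 := by
      filter_upwards [(hmem m).coeFn_toLp] with y hy
      rw [hx, hy]
      exact (hC m y).trans (le_max_left _ _)
    exact Lp.norm_le_of_ae_bound (le_max_right _ _) h1
  set y : ℕ → WeakDual ℝ (Lp ℝ 2 μ) := fun m =>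
    StrongDual.toWeakDual (InnerProductSpace.toDual ℝ (Lp ℝ 2 μ) (x m)) with hy
  -- Banach–Alaoglu in `L²`, identified with its dual. An ultrafilter on a compact set converges, so
  -- no subsequence has to be extracted.
  obtain ⟨Λ, -, hΛ⟩ := (WeakDual.isCompact_closedBall (𝕜 := ℝ) (E := Lp ℝ 2 μ) 0 R).ultrafilter_le_nhds'
    (𝒱.map y) (by
      refine Ultrafilter.mem_map.2 (mem_of_superset univ_mem fun m _ => ?_)
      simp only [mem_preimage, hy, Metric.mem_closedBall, dist_zero_right]
      exact ((InnerProductSpace.toDual ℝ (Lp ℝ 2 μ)).norm_map (x m)).trans_le (hR m))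
  set B₀ : Lp ℝ 2 μ := (InnerProductSpace.toDual ℝ (Lp ℝ 2 μ)).symm (WeakDual.toStrongDual Λ) with hB₀
  have hB₀Λ : ∀ z, inner ℝ B₀ z = Λ z := fun z => InnerProductSpace.toDual_symm_apply
  refine ⟨B₀, (Lp.stronglyMeasurable B₀).measurable,
    (Lp.memLp B₀).integrable (by norm_num), fun A hA C' hC' => ?_⟩
  have hAm : MemLp A 2 μ := MemLp.of_bound hA.aestronglyMeasurable C' (ae_of_all _ hC')
  have key : Tendsto (fun m => inner ℝ (x m) (hAm.toLp A)) 𝒱 (𝓝 (inner ℝ B₀ (hAm.toLp A))) := by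
    rw [hB₀Λ]
    have h1 : Tendsto y 𝒱 (𝓝 Λ) := hΛ
    exact ((WeakDual.eval_continuous (hAm.toLp A)).tendsto Λ).comp h1
  have e : ∀ z : Lp ℝ 2 μ, inner ℝ z (hAm.toLp A) = ∫ t, A t * z t ∂μ := by
    intro z
    rw [L2.inner_def]
    refine integral_congr_ae ?_
    filter_upwards [hAm.coeFn_toLp] with t ht
    rw [ht]
    simp
  simp only [e] at key
  refine key.congr fun m => integral_congr_ae ?_
  filter_upwards [(hmem m).coeFn_toLp] with t ht
  rw [hx, ht]

/-! ### Concentration of doubled variables -/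

/-- Nonnegative continuous kernels of integral one supported in the ball of radius `r`. -/
structure IsKernel (r : ℝ) (κ : ℝ × ℝ → ℝ) : Prop where
  continuous : Continuous κ
  hasCompactSupport : HasCompactSupport κ
  nonneg : ∀ h, 0 ≤ κ h
  integral_eq_one : ∫ h, κ h = 1
  norm_le : ∀ h, κ h ≠ 0 → ‖h‖ ≤ r

namespace IsKernel

variable {r : ℝ} {κ : ℝ × ℝ → ℝ}

theorem integrable (hκ : IsKernel r κ) : Integrable κ :=
  hκ.continuous.integrable_of_hasCompactSupport hκ.hasCompactSupport

theorem exists_bound (hκ : IsKernel r κ) : ∃ C, ∀ h, |κ h| ≤ C :=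
  hκ.hasCompactSupport.exists_bound_of_continuous hκ.continuous

theorem lintegral_eq_one (hκ : IsKernel r κ) : ∫⁻ h, ENNReal.ofReal (κ h) = 1 := by
  rw [← ofReal_integral_eq_lintegral_ofReal hκ.integrable (ae_of_all _ hκ.nonneg),
    hκ.integral_eq_one, ENNReal.ofReal_one]

theorem setIntegral_le_one (hκ : IsKernel r κ) (D : Set (ℝ × ℝ)) (p : ℝ × ℝ) :
    ∫ q in D, κ (q - p) ≤ 1 := by
  rw [← hκ.integral_eq_one, ← integral_sub_right_eq_self κ p]
  exact setIntegral_le_integral (hκ.integrable.comp_sub_right p)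
    (ae_of_all _ fun q => hκ.nonneg _)

end IsKernel

/-- The doubled functional. -/
def doubled (D : Set (ℝ × ℝ)) (κ w u v : ℝ × ℝ → ℝ) (g : ℝ → ℝ → ℝ) : ℝ :=
  ∫ z, w z.1 * g (u z.1) (v z.2) * κ (z.2 - z.1) ∂((volume.restrict D).prod (volume.restrict D))

/-- For the sequence `v`, doubling the variables in integrals of `g (u p, v m q)` has an effect that
is small, uniformly in `u`, eventually along `𝒱`, for kernels with small support. -/
def Undoubles (D : Set (ℝ × ℝ)) (v : ℕ → ℝ × ℝ → ℝ) (𝒱 : Ultrafilter ℕ) (M : ℝ)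
    (g : ℝ → ℝ → ℝ) : Prop :=
  ∀ W δ : ℝ, 0 < δ → ∃ r > 0, ∀ κ, IsKernel r κ → ∀ w u : ℝ × ℝ → ℝ, Measurable w →
    (∀ p, |w p| ≤ W) → Measurable u → (∀ p, |u p| ≤ M) → ∀ᶠ m in 𝒱,
      |doubled D κ w u (v m) g - ∫ p in D, w p * g (u p) (v m p)| ≤ δ

/-- Extending `B` by zero outside `D` lets the kernel act on the whole plane; its unit mass then
absorbs the term `B p`. -/
theorem setIntegral_kernel_sub {D : Set (ℝ × ℝ)} (hD : MeasurableSet D) {r : ℝ}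
    {κ : ℝ × ℝ → ℝ} (hκ : IsKernel r κ) {B : ℝ × ℝ → ℝ}
    (hBi : IntegrableOn B D) {p : ℝ × ℝ} (hp : p ∈ D) :
    (∫ q in D, B q * κ (q - p)) - B p =
      ∫ h, (D.indicator B (p + h) - D.indicator B p) * κ h := by
  obtain ⟨C, hC⟩ := hκ.exists_bound
  have hi : Integrable (D.indicator B) := hBi.integrable_indicator hD
  have h1 : ∫ q in D, B q * κ (q - p) = ∫ h, D.indicator B (p + h) * κ h := by
    rw [← integral_indicator hD, ← integral_add_left_eq_self _ p]
    refine integral_congr_ae (ae_of_all _ fun h => ?_)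
    simp only [indicator]
    split_ifs <;> simp
  have h2 : B p = ∫ h, D.indicator B p * κ h := by
    rw [integral_const_mul, hκ.integral_eq_one, mul_one, indicator_of_mem hp]
  rw [h1]
  nth_rewrite 1 [h2]
  rw [← integral_sub]
  · simp only [sub_mul]
  · exact (hi.comp_add_left p).mul_bdd (c := C) hκ.continuous.aestronglyMeasurable (ae_of_all _ hC)
  · exact hκ.integrable.const_mul _

theorem abs_mul_le_mul {a b A B : ℝ} (ha : |a| ≤ A) (hb : |b| ≤ B) : |a * b| ≤ A * B := by
  rw [abs_mul]
  exact mul_le_mul ha hb (abs_nonneg _) ((abs_nonneg _).trans ha)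

/-- By Fubini the convolution moves from `a` to `B`, so that the error is an average of translation
errors of `B` in `L¹`. Of `a` only a supremum bound enters, which is why the estimate is uniform in
the other function. -/
theorem doubled_sub_le {D : Set (ℝ × ℝ)} (hD : MeasurableSet D) (hfin : volume D ≠ ⊤) {W δ : ℝ}
    (hW : 0 ≤ W) (hδ : 0 ≤ δ) {r : ℝ}
    {κ : ℝ × ℝ → ℝ} (hκ : IsKernel r κ) {B : ℝ × ℝ → ℝ} (hB : Measurable B)
    (hBi : IntegrableOn B D)
    (htr : ∀ h, ‖h‖ ≤ r → ∫⁻ p, ‖D.indicator B (p + h) - D.indicator B p‖ₑ ≤ ENNReal.ofReal δ)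
    {a : ℝ × ℝ → ℝ} (ham : Measurable a) (ha : ∀ p, |a p| ≤ W) :
    |(∫ q in D, (∫ p in D, a p * κ (q - p)) * B q) - ∫ p in D, a p * B p| ≤ W * δ := by
  have : IsFiniteMeasure (volume.restrict D) := ⟨by simpa using hfin.lt_top⟩
  obtain ⟨C, hC⟩ := hκ.exists_bound
  have hBt : Measurable (D.indicator B) := hB.indicator hD
  have hint : Integrable (fun z : (ℝ × ℝ) × (ℝ × ℝ) => B z.1 * (a z.2 * κ (z.1 - z.2)))
      ((volume.restrict D).prod (volume.restrict D)) := by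
    refine (Integrable.comp_fst hBi (volume.restrict D)).mul_bdd (c := W * C) ?_
      (ae_of_all _ fun z => abs_mul_le_mul (ha _) (hC _))
    exact ((ham.comp measurable_snd).mul
      (hκ.continuous.measurable.comp (measurable_fst.sub measurable_snd))).aestronglyMeasurable
  have e1 : ∫ q in D, (∫ p in D, a p * κ (q - p)) * B q =
      ∫ p in D, a p * ∫ q in D, B q * κ (q - p) := by
    have h1 : ∀ q, (∫ p in D, a p * κ (q - p)) * B q = ∫ p in D, B q * (a p * κ (q - p)) := by
      intro q
      rw [integral_const_mul, mul_comm]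
    have h2 : ∀ p, a p * ∫ q in D, B q * κ (q - p) = ∫ q in D, B q * (a p * κ (q - p)) := by
      intro p
      rw [← integral_const_mul]
      refine integral_congr_ae (ae_of_all _ fun q => ?_)
      ring
    simp only [h1, h2]
    exact integral_integral_swap hint
  have i1 : IntegrableOn (fun p => a p * ∫ q in D, B q * κ (q - p)) D := by
    refine Integrable.bdd_mul (c := W) ?_ ham.aestronglyMeasurable (ae_of_all _ ha)
    have hint' : Integrable (fun z : (ℝ × ℝ) × (ℝ × ℝ) => B z.1 * κ (z.1 - z.2))
        ((volume.restrict D).prod (volume.restrict D)) :=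
      (Integrable.comp_fst hBi (volume.restrict D)).mul_bdd (c := C)
        (hκ.continuous.comp (continuous_fst.sub continuous_snd)).aestronglyMeasurable
        (ae_of_all _ fun z => hC _)
    exact hint'.integral_prod_right
  have i2 : IntegrableOn (fun p => a p * B p) D :=
    hBi.bdd_mul ham.aestronglyMeasurable (ae_of_all _ ha)
  rw [e1, ← integral_sub i1 i2, ← Real.norm_eq_abs]
  have hle : ‖∫ p in D, (a p * ∫ q in D, B q * κ (q - p)) - a p * B p‖ₑ ≤ ENNReal.ofReal (W * δ) := by
    calc ‖∫ p in D, (a p * ∫ q in D, B q * κ (q - p)) - a p * B p‖ₑ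
        ≤ ∫⁻ p in D, ‖(a p * ∫ q in D, B q * κ (q - p)) - a p * B p‖ₑ :=
          enorm_integral_le_lintegral_enorm _
      _ ≤ ∫⁻ p in D, ENNReal.ofReal W *
            ∫⁻ h, ‖D.indicator B (p + h) - D.indicator B p‖ₑ * ENNReal.ofReal (κ h) := by
          refine setLIntegral_mono' hD fun p hp => ?_
          rw [← mul_sub, setIntegral_kernel_sub hD hκ hBi hp, enorm_mul]
          refine mul_le_mul' ?_ ?_
          · rw [← ofReal_norm]
            exact ENNReal.ofReal_le_ofReal (ha p)
          · refine (enorm_integral_le_lintegral_enorm _).trans (lintegral_mono fun h => ?_)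
            rw [enorm_mul, Real.enorm_of_nonneg (hκ.nonneg h)]
      _ ≤ ∫⁻ p, ENNReal.ofReal W *
            ∫⁻ h, ‖D.indicator B (p + h) - D.indicator B p‖ₑ * ENNReal.ofReal (κ h) :=
          setLIntegral_le_lintegral _ _
      _ = ENNReal.ofReal W * ∫⁻ h, ∫⁻ p,
            ‖D.indicator B (p + h) - D.indicator B p‖ₑ * ENNReal.ofReal (κ h) := by
          rw [lintegral_const_mul' _ _ ENNReal.ofReal_ne_top, lintegral_lintegral_swap]
          have h1 : Measurable fun z : (ℝ × ℝ) × (ℝ × ℝ) =>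
              D.indicator B (z.1 + z.2) - D.indicator B z.1 :=
            (hBt.comp (measurable_fst.add measurable_snd)).sub (hBt.comp measurable_fst)
          exact (h1.enorm.mul (ENNReal.measurable_ofReal.comp
            (hκ.continuous.measurable.comp measurable_snd))).aemeasurable
      _ ≤ ENNReal.ofReal W * ∫⁻ h, ENNReal.ofReal δ * ENNReal.ofReal (κ h) := by
          refine mul_le_mul_right (lintegral_mono fun h => ?_) _
          rw [lintegral_mul_const' _ _ ENNReal.ofReal_ne_top]
          rcases eq_or_ne (κ h) 0 with h0 | h0
          · simp [h0]
          · exact mul_le_mul_left (htr h (hκ.norm_le h h0)) _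
      _ = ENNReal.ofReal (W * δ) := by
          rw [lintegral_const_mul' _ _ ENNReal.ofReal_ne_top, hκ.lintegral_eq_one, mul_one,
            ENNReal.ofReal_mul hW]
  rw [← ofReal_norm] at hle
  exact (ENNReal.ofReal_le_ofReal_iff (mul_nonneg hW hδ)).1 hle

theorem measurable_kernel_sub {r : ℝ} {κ : ℝ × ℝ → ℝ} (hκ : IsKernel r κ) :
    Measurable fun z : (ℝ × ℝ) × (ℝ × ℝ) => κ (z.2 - z.1) :=
  hκ.continuous.measurable.comp (measurable_snd.sub measurable_fst)

theorem integrable_doubled {D : Set (ℝ × ℝ)} [IsFiniteMeasure (volume.restrict D)] {r : ℝ}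
    {κ w u v : ℝ × ℝ → ℝ} (hκ : IsKernel r κ) {W M C : ℝ} {g : ℝ → ℝ → ℝ}
    (hg : Measurable (Function.uncurry g)) (hgC : ∀ a b, |a| ≤ M → |b| ≤ M → |g a b| ≤ C)
    (hw : Measurable w) (hW : ∀ p, |w p| ≤ W) (hu : Measurable u) (hM : ∀ p, |u p| ≤ M)
    (hv : Measurable v) (hvM : ∀ p, |v p| ≤ M) :
    Integrable (fun z : (ℝ × ℝ) × (ℝ × ℝ) => w z.1 * g (u z.1) (v z.2) * κ (z.2 - z.1))
      ((volume.restrict D).prod (volume.restrict D)) := by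
  obtain ⟨K, hK⟩ := hκ.exists_bound
  refine integrable_of_measurable_of_bound (C := W * C * K) ?_ fun z =>
    abs_mul_le_mul (abs_mul_le_mul (hW _) (hgC _ _ (hM _) (hvM _))) (hK _)
  exact ((hw.comp measurable_fst).mul (hg.comp ((hu.comp measurable_fst).prodMk
    (hv.comp measurable_snd)))).mul (measurable_kernel_sub hκ)

theorem integrable_diagonal {D : Set (ℝ × ℝ)} [IsFiniteMeasure (volume.restrict D)]
    {w u v : ℝ × ℝ → ℝ} {W M C : ℝ} {g : ℝ → ℝ → ℝ}
    (hg : Measurable (Function.uncurry g)) (hgC : ∀ a b, |a| ≤ M → |b| ≤ M → |g a b| ≤ C)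
    (hw : Measurable w) (hW : ∀ p, |w p| ≤ W) (hu : Measurable u) (hM : ∀ p, |u p| ≤ M)
    (hv : Measurable v) (hvM : ∀ p, |v p| ≤ M) :
    IntegrableOn (fun p => w p * g (u p) (v p)) D :=
  integrable_of_measurable_of_bound (hw.mul (hg.comp (hu.prodMk hv))) fun _ =>
    abs_mul_le_mul (hW _) (hgC _ _ (hM _) (hvM _))

namespace Undoubles

variable {D : Set (ℝ × ℝ)} {v : ℕ → ℝ × ℝ → ℝ} {𝒱 : Ultrafilter ℕ} {M : ℝ}

/-- Both integrals pair `β (v m)` with a fixed bounded function, hence converge along `𝒱` to the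
pairings with the weak limit `B₀`. The two limits are close by `doubled_sub_le`, with a radius `r`
determined by `B₀` and the bounds, before `κ`, `w` and `u` are given. -/
theorem tensor (hD : MeasurableSet D) (hfin : volume D ≠ ⊤) (hv : ∀ m, Measurable (v m))
    (hvM : ∀ m p, |v m p| ≤ M) {α β : ℝ → ℝ} {A B : ℝ} (hα : Measurable α) (hαA : ∀ x, |α x| ≤ A)
    (hβ : Measurable β) (hβB : ∀ x, |x| ≤ M → |β x| ≤ B) :
    Undoubles D v 𝒱 M fun x y => α x * β y := by
  have : IsFiniteMeasure (volume.restrict D) := ⟨by simpa using hfin.lt_top⟩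
  intro W δ hδ
  obtain ⟨B₀, hB₀m, hB₀, hlim⟩ := exists_weak_limit (volume.restrict D)
    (b := fun m p => β (v m p)) (fun m => hβ.comp (hv m)) (C := B) (fun m p => hβB _ (hvM m p)) 𝒱
  set W' := max (W * A) 0 with hW'
  obtain ⟨r, hr, htr⟩ := exists_lintegral_translate_le volume
    (IntegrableOn.integrable_indicator hB₀ hD) (δ := δ / 2 / (W' + 1)) (by positivity)
  refine ⟨r, hr, fun κ hκ w u hw hwW hu huM => ?_⟩
  obtain ⟨K, hK⟩ := hκ.exists_bound
  set a : ℝ × ℝ → ℝ := fun p => w p * α (u p) with ha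
  have ham : Measurable a := hw.mul (hα.comp hu)
  have haW : ∀ p, |a p| ≤ W' := fun p =>
    (abs_mul_le_mul (hwW p) (hαA _)).trans (le_max_left _ _)
  have hm : Measurable fun z : (ℝ × ℝ) × (ℝ × ℝ) => a z.2 * κ (z.1 - z.2) :=
    (ham.comp measurable_snd).mul (hκ.continuous.measurable.comp (measurable_fst.sub measurable_snd))
  have hAm : Measurable fun q => ∫ p in D, a p * κ (q - p) :=
    (hm.stronglyMeasurable.integral_prod_right (ν := volume.restrict D)).measurable
  have hAb : ∀ q, |∫ p in D, a p * κ (q - p)| ≤ W' * K * (volume.restrict D).real univ := by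
    intro q
    rw [← Real.norm_eq_abs]
    exact norm_integral_le_of_norm_le_const (ae_of_all _ fun p => abs_mul_le_mul (haW p) (hK _))
  have l1 := hlim _ hAm _ hAb
  have l2 := hlim a ham _ haW
  have hlt : |(∫ q in D, (∫ p in D, a p * κ (q - p)) * B₀ q) - ∫ p in D, a p * B₀ p| < δ := by
    refine (doubled_sub_le hD hfin (le_max_right _ _) (by positivity) hκ hB₀m hB₀ htr ham haW).trans_lt
      ?_
    rw [← mul_div_assoc, div_lt_iff₀ (by positivity)]
    nlinarith [le_max_right (W * A) 0]
  have l3 := (l1.sub l2).abs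
  filter_upwards [l3.eventually (gt_mem_nhds hlt)] with m hm
  refine le_of_eq_of_le ?_ hm.le
  have hint : Integrable (fun z : (ℝ × ℝ) × (ℝ × ℝ) =>
      w z.1 * (α (u z.1) * β (v m z.2)) * κ (z.2 - z.1))
      ((volume.restrict D).prod (volume.restrict D)) :=
    integrable_doubled (g := fun x y => α x * β y) hκ
      ((hα.comp measurable_fst).mul (hβ.comp measurable_snd))
      (fun x y _ hy => abs_mul_le_mul (hαA x) (hβB y hy)) hw hwW hu huM (hv m) (hvM m)
  have e1 : doubled D κ w u (v m) (fun x y => α x * β y) =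
      ∫ q in D, (∫ p in D, a p * κ (q - p)) * β (v m q) := by
    rw [doubled, integral_prod_symm _ hint]
    refine integral_congr_ae (ae_of_all _ fun q => ?_)
    simp only
    rw [← integral_mul_const]
    refine integral_congr_ae (ae_of_all _ fun p => ?_)
    simp only [ha]
    ring
  rw [e1]
  simp only [ha, mul_assoc]

theorem zero : Undoubles D v 𝒱 M fun _ _ => 0 := by
  intro W δ hδ
  exact ⟨1, one_pos, fun κ _ w u _ _ _ _ => Eventually.of_forall fun m => by
    simp [doubled, hδ.le]⟩

theorem add (hfin : volume D ≠ ⊤) (hv : ∀ m, Measurable (v m))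
    (hvM : ∀ m p, |v m p| ≤ M) {g₁ g₂ : ℝ → ℝ → ℝ} {C₁ C₂ : ℝ}
    (m₁ : Measurable (Function.uncurry g₁)) (m₂ : Measurable (Function.uncurry g₂))
    (b₁ : ∀ a b, |a| ≤ M → |b| ≤ M → |g₁ a b| ≤ C₁) (b₂ : ∀ a b, |a| ≤ M → |b| ≤ M → |g₂ a b| ≤ C₂)
    (h₁ : Undoubles D v 𝒱 M g₁) (h₂ : Undoubles D v 𝒱 M g₂) :
    Undoubles D v 𝒱 M fun x y => g₁ x y + g₂ x y := by
  have : IsFiniteMeasure (volume.restrict D) := ⟨by simpa using hfin.lt_top⟩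
  intro W δ hδ
  obtain ⟨r₁, hr₁, k₁⟩ := h₁ W (δ / 2) (by positivity)
  obtain ⟨r₂, hr₂, k₂⟩ := h₂ W (δ / 2) (by positivity)
  refine ⟨min r₁ r₂, lt_min hr₁ hr₂, fun κ hκ w u hw hwW hu huM => ?_⟩
  have hκ₁ : IsKernel r₁ κ := { hκ with norm_le := fun h h0 => (hκ.norm_le h h0).trans (min_le_left _ _) }
  have hκ₂ : IsKernel r₂ κ := { hκ with norm_le := fun h h0 => (hκ.norm_le h h0).trans (min_le_right _ _) }
  filter_upwards [k₁ κ hκ₁ w u hw hwW hu huM, k₂ κ hκ₂ w u hw hwW hu huM] with m i₁ i₂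
  have e1 : doubled D κ w u (v m) (fun x y => g₁ x y + g₂ x y) =
      doubled D κ w u (v m) g₁ + doubled D κ w u (v m) g₂ := by
    rw [doubled, doubled, doubled, ← integral_add
      (integrable_doubled hκ m₁ b₁ hw hwW hu huM (hv m) (hvM m))
      (integrable_doubled hκ m₂ b₂ hw hwW hu huM (hv m) (hvM m))]
    refine integral_congr_ae (ae_of_all _ fun z => ?_)
    simp only
    ring
  have e2 : ∫ p in D, w p * (g₁ (u p) (v m p) + g₂ (u p) (v m p)) =
      (∫ p in D, w p * g₁ (u p) (v m p)) + ∫ p in D, w p * g₂ (u p) (v m p) := by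
    rw [← integral_add (integrable_diagonal m₁ b₁ hw hwW hu huM (hv m) (hvM m))
      (integrable_diagonal m₂ b₂ hw hwW hu huM (hv m) (hvM m))]
    simp only [mul_add]
  rw [e1, e2]
  rw [abs_le] at i₁ i₂ ⊢
  constructor <;> linarith [i₁.1, i₁.2, i₂.1, i₂.2]

/-- Replacing `g` by a uniformly close `g'` costs at most `T * η` in either integral, whatever the
kernel, since a kernel has mass at most one over `D`. -/
theorem approx (hfin : volume D ≠ ⊤) (hv : ∀ m, Measurable (v m))
    (hvM : ∀ m p, |v m p| ≤ M) {g : ℝ → ℝ → ℝ} {C : ℝ}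
    (mg : Measurable (Function.uncurry g)) (bg : ∀ a b, |a| ≤ M → |b| ≤ M → |g a b| ≤ C)
    (h : ∀ η : ℝ, 0 < η → ∃ g' : ℝ → ℝ → ℝ, Measurable (Function.uncurry g') ∧
      (∀ a b, |a| ≤ M → |b| ≤ M → |g a b - g' a b| ≤ η) ∧ Undoubles D v 𝒱 M g') :
    Undoubles D v 𝒱 M g := by
  have : IsFiniteMeasure (volume.restrict D) := ⟨by simpa using hfin.lt_top⟩
  intro W δ hδ
  set T := max W 0 * (volume.restrict D).real univ with hT
  have hT0 : 0 ≤ T := mul_nonneg (le_max_right _ _) measureReal_nonneg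
  set η := δ / 3 / (T + 1) with hη
  have hη0 : 0 < η := by positivity
  have hTη : T * η ≤ δ / 3 := by
    rw [hη, ← mul_div_assoc, div_le_iff₀ (by positivity)]
    nlinarith
  obtain ⟨g', mg', hg', hu'⟩ := h η hη0
  obtain ⟨r, hr, k⟩ := hu' W (δ / 3) (by positivity)
  refine ⟨r, hr, fun κ hκ w u hw hwW hu huM => ?_⟩
  filter_upwards [k κ hκ w u hw hwW hu huM] with m i
  have hwW' : ∀ p, |w p| ≤ max W 0 := fun p => (hwW p).trans (le_max_left _ _)
  have bg' : ∀ a b, |a| ≤ M → |b| ≤ M → |g' a b| ≤ C + η := by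
    intro a b ha hb
    have h1 := abs_le.1 (hg' a b ha hb)
    have h2 := abs_le.1 (bg a b ha hb)
    exact abs_le.2 ⟨by linarith, by linarith⟩
  have j1 : |doubled D κ w u (v m) g - doubled D κ w u (v m) g'| ≤ T * η := by
    rw [doubled, doubled, ← integral_sub
      (integrable_doubled hκ mg bg hw hwW hu huM (hv m) (hvM m))
      (integrable_doubled hκ mg' bg' hw hwW hu huM (hv m) (hvM m))]
    have hi : Integrable (fun z : (ℝ × ℝ) × (ℝ × ℝ) => max W 0 * η * κ (z.2 - z.1))
        ((volume.restrict D).prod (volume.restrict D)) := by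
      obtain ⟨K, hK⟩ := hκ.exists_bound
      exact (integrable_of_measurable_of_bound (measurable_kernel_sub hκ)
        fun z => hK _).const_mul _
    rw [← Real.norm_eq_abs]
    refine (norm_integral_le_of_norm_le hi (ae_of_all _ fun z => ?_)).trans ?_
    · rw [← sub_mul, ← mul_sub, Real.norm_eq_abs, abs_mul, abs_of_nonneg (hκ.nonneg _)]
      exact mul_le_mul_of_nonneg_right
        (abs_mul_le_mul (hwW' _) (hg' _ _ (huM _) (hvM _ _))) (hκ.nonneg _)
    · rw [integral_prod _ hi]
      have h1 : ∀ p, ∫ q in D, max W 0 * η * κ (q - p) ≤ max W 0 * η := by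
        intro p
        rw [integral_const_mul]
        exact mul_le_of_le_one_right (mul_nonneg (le_max_right _ _) hη0.le)
          (hκ.setIntegral_le_one D p)
      refine (integral_mono hi.integral_prod_left (integrable_const _) h1).trans (le_of_eq ?_)
      rw [integral_const, smul_eq_mul, hT]
      ring
  have j2 : |(∫ p in D, w p * g (u p) (v m p)) - ∫ p in D, w p * g' (u p) (v m p)| ≤ T * η := by
    rw [← integral_sub (integrable_diagonal mg bg hw hwW hu huM (hv m) (hvM m))
      (integrable_diagonal mg' bg' hw hwW hu huM (hv m) (hvM m))]
    rw [← Real.norm_eq_abs]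
    refine (norm_integral_le_of_norm_le_const (C := max W 0 * η) (ae_of_all _ fun p => ?_)).trans
      (le_of_eq ?_)
    · rw [← mul_sub]
      exact abs_mul_le_mul (hwW' _) (hg' _ _ (huM _) (hvM _ _))
    · rw [hT]
      ring
  rw [abs_le] at i j1 j2 ⊢
  constructor <;> linarith [i.1, i.2, j1.1, j1.2, j2.1, j2.2]

/-- Freezing the first argument at the left end of each interval of length `s` turns `g` into a
finite sum of tensor products, with an error of at most a Lipschitz constant times `s`. The
indicator factors need only be measurable, as they act on `u`, of which no limit is taken. -/
theorem of_lipschitz (hD : MeasurableSet D) (hfin : volume D ≠ ⊤) (hv : ∀ m, Measurable (v m))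
    (hvM : ∀ m p, |v m p| ≤ M) {g : ℝ → ℝ → ℝ} {L : ℝ} (hg : Continuous (Function.uncurry g))
    (hL : ∀ a a' b, |a| ≤ M → |a'| ≤ M → |b| ≤ M → |g a b - g a' b| ≤ L * |a - a'|) :
    Undoubles D v 𝒱 M g := by
  have bound : ∀ A, ∃ C, ∀ a b, |a| ≤ A → |b| ≤ M → |g a b| ≤ C := by
    intro A
    obtain ⟨C, hC⟩ := ((isCompact_Icc (a := -A) (b := A)).prod
      (isCompact_Icc (a := -M) (b := M))).exists_bound_of_continuousOn hg.continuousOn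
    exact ⟨C, fun a b ha hb => hC (a, b) ⟨abs_le.1 ha, abs_le.1 hb⟩⟩
  obtain ⟨C, hC⟩ := bound M
  refine approx hfin hv hvM hg.measurable hC fun η hη => ?_
  set s := η / (max L 0 + 1) with hs
  have hs0 : 0 < s := by positivity
  -- Enough intervals to cover `[-M, M]`; the additional one contains the right end. Arguments below
  -- `-M` also fall into `I 0`, but play no role.
  set n := ⌊2 * M / s⌋₊ + 1 with hn
  set I : ℕ → Set ℝ := fun i => {x | ⌊(x + M) / s⌋₊ = i} with hI
  have hIm : ∀ i, MeasurableSet (I i) := fun i =>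
    measurableSet_eq_fun (Nat.measurable_floor.comp (by fun_prop)) measurable_const
  set c : ℕ → ℝ := fun i => -M + i * s with hc
  set T : ℕ → ℝ → ℝ → ℝ := fun i x y => (I i).indicator 1 x * g (c i) y with hTdef
  have hTm : ∀ i, Measurable (Function.uncurry (T i)) := fun i =>
    ((measurable_one.indicator (hIm i)).comp measurable_fst).mul
      ((hg.measurable.comp (measurable_const.prodMk measurable_id)).comp measurable_snd)
  have hind : ∀ i x, |(I i).indicator (1 : ℝ → ℝ) x| ≤ 1 := by
    intro i x
    by_cases hx : x ∈ I i <;> simp [hx]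
  have hTb : ∀ i, ∃ C', ∀ a b, |a| ≤ M → |b| ≤ M → |T i a b| ≤ C' := by
    intro i
    obtain ⟨C', hC'⟩ := bound |c i|
    exact ⟨1 * C', fun a b _ hb => abs_mul_le_mul (hind i a) (hC' _ _ le_rfl hb)⟩
  have hTu : ∀ i, Undoubles D v 𝒱 M (T i) := by
    intro i
    obtain ⟨C', hC'⟩ := bound |c i|
    exact tensor hD hfin hv hvM (measurable_one.indicator (hIm i)) (hind i)
      (hg.measurable.comp (measurable_const.prodMk measurable_id)) fun y hy => hC' _ y le_rfl hy
  have hsum : ∀ k, (Measurable (Function.uncurry fun x y => ∑ i ∈ Finset.range k, T i x y)) ∧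
      (∃ C', ∀ a b, |a| ≤ M → |b| ≤ M → |∑ i ∈ Finset.range k, T i a b| ≤ C') ∧
      Undoubles D v 𝒱 M fun x y => ∑ i ∈ Finset.range k, T i x y := by
    intro k
    induction k with
    | zero =>
      simp only [Finset.range_zero, Finset.sum_empty]
      exact ⟨measurable_const, ⟨0, fun _ _ _ _ => by simp⟩, zero⟩
    | succ k ih =>
      obtain ⟨i1, ⟨C1, i2⟩, i3⟩ := ih
      obtain ⟨C2, i4⟩ := hTb k
      simp only [Finset.sum_range_succ]
      exact ⟨i1.add (hTm k), ⟨C1 + C2, fun a b ha hb =>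
        (abs_add_le _ _).trans (add_le_add (i2 a b ha hb) (i4 a b ha hb))⟩,
        add hfin hv hvM i1 (hTm k) i2 i4 i3 (hTu k)⟩
  refine ⟨_, (hsum n).1, fun a b ha hb => ?_, (hsum n).2.2⟩
  have ha' := abs_le.1 ha
  set k := ⌊(a + M) / s⌋₊ with hk
  have hkn : k ∈ Finset.range n := by
    rw [Finset.mem_range, hn, Nat.lt_succ_iff]
    exact Nat.floor_le_floor (by gcongr; linarith)
  have hval : ∑ i ∈ Finset.range n, T i a b = g (c k) b := by
    rw [Finset.sum_eq_single k]
    · have : a ∈ I k := rfl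
      simp [hTdef, this]
    · intro i _ hik
      have : a ∉ I i := fun h => hik (Eq.symm h)
      simp [hTdef, this]
    · exact fun h => absurd hkn h
  rw [hval]
  have h1 : (k : ℝ) ≤ (a + M) / s := Nat.floor_le (by apply div_nonneg <;> linarith)
  have h2 : (a + M) / s < k + 1 := Nat.lt_floor_add_one _
  rw [le_div_iff₀ hs0] at h1
  rw [div_lt_iff₀ hs0] at h2
  have hck : |c k| ≤ M := abs_le.2 ⟨by simp only [hc]; nlinarith [k.cast_nonneg (α := ℝ)],
    by simp only [hc]; linarith⟩
  have hac : |a - c k| ≤ s := abs_le.2 ⟨by simp only [hc]; linarith, by simp only [hc]; linarith⟩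
  calc |g a b - g (c k) b| ≤ L * |a - c k| := hL a (c k) b ha hck hb
    _ ≤ (max L 0 + 1) * s := mul_le_mul ((le_max_left L 0).trans (by linarith)) hac (abs_nonneg _)
        (by positivity)
    _ = η := by rw [hs]; field_simp

end Undoubles

/-! ### Test functions and entropy functionals -/

/-- Nonnegative test functions supported in a given ball, with a bound on their derivatives up to
order two. -/
structure IsTest (R B : ℝ) (ψ : ℝ × ℝ → ℝ) : Prop where
  contDiff : ContDiff ℝ ∞ ψ
  nonneg : ∀ p, 0 ≤ ψ p
  support : ∀ p, ψ p ≠ 0 → ‖p‖ ≤ R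
  lipschitz : ∀ p q, |ψ p - ψ q| ≤ B * ‖p - q‖
  lipschitz_fderiv : ∀ p q, ‖fderiv ℝ ψ p - fderiv ℝ ψ q‖ ≤ B * ‖p - q‖

/-- The left-hand side of the entropy inequality, with initial data, for the test function `ψ`. -/
def entropyFunctional (V G : ℝ → ℝ) (u₀ : ℝ → ℝ) (u ψ : ℝ × ℝ → ℝ) : ℝ :=
  (∫ p in halfPlane, (V (u p) * fderiv ℝ ψ p (0, 1) + G (u p) * fderiv ℝ ψ p (1, 0)))
    + ∫ x : ℝ, V (u₀ x) * ψ (x, 0)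

theorem measurableSet_halfPlane : MeasurableSet halfPlane :=
  measurableSet_lt measurable_const measurable_snd

namespace IsTest

variable {R B : ℝ} {ψ : ℝ × ℝ → ℝ}

theorem tsupport_subset (h : IsTest R B ψ) : tsupport ψ ⊆ Metric.closedBall 0 R :=
  closure_minimal (fun p hp => mem_closedBall_zero_iff.2 (h.support p hp)) Metric.isClosed_closedBall

theorem hasCompactSupport (h : IsTest R B ψ) : HasCompactSupport ψ :=
  HasCompactSupport.of_support_subset_isCompact (isCompact_closedBall 0 R)
    fun p hp => mem_closedBall_zero_iff.2 (h.support p hp)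

theorem fderiv_eq_zero (h : IsTest R B ψ) {p : ℝ × ℝ} (hp : R < ‖p‖) : fderiv ℝ ψ p = 0 := by
  by_contra hne
  have := h.tsupport_subset (support_fderiv_subset ℝ (Function.mem_support.2 hne))
  rw [mem_closedBall_zero_iff] at this
  linarith

theorem eq_zero (h : IsTest R B ψ) {p : ℝ × ℝ} (hp : R < ‖p‖) : ψ p = 0 := by
  by_contra hne
  have := h.support p hne
  linarith

theorem continuous (h : IsTest R B ψ) : Continuous ψ := h.contDiff.continuous

theorem continuous_fderiv (h : IsTest R B ψ) (e : ℝ × ℝ) : Continuous fun p => fderiv ℝ ψ p e :=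
  (h.contDiff.continuous_fderiv (by norm_num)).clm_apply continuous_const

theorem integrable_fderiv (h : IsTest R B ψ) (e : ℝ × ℝ) : Integrable fun p => fderiv ℝ ψ p e :=
  (h.continuous_fderiv e).integrable_of_hasCompactSupport (h.hasCompactSupport.fderiv_apply ℝ e)

theorem continuous_initial (h : IsTest R B ψ) : Continuous fun x : ℝ => ψ (x, 0) :=
  h.continuous.comp (by fun_prop)

theorem integrable_initial (h : IsTest R B ψ) : Integrable fun x : ℝ => ψ (x, 0) :=
  h.continuous_initial.integrable_of_hasCompactSupport
    (HasCompactSupport.of_support_subset_isCompact (isCompact_closedBall 0 R) fun x hx =>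
      mem_closedBall_zero_iff.2 ((le_max_left |x| |(0 : ℝ)|).trans (h.support _ hx)))

theorem mono (h : IsTest R B ψ) {R' B' : ℝ} (hR : R ≤ R') (hB : B ≤ B') : IsTest R' B' ψ where
  contDiff := h.contDiff
  nonneg := h.nonneg
  support p hp := (h.support p hp).trans hR
  lipschitz p q := (h.lipschitz p q).trans (by gcongr)
  lipschitz_fderiv p q := (h.lipschitz_fderiv p q).trans (by gcongr)

/-- The restriction of a smooth function on `ℝ × ℝ × P` to the slices of constant parameter are
uniformly test functions. -/
theorem exists_slices {P : Type*} [NormedAddCommGroup P] [NormedSpace ℝ P]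
    {Ψ : (ℝ × ℝ) × P → ℝ} (hΨ : ContDiff ℝ ∞ Ψ) (hc : HasCompactSupport Ψ) (h0 : ∀ z, 0 ≤ Ψ z) :
    ∃ R B : ℝ, ∀ y : P, IsTest R B fun p => Ψ (p, y) := by
  obtain ⟨R, hR⟩ := hc.isCompact.isBounded.subset_closedBall 0
  obtain ⟨K, hK⟩ := hΨ.lipschitzWith_of_hasCompactSupport hc (by norm_num)
  obtain ⟨K', hK'⟩ := (hΨ.fderiv_right (m := 1) (by norm_cast)).lipschitzWith_of_hasCompactSupport
    (hc.fderiv ℝ) (by norm_num)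
  refine ⟨R, max K K', fun y => ?_⟩
  have hfd : ∀ p, fderiv ℝ (fun p => Ψ (p, y)) p =
      (fderiv ℝ Ψ (p, y)).comp (ContinuousLinearMap.inl ℝ (ℝ × ℝ) P) := by
    intro p
    have h1 := (hΨ.differentiable (by norm_num) (p, y)).hasFDerivAt
    exact (h1.comp p (hasFDerivAt_prodMk_left p y)).fderiv
  have hn : ∀ p q : ℝ × ℝ, ‖((p, y) : (ℝ × ℝ) × P) - (q, y)‖ = ‖p - q‖ := by
    intro p q
    rw [Prod.mk_sub_mk, sub_self, Prod.norm_mk, norm_zero, max_eq_left (norm_nonneg _)]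
  refine ⟨hΨ.comp (contDiff_prodMk_left y), fun p => h0 _, fun p hp => ?_, fun p q => ?_, fun p q => ?_⟩
  · have := hR (subset_tsupport _ (Function.mem_support.2 hp))
    rw [mem_closedBall_zero_iff] at this
    exact (norm_fst_le _).trans this
  · have := hK.norm_sub_le (p, y) (q, y)
    rw [hn] at this
    exact this.trans (by gcongr; exact le_max_left _ _)
  · rw [hfd, hfd, ← ContinuousLinearMap.sub_comp]
    have := hK'.norm_sub_le (p, y) (q, y)
    rw [hn] at this
    refine (ContinuousLinearMap.opNorm_comp_le _ _).trans ((mul_le_of_le_one_right (norm_nonneg _)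
      (ContinuousLinearMap.norm_inl_le_one ℝ _ _)).trans (this.trans ?_))
    gcongr
    exact le_max_right _ _

theorem exists_of_contDiff {ψ : ℝ × ℝ → ℝ} (hψ : ContDiff ℝ ∞ ψ) (hc : HasCompactSupport ψ)
    (h0 : ∀ z, 0 ≤ ψ z) : ∃ R B : ℝ, IsTest R B ψ := by
  obtain ⟨R, hR⟩ := hc.isCompact.isBounded.subset_closedBall 0
  obtain ⟨K, hK⟩ := hψ.lipschitzWith_of_hasCompactSupport hc (by norm_num)
  obtain ⟨K', hK'⟩ := (hψ.fderiv_right (m := 1) (by norm_cast)).lipschitzWith_of_hasCompactSupport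
    (hc.fderiv ℝ) (by norm_num)
  refine ⟨R, max K K', hψ, h0, fun p hp => ?_, fun p q => ?_, fun p q => ?_⟩
  · exact mem_closedBall_zero_iff.1 (hR (subset_tsupport _ (Function.mem_support.2 hp)))
  · exact (hK.norm_sub_le p q).trans (by gcongr; exact le_max_left _ _)
  · exact (hK'.norm_sub_le p q).trans (by gcongr; exact le_max_right _ _)

end IsTest

section Functional

variable {R B M : ℝ} {ψ : ℝ × ℝ → ℝ} {u₀ : ℝ → ℝ} {u : ℝ × ℝ → ℝ} {V G V' G' : ℝ → ℝ}

theorem exists_bound_of_continuous {V : ℝ → ℝ} (hV : Continuous V) (M : ℝ) :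
    ∃ C, ∀ a, |a| ≤ M → |V a| ≤ C := by
  obtain ⟨C, hC⟩ := (isCompact_Icc (a := -M) (b := M)).exists_bound_of_continuousOn hV.continuousOn
  exact ⟨C, fun a ha => hC a (abs_le.1 ha)⟩

theorem integrable_comp_mul {α : Type*} [MeasurableSpace α] {μ : Measure α} {w θ : α → ℝ}
    (hV : Continuous V) (hw : Measurable w) (hM : ∀ x, |w x| ≤ M) (hθ : Integrable θ μ) :
    Integrable (fun x => V (w x) * θ x) μ := by
  obtain ⟨C, hC⟩ := exists_bound_of_continuous hV M
  exact hθ.bdd_mul (c := C) (hV.measurable.comp hw).aestronglyMeasurable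
    (ae_of_all _ fun x => hC _ (hM x))

theorem integrable_entropy (hψ : IsTest R B ψ) (hV : Continuous V) (hG : Continuous G)
    (hu : Measurable u) (hM : ∀ p, |u p| ≤ M) (μ : Measure (ℝ × ℝ)) (hμ : μ ≤ volume) :
    Integrable (fun p => V (u p) * fderiv ℝ ψ p (0, 1) + G (u p) * fderiv ℝ ψ p (1, 0)) μ :=
  (integrable_comp_mul hV hu hM ((hψ.integrable_fderiv _).mono_measure hμ)).add
    (integrable_comp_mul hG hu hM ((hψ.integrable_fderiv _).mono_measure hμ))

/-- A quantity that controls the dependence of the entropy functional on the entropy. -/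
def testMass (ψ : ℝ × ℝ → ℝ) : ℝ :=
  (∫ p in halfPlane, (|fderiv ℝ ψ p (0, 1)| + |fderiv ℝ ψ p (1, 0)|)) + ∫ x : ℝ, |ψ (x, 0)|

theorem testMass_nonneg (ψ : ℝ × ℝ → ℝ) : 0 ≤ testMass ψ :=
  add_nonneg (integral_nonneg fun _ => by positivity) (integral_nonneg fun _ => abs_nonneg _)

theorem entropyFunctional_sub_le (hψ : IsTest R B ψ) (hV : Continuous V) (hG : Continuous G)
    (hV' : Continuous V') (hG' : Continuous G') (hu : Measurable u) (hM : ∀ p, |u p| ≤ M)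
    (hu₀ : Measurable u₀) (hM₀ : ∀ x, |u₀ x| ≤ M) {η : ℝ}
    (h1 : ∀ a, |a| ≤ M → |V a - V' a| ≤ η) (h2 : ∀ a, |a| ≤ M → |G a - G' a| ≤ η) :
    |entropyFunctional V G u₀ u ψ - entropyFunctional V' G' u₀ u ψ| ≤ η * testMass ψ := by
  have i1 := integrable_entropy hψ hV hG hu hM (volume.restrict halfPlane) Measure.restrict_le_self
  have i2 := integrable_entropy hψ hV' hG' hu hM (volume.restrict halfPlane) Measure.restrict_le_self
  have j1 := integrable_comp_mul hV hu₀ hM₀ hψ.integrable_initial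
  have j2 := integrable_comp_mul hV' hu₀ hM₀ hψ.integrable_initial
  have e : entropyFunctional V G u₀ u ψ - entropyFunctional V' G' u₀ u ψ =
      (∫ p in halfPlane, ((V (u p) * fderiv ℝ ψ p (0, 1) + G (u p) * fderiv ℝ ψ p (1, 0)) -
        (V' (u p) * fderiv ℝ ψ p (0, 1) + G' (u p) * fderiv ℝ ψ p (1, 0)))) +
      ∫ x, (V (u₀ x) * ψ (x, 0) - V' (u₀ x) * ψ (x, 0)) := by
    rw [integral_sub i1 i2, integral_sub j1 j2, entropyFunctional, entropyFunctional]
    ring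
  rw [e, testMass, mul_add]
  refine (abs_add_le _ _).trans (add_le_add ?_ ?_)
  · rw [← integral_const_mul, ← Real.norm_eq_abs]
    refine norm_integral_le_of_norm_le
      (((hψ.integrable_fderiv _).abs.add (hψ.integrable_fderiv _).abs).const_mul η).integrableOn
      (ae_of_all _ fun p => ?_)
    rw [Real.norm_eq_abs, add_sub_add_comm, ← sub_mul, ← sub_mul, mul_add]
    exact (abs_add_le _ _).trans (add_le_add (abs_mul_le_mul (h1 _ (hM p)) le_rfl)
      (abs_mul_le_mul (h2 _ (hM p)) le_rfl))
  · rw [← integral_const_mul, ← Real.norm_eq_abs]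
    refine norm_integral_le_of_norm_le (hψ.integrable_initial.abs.const_mul η)
      (ae_of_all _ fun x => ?_)
    rw [← sub_mul]
    exact abs_mul_le_mul (h1 _ (hM₀ x)) le_rfl

end Functional

/-! ### Kruzhkov entropies -/

/-- The flux of the Kruzhkov entropy `|a - c|`. -/
def kruzhkovFlux (f : ℝ → ℝ) (a c : ℝ) : ℝ := f (max a c) - f (min a c)

theorem kruzhkovFlux_comm (f : ℝ → ℝ) (a c : ℝ) : kruzhkovFlux f a c = kruzhkovFlux f c a := by
  rw [kruzhkovFlux, kruzhkovFlux, max_comm, min_comm]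

theorem continuous_kruzhkovFlux {f : ℝ → ℝ} (hf : Continuous f) :
    Continuous (Function.uncurry (kruzhkovFlux f)) := by
  unfold kruzhkovFlux Function.uncurry
  fun_prop

theorem le_of_hasDerivAt_nonneg {k k' : ℝ → ℝ} (h : ∀ x, HasDerivAt k (k' x) x) {a b : ℝ}
    (hab : a ≤ b) (h0 : ∀ x ∈ Icc a b, 0 ≤ k' x) : k a ≤ k b := by
  refine monotoneOn_of_deriv_nonneg (convex_Icc a b)
    (continuous_iff_continuousAt.2 fun x => (h x).continuousAt).continuousOn
    (fun x _ => (h x).differentiableAt.differentiableWithinAt) ?_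
    (left_mem_Icc.2 hab) (right_mem_Icc.2 hab) hab
  intro x hx
  rw [(h x).deriv]
  exact h0 x (interior_subset hx)

theorem abs_sub_le_mul_of_deriv_le {f : ℝ → ℝ} (hf : ContDiff ℝ 1 f) {M L : ℝ}
    (hL : ∀ v, |v| ≤ M → |deriv f v| ≤ L) {a b : ℝ} (ha : |a| ≤ M) (hb : |b| ≤ M) :
    |f a - f b| ≤ L * |a - b| := by
  have hconv : Convex ℝ (Icc (-M) M) := convex_Icc _ _
  exact hconv.norm_image_sub_le_of_norm_deriv_le
    (fun x _ => (hf.differentiable (by norm_num)) x) (fun x hx => hL x (abs_le.2 hx))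
    (abs_le.1 hb) (abs_le.1 ha)

theorem abs_kruzhkovFlux_le {f : ℝ → ℝ} (hf : ContDiff ℝ 1 f) {M L : ℝ}
    (hL : ∀ v, |v| ≤ M → |deriv f v| ≤ L) {a b : ℝ} (ha : |a| ≤ M) (hb : |b| ≤ M) :
    |kruzhkovFlux f a b| ≤ L * |a - b| := by
  unfold kruzhkovFlux
  rcases le_total a b with h | h
  · rw [max_eq_right h, min_eq_left h, abs_sub_comm a b]
    exact abs_sub_le_mul_of_deriv_le hf hL hb ha
  · rw [max_eq_left h, min_eq_right h]
    exact abs_sub_le_mul_of_deriv_le hf hL ha hb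

theorem exists_deriv_bound {f : ℝ → ℝ} (hf : ContDiff ℝ 1 f) (M : ℝ) :
    ∃ L, 0 ≤ L ∧ ∀ v, |v| ≤ M → |deriv f v| ≤ L := by
  obtain ⟨C, hC⟩ := exists_bound_of_continuous (hf.continuous_deriv le_rfl) M
  exact ⟨max C 0, le_max_right _ _, fun v hv => (hC v hv).trans (le_max_left _ _)⟩

/-- The Kruzhkov entropies are limits of differentiable, strictly convex entropies. -/
theorem exists_entropyPair_near {f : ℝ → ℝ} (hf : ContDiff ℝ 1 f) {M L : ℝ}
    (hL : ∀ v, |v| ≤ M → |deriv f v| ≤ L) {c : ℝ} (hc : |c| ≤ M) {δ : ℝ} (hδ : 0 < δ) :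
    ∃ V G : ℝ → ℝ, IsEntropyPair f V G ∧ Continuous V ∧ Continuous G ∧
      ∀ a, |a| ≤ M → |V a - abs (a - c)| ≤ δ ∧ |G a - kruzhkovFlux f a c| ≤ L * δ := by
  -- A smooth, strictly convex function with `|x - c| ≤ V x ≤ |x - c| + δ`. Its flux is normalised
  -- to vanish at `c`, as the Kruzhkov flux does.
  set V : ℝ → ℝ := fun x => √((x - c) ^ 2 + δ ^ 2) with hVdef
  have hpos : ∀ x, 0 < (x - c) ^ 2 + δ ^ 2 := fun x => by positivity
  have hVpos : ∀ x, 0 < V x := fun x => Real.sqrt_pos.2 (hpos x)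
  have hVsq : ∀ x, V x ^ 2 = (x - c) ^ 2 + δ ^ 2 := fun x => Real.sq_sqrt (hpos x).le
  have hVd : ∀ x, HasDerivAt V ((x - c) / V x) x := by
    intro x
    have h1 : HasDerivAt (fun x => (x - c) ^ 2 + δ ^ 2) (2 * (x - c)) x := by
      have := (((hasDerivAt_id x).sub_const c).pow 2).add_const (δ ^ 2)
      simpa using this
    refine (h1.sqrt (hpos x).ne').congr_deriv ?_
    rw [mul_div_mul_left _ _ two_ne_zero]
  have hVderiv : deriv V = fun x => (x - c) / V x := funext fun x => (hVd x).deriv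
  have hVc : Continuous V := continuous_iff_continuousAt.2 fun x => (hVd x).continuousAt
  have habs : ∀ x, |x - c| ≤ V x := fun x => Real.abs_le_sqrt (by nlinarith)
  have hle : ∀ x, V x ≤ |x - c| + δ := fun x => by
    rw [hVdef]
    refine Real.sqrt_le_iff.2 ⟨by positivity, ?_⟩
    rw [add_sq, sq_abs]
    nlinarith [abs_nonneg (x - c)]
  have hVc' : V c = δ := by simp [hVdef, Real.sqrt_sq hδ.le]
  have hd1 : ∀ x, |(x - c) / V x| ≤ 1 := fun x => by
    rw [abs_div, abs_of_pos (hVpos x), div_le_one (hVpos x)]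
    exact habs x
  have hsm : StrictMono (deriv V) := by
    refine strictMono_of_hasDerivAt_pos (f' := fun x => δ ^ 2 / V x ^ 3) (fun x => ?_) fun x => ?_
    · rw [hVderiv]
      refine (((hasDerivAt_id x).sub_const c).div (hVd x) (hVpos x).ne').congr_deriv ?_
      have := (hVpos x).ne'
      simp only [id]
      field_simp
      rw [hVsq]
      ring
    · exact div_pos (by positivity) (pow_pos (hVpos x) 3)
  have hcont : Continuous fun x => (x - c) / V x * deriv f x :=
    ((by fun_prop : Continuous fun x : ℝ => x - c).div hVc fun x => (hVpos x).ne').mul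
      (hf.continuous_deriv le_rfl)
  set G : ℝ → ℝ := fun a => ∫ s in c..a, (s - c) / V s * deriv f s with hGdef
  have hGd : ∀ x, HasDerivAt G ((x - c) / V x * deriv f x) x := fun x =>
    hcont.integral_hasStrictDerivAt c x |>.hasDerivAt
  have hGc : G c = 0 := intervalIntegral.integral_same
  have hfd : ∀ x, HasDerivAt f (deriv f x) x := fun x =>
    (hf.differentiable (by norm_num) x).hasDerivAt
  refine ⟨V, G, ⟨hsm.strictConvexOn_univ_of_deriv hVc, fun x => (hVd x).differentiableAt,
    fun x => by rw [hVderiv]; exact hGd x⟩, hVc,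
    continuous_iff_continuousAt.2 fun x => (hGd x).continuousAt, fun a ha => ⟨?_, ?_⟩⟩
  · rw [abs_le]
    constructor <;> linarith [habs a, hle a]
  have ha' := abs_le.1 ha
  have hc' := abs_le.1 hc
  unfold kruzhkovFlux
  rcases le_total c a with h | h
  · rw [max_eq_left h, min_eq_right h]
    have hmem : ∀ x ∈ Icc c a, |deriv f x| ≤ L := fun x hx =>
      hL x (abs_le.2 ⟨hc'.1.trans hx.1, hx.2.trans ha'.2⟩)
    -- To the right of `c` one has `|f' - G'| = |f'| (1 - V') ≤ L (1 - V')`. Integrating from `c`,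
    -- where `V = δ`, bounds the flux error by `L (a - c - V a + δ) ≤ L δ`.
    have k1 := le_of_hasDerivAt_nonneg (k := fun x => L * (x - V x) - (f x - G x))
      (fun x => ((((hasDerivAt_id x).sub (hVd x)).const_mul L).sub ((hfd x).sub (hGd x)))) h
      (fun x hx => by
        nlinarith [abs_le.1 (hmem x hx), abs_le.1 (hd1 x)])
    have k2 := le_of_hasDerivAt_nonneg (k := fun x => L * (x - V x) + (f x - G x))
      (fun x => ((((hasDerivAt_id x).sub (hVd x)).const_mul L).add ((hfd x).sub (hGd x)))) h
      (fun x hx => by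
        nlinarith [abs_le.1 (hmem x hx), abs_le.1 (hd1 x)])
    simp only [hGc, hVc'] at k1 k2
    have hL0 : 0 ≤ L := (abs_nonneg _).trans (hL c hc)
    have h3 : L * (a - c) ≤ L * V a :=
      mul_le_mul_of_nonneg_left ((le_abs_self _).trans (habs a)) hL0
    rw [abs_le]
    constructor <;> nlinarith
  · rw [max_eq_right h, min_eq_left h]
    have hmem : ∀ x ∈ Icc a c, |deriv f x| ≤ L := fun x hx =>
      hL x (abs_le.2 ⟨ha'.1.trans hx.1, hx.2.trans hc'.2⟩)
    have k1 := le_of_hasDerivAt_nonneg (k := fun x => L * (x + V x) - (f x + G x))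
      (fun x => ((((hasDerivAt_id x).add (hVd x)).const_mul L).sub ((hfd x).add (hGd x)))) h
      (fun x hx => by
        nlinarith [abs_le.1 (hmem x hx), abs_le.1 (hd1 x)])
    have k2 := le_of_hasDerivAt_nonneg (k := fun x => L * (x + V x) + (f x + G x))
      (fun x => ((((hasDerivAt_id x).add (hVd x)).const_mul L).add ((hfd x).add (hGd x)))) h
      (fun x hx => by
        nlinarith [abs_le.1 (hmem x hx), abs_le.1 (hd1 x)])
    simp only [hGc, hVc'] at k1 k2
    have hL0 : 0 ≤ L := (abs_nonneg _).trans (hL c hc)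
    have h3 : L * (c - a) ≤ L * V a := by
      refine mul_le_mul_of_nonneg_left (le_trans ?_ (habs a)) hL0
      rw [abs_sub_comm]
      exact le_abs_self _
    rw [abs_le]
    constructor <;> nlinarith

theorem IsEntropyPair.continuous {f V G : ℝ → ℝ} (h : IsEntropyPair f V G) : Continuous V :=
  h.differentiable.continuous

theorem IsEntropyPair.continuous_flux {f V G : ℝ → ℝ} (h : IsEntropyPair f V G) : Continuous G :=
  continuous_iff_continuousAt.2 fun x => (h.hasDerivAt_flux x).continuousAt

/-! ### Asymptotic entropy solutions -/

/-- A uniformly bounded sequence of functions that satisfy the entropy inequalities up to errors that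
tend to zero, uniformly for bounded entropies and test functions. -/
structure AsymptoticSolution (f u₀ : ℝ → ℝ) (M : ℝ) (u : ℕ → ℝ × ℝ → ℝ) : Prop where
  measurable : ∀ k, Measurable (u k)
  bound : ∀ k p, |u k p| ≤ M
  entropy : ∀ R B N ε : ℝ, 0 < ε → ∀ᶠ k in atTop, ∀ V G : ℝ → ℝ, IsEntropyPair f V G →
    (∀ v, |v| ≤ M → |V v| ≤ N ∧ |G v| ≤ N) → ∀ ψ, IsTest R B ψ →
    -ε ≤ entropyFunctional V G u₀ (u k) ψ

/-- The uniformity in the definition of an asymptotic solution is used here: the regularised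
entropies have a common bound for all `c` and all `δ ≤ 1`, so one `k` serves every `c`. -/
theorem AsymptoticSolution.kruzhkov {f u₀ : ℝ → ℝ} (hf : ContDiff ℝ 1 f) {M : ℝ}
    {u : ℕ → ℝ × ℝ → ℝ} (hu : AsymptoticSolution f u₀ M u) (hu₀ : Measurable u₀)
    (hM₀ : ∀ x, |u₀ x| ≤ M) (R B ε : ℝ) (hε : 0 < ε) :
    ∀ᶠ k in atTop, ∀ c, |c| ≤ M → ∀ ψ, IsTest R B ψ →
      -ε ≤ entropyFunctional (fun a => |a - c|) (fun a => kruzhkovFlux f a c) u₀ (u k) ψ := by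
  obtain ⟨L, hL0, hL⟩ := exists_deriv_bound hf M
  -- On `[-M, M]` the regularised entropy is at most `2 M + δ` and its flux at most `2 M L + L δ`,
  -- with `δ ≤ 1`; the sum of the two bounds is taken.
  filter_upwards [hu.entropy R B (2 * M + 1 + L * (2 * M + 1)) (ε / 2) (by positivity)]
    with k hk c hc ψ hψ
  have hM : 0 ≤ M := (abs_nonneg c).trans hc
  set A := (1 + L) * testMass ψ with hA
  have hA0 : 0 ≤ A := mul_nonneg (by positivity) (testMass_nonneg ψ)
  -- The regularisation may depend on `ψ`, since `k` is already fixed.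
  set δ := min 1 (ε / 2 / (A + 1)) with hδ
  have hδ0 : 0 < δ := by positivity
  have hδ1 : δ ≤ 1 := min_le_left _ _
  obtain ⟨V, G, hVG, hVc, hGc, h⟩ := exists_entropyPair_near hf hL hc hδ0
  have h2M : ∀ a, |a| ≤ M → |a - c| ≤ 2 * M := fun a ha =>
    (abs_sub a c).trans (by linarith)
  have h1 := hk V G hVG (fun a ha => by
    obtain ⟨i1, i2⟩ := h a ha
    have i3 := h2M a ha
    have i4 := abs_kruzhkovFlux_le hf hL ha hc
    have i5 : L * |a - c| ≤ L * (2 * M) := by gcongr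
    have i6 : L * δ ≤ L * 1 := by gcongr
    rw [abs_le] at i1 i2 i4
    have i7 := abs_nonneg (a - c)
    have i8 : 0 ≤ L * (2 * M) := by positivity
    constructor <;> rw [abs_le] <;> constructor <;> linarith [i1.1, i1.2, i2.1, i2.2, i4.1, i4.2]) ψ hψ
  have h2 := entropyFunctional_sub_le (V := V) (G := G) (V' := fun a => |a - c|)
    (G' := fun a => kruzhkovFlux f a c) (η := (1 + L) * δ) hψ hVc hGc (by fun_prop)
    ((continuous_kruzhkovFlux hf.continuous).comp (by fun_prop : Continuous fun a => (a, c)))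
    (hu.measurable k) (hu.bound k) hu₀ hM₀ (fun a ha => (h a ha).1.trans (by nlinarith))
    (fun a ha => (h a ha).2.trans (by nlinarith))
  have h3 : (1 + L) * δ * testMass ψ ≤ ε / 2 := by
    calc (1 + L) * δ * testMass ψ = A * δ := by rw [hA]; ring
      _ ≤ A * (ε / 2 / (A + 1)) := by gcongr; exact min_le_right _ _
      _ ≤ ε / 2 := by
        rw [← mul_div_assoc, div_le_iff₀ (by positivity)]
        nlinarith
  have h4 := abs_le.1 (h2.trans h3)
  linarith [h4.2]

/-! ### Bounded functions -/

/-- The function `h` is bounded. -/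
def IsBdd {α : Type*} (h : α → ℝ) : Prop := ∃ C, ∀ x, |h x| ≤ C

namespace IsBdd

variable {α β : Type*} {h k : α → ℝ}

theorem add (hh : IsBdd h) (hk : IsBdd k) : IsBdd fun x => h x + k x := by
  obtain ⟨C, hC⟩ := hh
  obtain ⟨K, hK⟩ := hk
  exact ⟨C + K, fun x => (abs_add_le _ _).trans (add_le_add (hC x) (hK x))⟩

theorem sub (hh : IsBdd h) (hk : IsBdd k) : IsBdd fun x => h x - k x := by
  obtain ⟨C, hC⟩ := hh
  obtain ⟨K, hK⟩ := hk
  exact ⟨C + K, fun x => (abs_sub _ _).trans (add_le_add (hC x) (hK x))⟩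

theorem mul (hh : IsBdd h) (hk : IsBdd k) : IsBdd fun x => h x * k x := by
  obtain ⟨C, hC⟩ := hh
  obtain ⟨K, hK⟩ := hk
  exact ⟨C * K, fun x => abs_mul_le_mul (hC x) (hK x)⟩

theorem abs (hh : IsBdd h) : IsBdd fun x => |h x| := by
  obtain ⟨C, hC⟩ := hh
  exact ⟨C, fun x => by rw [abs_abs]; exact hC x⟩

theorem comp (hh : IsBdd h) (g : β → α) : IsBdd fun x => h (g x) := by
  obtain ⟨C, hC⟩ := hh
  exact ⟨C, fun x => hC _⟩

theorem const (c : ℝ) : IsBdd fun _ : α => c := ⟨|c|, fun _ => le_rfl⟩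

theorem of_hasCompactSupport {E : Type*} [TopologicalSpace E] {h : E → ℝ} (hc : Continuous h)
    (hs : HasCompactSupport h) : IsBdd h := hs.exists_bound_of_continuous hc

theorem integrable [MeasurableSpace α] {μ : Measure α} [IsFiniteMeasure μ] (hh : IsBdd h)
    (hm : Measurable h) : Integrable h μ := by
  obtain ⟨C, hC⟩ := hh
  exact integrable_of_measurable_of_bound hm hC

theorem kruzhkovFlux {f : ℝ → ℝ} (hf : Continuous f) {M : ℝ} (hh : ∀ x, |h x| ≤ M)
    (hk : ∀ x, |k x| ≤ M) : IsBdd fun x => kruzhkovFlux f (h x) (k x) := by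
  obtain ⟨C, hC⟩ := exists_bound_of_continuous hf M
  refine ⟨C + C, fun x => (abs_sub _ _).trans (add_le_add (hC _ ?_) (hC _ ?_))⟩
  · rcases max_choice (h x) (k x) with e | e <;> rw [e]
    exacts [hh x, hk x]
  · rcases min_choice (h x) (k x) with e | e <;> rw [e]
    exacts [hh x, hk x]

end IsBdd

theorem measurable_kruzhkovFlux {α : Type*} [MeasurableSpace α] {f : ℝ → ℝ} (hf : Continuous f)
    {h k : α → ℝ} (hh : Measurable h) (hk : Measurable k) :
    Measurable fun x => kruzhkovFlux f (h x) (k x) :=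
  (continuous_kruzhkovFlux hf).measurable.comp (hh.prodMk hk)

theorem neg_mul_le_integral {α : Type*} [MeasurableSpace α] {μ : Measure α} [IsFiniteMeasure μ]
    {h : α → ℝ} (hi : Integrable h μ) {e : ℝ} (he : ∀ᵐ x ∂μ, -e ≤ h x) :
    -(e * μ.real univ) ≤ ∫ x, h x ∂μ := by
  have := integral_mono_ae (integrable_const (-e)) hi he
  rw [integral_const, smul_eq_mul] at this
  linarith

/-! ### Doubling of variables -/

/-- The part of a ball that lies in the open half-plane. -/
def halfBall (R : ℝ) : Set (ℝ × ℝ) := halfPlane ∩ Metric.closedBall 0 R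

theorem measurableSet_halfBall (R : ℝ) : MeasurableSet (halfBall R) :=
  measurableSet_halfPlane.inter Metric.isClosed_closedBall.measurableSet

theorem volume_halfBall_ne_top (R : ℝ) : volume (halfBall R) ≠ ⊤ :=
  ((measure_mono inter_subset_right).trans_lt
    (isCompact_closedBall (0 : ℝ × ℝ) R).measure_lt_top).ne

instance (R : ℝ) : IsFiniteMeasure (volume.restrict (halfBall R)) :=
  ⟨by simpa using (volume_halfBall_ne_top R).lt_top⟩

/-- On sets of finite measure every bounded measurable integrand of the doubling argument is
integrable. -/
theorem entropyFunctional_eq {V G u₀ : ℝ → ℝ} {u ψ : ℝ × ℝ → ℝ} {R B : ℝ} (hψ : IsTest R B ψ) :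
    entropyFunctional V G u₀ u ψ =
      (∫ p in halfBall R, (V (u p) * fderiv ℝ ψ p (0, 1) + G (u p) * fderiv ℝ ψ p (1, 0)))
        + ∫ x in Icc (-R) R, V (u₀ x) * ψ (x, 0) := by
  unfold entropyFunctional
  congr 1
  · refine setIntegral_eq_of_subset_of_forall_sdiff_eq_zero measurableSet_halfPlane
      inter_subset_left fun p hp => ?_
    have : R < ‖p‖ := by
      by_contra h
      exact hp.2 ⟨hp.1, mem_closedBall_zero_iff.2 (not_lt.1 h)⟩
    simp [hψ.fderiv_eq_zero this]
  · refine (setIntegral_eq_integral_of_forall_compl_eq_zero fun x hx => ?_).symm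
    have : R < ‖((x, 0) : ℝ × ℝ)‖ := by
      by_contra h
      exact hx (abs_le.1 ((le_max_left |x| |(0 : ℝ)|).trans (not_lt.1 h)))
    rw [hψ.eq_zero this, mul_zero]

/-- The functions out of which the test functions of the doubling argument are built: `ζ` is the test
function in the result, `ρ` and `η` are kernels in space and time, and `-N` is a primitive of `η`. -/
structure DoublingData (ζ : ℝ × ℝ → ℝ) (ρ η N : ℝ → ℝ) : Prop where
  contDiff : ContDiff ℝ ∞ ζ
  hasCompactSupport : HasCompactSupport ζ
  contDiff_space : ContDiff ℝ ∞ ρ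
  hasCompactSupport_space : HasCompactSupport ρ
  nonneg_space : ∀ x, 0 ≤ ρ x
  contDiff_time : ContDiff ℝ ∞ η
  hasCompactSupport_time : HasCompactSupport η
  nonneg_time : ∀ t, 0 ≤ η t
  pos_of_ne_zero : ∀ t, η t ≠ 0 → 0 < t
  contDiff_primitive : ContDiff ℝ ∞ N
  hasCompactSupport_primitive : HasCompactSupport N
  primitive_zero : N 0 = 1
  hasDerivAt_primitive : ∀ t, 0 < t → HasDerivAt N (-η t) t

/-- The kernel with factors `ρ` and `η`. -/
def tensorKernel (ρ η : ℝ → ℝ) (h : ℝ × ℝ) : ℝ := ρ h.1 * η h.2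

namespace DoublingData

variable {ζ : ℝ × ℝ → ℝ} {ρ η N : ℝ → ℝ}

theorem contDiff_kernel (h : DoublingData ζ ρ η N) : ContDiff ℝ ∞ (tensorKernel ρ η) :=
  (h.contDiff_space.comp contDiff_fst).mul (h.contDiff_time.comp contDiff_snd)

theorem hasCompactSupport_kernel (h : DoublingData ζ ρ η N) :
    HasCompactSupport (tensorKernel ρ η) := by
  refine HasCompactSupport.intro (h.hasCompactSupport_space.isCompact.prod
    h.hasCompactSupport_time.isCompact) fun p hp => ?_
  by_contra hne
  exact hp ⟨subset_tsupport _ (left_ne_zero_of_mul hne), subset_tsupport _ (right_ne_zero_of_mul hne)⟩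

theorem kernel_nonneg (h : DoublingData ζ ρ η N) (p : ℝ × ℝ) : 0 ≤ tensorKernel ρ η p :=
  mul_nonneg (h.nonneg_space _) (h.nonneg_time _)

theorem kernel_eq_zero (h : DoublingData ζ ρ η N) {p : ℝ × ℝ} (hp : p.2 ≤ 0) :
    tensorKernel ρ η p = 0 := by
  have : η p.2 = 0 := by
    by_contra hne
    exact not_lt.2 hp (h.pos_of_ne_zero _ hne)
  rw [tensorKernel, this, mul_zero]

theorem fderiv_first (h : DoublingData ζ ρ η N) (p q e : ℝ × ℝ) :
    fderiv ℝ (fun p => ζ p * tensorKernel ρ η (q - p)) p e =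
      fderiv ℝ ζ p e * tensorKernel ρ η (q - p) - ζ p * fderiv ℝ (tensorKernel ρ η) (q - p) e := by
  have h1 := (h.contDiff.differentiable (by norm_num) p).hasFDerivAt
  have h2 := (h.contDiff_kernel.differentiable (by norm_num) (q - p)).hasFDerivAt.comp p
    ((hasFDerivAt_id p).const_sub q)
  have h3 := (h1.fun_mul h2).fderiv
  simp only [Function.comp_def] at h3
  rw [h3]
  simp
  ring

theorem fderiv_second (h : DoublingData ζ ρ η N) (p q e : ℝ × ℝ) :
    fderiv ℝ (fun q => ζ p * tensorKernel ρ η (q - p)) q e =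
      ζ p * fderiv ℝ (tensorKernel ρ η) (q - p) e := by
  have h2 := (h.contDiff_kernel.differentiable (by norm_num) (q - p)).hasFDerivAt.comp q
    ((hasFDerivAt_id q).sub_const p)
  have h3 := (h2.const_mul (ζ p)).fderiv
  simp only [Function.comp_def, id] at h3
  rw [h3]
  simp

theorem fderiv_layer (h : DoublingData ζ ρ η N) (x : ℝ) (q : ℝ × ℝ) (hq : 0 < q.2) (e : ℝ × ℝ) :
    fderiv ℝ (fun q : ℝ × ℝ => ζ (x, 0) * (ρ (q.1 - x) * N q.2)) q e =
      ζ (x, 0) * (deriv ρ (q.1 - x) * N q.2) * e.1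
        - ζ (x, 0) * tensorKernel ρ η (q - (x, 0)) * e.2 := by
  have h1 : HasFDerivAt (fun q : ℝ × ℝ => ρ (q.1 - x)) _ q :=
    (h.contDiff_space.differentiable (by norm_num) (q.1 - x)).hasDerivAt.comp_hasFDerivAt q
    ((hasFDerivAt_fst (𝕜 := ℝ) (p := q)).sub_const x)
  have h2 : HasFDerivAt (fun q : ℝ × ℝ => N q.2) _ q :=
    (h.hasDerivAt_primitive q.2 hq).comp_hasFDerivAt q
    (hasFDerivAt_snd (𝕜 := ℝ) (p := q))
  have h3 := ((h1.fun_mul h2).const_mul (ζ (x, 0))).fderiv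
  rw [h3]
  simp [tensorKernel]
  ring

/-- The doubled inequality, with the errors that come from the entropy inequalities (`e`) and from the
initial data. -/
theorem doubled_ge (h : DoublingData ζ ρ η N) {f u₀ : ℝ → ℝ} {u v : ℝ × ℝ → ℝ} {M R B e : ℝ}
    (hf : Continuous f) (hu₀ : Measurable u₀) (hM₀ : ∀ x, |u₀ x| ≤ M) (hu : Measurable u)
    (hM : ∀ p, |u p| ≤ M) (hv : Measurable v) (hvM : ∀ p, |v p| ≤ M)
    (t1 : ∀ q, IsTest R B fun p => ζ p * tensorKernel ρ η (q - p))
    (t2 : ∀ p, IsTest R B fun q => ζ p * tensorKernel ρ η (q - p))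
    (t3 : ∀ x : ℝ, IsTest R B fun q : ℝ × ℝ => ζ (x, 0) * (ρ (q.1 - x) * N q.2))
    (e1 : ∀ c, |c| ≤ M → ∀ ψ, IsTest R B ψ → -e ≤ entropyFunctional (fun a => |a - c|)
      (fun a => kruzhkovFlux f a c) u₀ u ψ)
    (e2 : ∀ c, |c| ≤ M → ∀ ψ, IsTest R B ψ → -e ≤ entropyFunctional (fun a => |a - c|)
      (fun a => kruzhkovFlux f a c) u₀ v ψ) :
    -(e * (2 * (volume.restrict (halfBall R)).real univ + (volume.restrict (Icc (-R) R)).real univ))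
      - (∫ z, kruzhkovFlux f (v z.2) (u₀ z.1) * (ζ (z.1, 0) * (deriv ρ (z.2.1 - z.1) * N z.2.2))
          ∂((volume.restrict (Icc (-R) R)).prod (volume.restrict (halfBall R))))
      - (∫ z, |u₀ z.2 - u₀ z.1| * (ζ (z.1, 0) * ρ (z.2 - z.1))
          ∂((volume.restrict (Icc (-R) R)).prod (volume.restrict (Icc (-R) R)))) ≤
    doubled (halfBall R) (tensorKernel ρ η) (fun p => fderiv ℝ ζ p (0, 1)) u v (fun a b => |a - b|) +
    doubled (halfBall R) (tensorKernel ρ η) (fun p => fderiv ℝ ζ p (1, 0)) u v (kruzhkovFlux f) := by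
  set κ := tensorKernel ρ η with hκ
  set μ := volume.restrict (halfBall R) with hμ
  set ν := volume.restrict (Icc (-R) R) with hν
  have cζ : Continuous ζ := h.contDiff.continuous
  have cκ : Continuous κ := h.contDiff_kernel.continuous
  have cρ : Continuous ρ := h.contDiff_space.continuous
  have cρ' : Continuous (deriv ρ) := h.contDiff_space.continuous_deriv (by norm_num)
  have cN : Continuous N := h.contDiff_primitive.continuous
  have cζe : ∀ e, Continuous fun p => fderiv ℝ ζ p e := fun e =>
    (h.contDiff.continuous_fderiv (by norm_num)).clm_apply continuous_const
  have cκe : ∀ e, Continuous fun p => fderiv ℝ κ p e := fun e =>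
    (h.contDiff_kernel.continuous_fderiv (by norm_num)).clm_apply continuous_const
  have bζ : IsBdd ζ := .of_hasCompactSupport cζ h.hasCompactSupport
  have bκ : IsBdd κ := .of_hasCompactSupport cκ h.hasCompactSupport_kernel
  have bρ : IsBdd ρ := .of_hasCompactSupport cρ h.hasCompactSupport_space
  have bρ' : IsBdd (deriv ρ) := .of_hasCompactSupport cρ' h.hasCompactSupport_space.deriv
  have bN : IsBdd N := .of_hasCompactSupport cN h.hasCompactSupport_primitive
  have bζe : ∀ e, IsBdd fun p => fderiv ℝ ζ p e := fun e =>
    .of_hasCompactSupport (cζe e) (h.hasCompactSupport.fderiv_apply ℝ e)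
  have bκe : ∀ e, IsBdd fun p => fderiv ℝ κ p e := fun e =>
    .of_hasCompactSupport (cκe e) (h.hasCompactSupport_kernel.fderiv_apply ℝ e)
  have bu : IsBdd u := ⟨M, hM⟩
  have bv : IsBdd v := ⟨M, hvM⟩
  have bu₀ : IsBdd u₀ := ⟨M, hM₀⟩
  have m1 : Measurable fun z : (ℝ × ℝ) × (ℝ × ℝ) => u z.1 := hu.comp measurable_fst
  have m2 : Measurable fun z : (ℝ × ℝ) × (ℝ × ℝ) => v z.2 := hv.comp measurable_snd
  have m3 : Measurable fun z : ℝ × (ℝ × ℝ) => u₀ z.1 := hu₀.comp measurable_fst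
  have m4 : Measurable fun z : ℝ × (ℝ × ℝ) => v z.2 := hv.comp measurable_snd
  have k1 : ∀ e, Continuous fun z : (ℝ × ℝ) × (ℝ × ℝ) =>
      fderiv ℝ ζ z.1 e * κ (z.2 - z.1) - ζ z.1 * fderiv ℝ κ (z.2 - z.1) e := fun e =>
    (((cζe e).comp continuous_fst).mul (cκ.comp (continuous_snd.sub continuous_fst))).sub
      ((cζ.comp continuous_fst).mul ((cκe e).comp (continuous_snd.sub continuous_fst)))
  have k2 : ∀ e, Continuous fun z : (ℝ × ℝ) × (ℝ × ℝ) => ζ z.1 * fderiv ℝ κ (z.2 - z.1) e :=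
    fun e => (cζ.comp continuous_fst).mul ((cκe e).comp (continuous_snd.sub continuous_fst))
  have b1 : ∀ e, IsBdd fun z : (ℝ × ℝ) × (ℝ × ℝ) =>
      fderiv ℝ ζ z.1 e * κ (z.2 - z.1) - ζ z.1 * fderiv ℝ κ (z.2 - z.1) e := fun e =>
    (((bζe e).comp _).mul (bκ.comp _)).sub ((bζ.comp _).mul ((bκe e).comp _))
  have b2 : ∀ e, IsBdd fun z : (ℝ × ℝ) × (ℝ × ℝ) => ζ z.1 * fderiv ℝ κ (z.2 - z.1) e :=
    fun e => (bζ.comp _).mul ((bκe e).comp _)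
  set F1 : (ℝ × ℝ) × (ℝ × ℝ) → ℝ := fun z =>
    |u z.1 - v z.2| * (fderiv ℝ ζ z.1 (0, 1) * κ (z.2 - z.1) - ζ z.1 * fderiv ℝ κ (z.2 - z.1) (0, 1))
    + kruzhkovFlux f (u z.1) (v z.2) *
      (fderiv ℝ ζ z.1 (1, 0) * κ (z.2 - z.1) - ζ z.1 * fderiv ℝ κ (z.2 - z.1) (1, 0)) with hF1
  set F2 : (ℝ × ℝ) × (ℝ × ℝ) → ℝ := fun z =>
    |v z.2 - u z.1| * (ζ z.1 * fderiv ℝ κ (z.2 - z.1) (0, 1))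
    + kruzhkovFlux f (v z.2) (u z.1) * (ζ z.1 * fderiv ℝ κ (z.2 - z.1) (1, 0)) with hF2
  set K : ℝ × (ℝ × ℝ) → ℝ := fun z => |u₀ z.1 - v z.2| * (ζ (z.1, 0) * κ (z.2 - (z.1, 0))) with hK
  set Q : ℝ × (ℝ × ℝ) → ℝ := fun z =>
    kruzhkovFlux f (v z.2) (u₀ z.1) * (ζ (z.1, 0) * (deriv ρ (z.2.1 - z.1) * N z.2.2)) with hQ
  set U : ℝ × ℝ → ℝ := fun z => |u₀ z.2 - u₀ z.1| * (ζ (z.1, 0) * ρ (z.2 - z.1)) with hU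
  have iF1 : Integrable F1 (μ.prod μ) :=
    ((((bu.comp _).sub (bv.comp _)).abs.mul (b1 _)).add
      ((IsBdd.kruzhkovFlux hf (fun z => hM _) fun z => hvM _).mul (b1 _))).integrable
    (((_root_.measurable_abs.comp (m1.sub m2)).mul (k1 _).measurable).add
      ((measurable_kruzhkovFlux hf m1 m2).mul (k1 _).measurable))
  have iF2 : Integrable F2 (μ.prod μ) :=
    ((((bv.comp _).sub (bu.comp _)).abs.mul (b2 _)).add
      ((IsBdd.kruzhkovFlux hf (fun z => hvM _) fun z => hM _).mul (b2 _))).integrable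
    (((_root_.measurable_abs.comp (m2.sub m1)).mul (k2 _).measurable).add
      ((measurable_kruzhkovFlux hf m2 m1).mul (k2 _).measurable))
  have iK : Integrable K (ν.prod μ) := by
    refine ((((bu₀.comp _).sub (bv.comp _)).abs).mul ((bζ.comp _).mul (bκ.comp _))).integrable
      ((_root_.measurable_abs.comp (m3.sub m4)).mul ?_)
    exact ((cζ.comp (by fun_prop)).mul (cκ.comp (by fun_prop))).measurable
  have iQ : Integrable Q (ν.prod μ) := by
    refine ((IsBdd.kruzhkovFlux hf (fun z => hvM _) fun z => hM₀ _).mul ((bζ.comp _).mul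
      ((bρ'.comp _).mul (bN.comp _)))).integrable
      ((measurable_kruzhkovFlux hf m4 m3).mul ?_)
    exact ((cζ.comp (by fun_prop)).mul ((cρ'.comp (by fun_prop)).mul
      (cN.comp (by fun_prop)))).measurable
  have iU : Integrable U (ν.prod ν) := by
    refine ((((bu₀.comp _).sub (bu₀.comp _)).abs).mul ((bζ.comp _).mul (bρ.comp _))).integrable
      ((_root_.measurable_abs.comp ((hu₀.comp measurable_snd).sub (hu₀.comp measurable_fst))).mul ?_)
    exact ((cζ.comp (by fun_prop)).mul (cρ.comp (by fun_prop))).measurable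
  have fd1 : ∀ p q e, fderiv ℝ (fun p => ζ p * κ (q - p)) p e =
      fderiv ℝ ζ p e * κ (q - p) - ζ p * fderiv ℝ κ (q - p) e := h.fderiv_first
  have fd2 : ∀ p q e, fderiv ℝ (fun q => ζ p * κ (q - p)) q e = ζ p * fderiv ℝ κ (q - p) e :=
    h.fderiv_second
  -- The inequality for `u` in the variable `p`, with the constant `v q`, integrated over `q`. It
  -- leaves the initial term `K`, which compares `u₀` with `v` just after the initial time.
  have a : -(e * μ.real univ) ≤ ∫ z, F1 z ∂(μ.prod μ) + ∫ z, K z ∂(ν.prod μ) := by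
    rw [integral_prod_symm _ iF1, integral_prod_symm _ iK, ← integral_add iF1.integral_prod_right
      iK.integral_prod_right]
    refine neg_mul_le_integral (iF1.integral_prod_right.add iK.integral_prod_right)
      (ae_of_all _ fun q => ?_)
    have := e1 (v q) (hvM q) _ (t1 q)
    rw [entropyFunctional_eq (t1 q)] at this
    simp only [fd1] at this
    exact this
  -- The inequality for `v` in the variable `q`, with the constant `u p`. There is no initial term:
  -- the kernel vanishes unless `q` is later than `p`, and `p` has positive time.
  have b : -(e * μ.real univ) ≤ ∫ z, F2 z ∂(μ.prod μ) := by
    rw [integral_prod _ iF2]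
    refine neg_mul_le_integral iF2.integral_prod_left
      ((ae_restrict_iff' (measurableSet_halfBall R)).2 (ae_of_all _ fun p hp => ?_))
    have := e2 (u p) (hM p) _ (t2 p)
    rw [entropyFunctional_eq (t2 p)] at this
    have hz : ∀ x : ℝ, κ ((x, 0) - p) = 0 := fun x => h.kernel_eq_zero (by
      have : 0 < p.2 := hp.1
      simp [this.le])
    simp only [fd2, hz, mul_zero, integral_zero, add_zero] at this
    exact this
  -- The inequality for `v` once more, now with the constant `u₀ x` and a test function in an
  -- initial layer whose time derivative is `-ζ κ`. It removes `K` in exchange for the small terms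
  -- `Q` (flux in the layer) and `U` (oscillation of `u₀`).
  have c : -(e * ν.real univ) ≤ -∫ z, K z ∂(ν.prod μ) + ∫ z, Q z ∂(ν.prod μ) +
      ∫ z, U z ∂(ν.prod ν) := by
    have iKQ : Integrable (fun z => -K z + Q z) (ν.prod μ) := iK.neg.add iQ
    rw [← integral_neg, ← integral_add iK.fun_neg iQ, integral_prod _ iKQ, integral_prod _ iU,
      ← integral_add iKQ.integral_prod_left iU.integral_prod_left]
    refine neg_mul_le_integral (iKQ.integral_prod_left.add iU.integral_prod_left)
      (ae_of_all _ fun x => ?_)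
    have := e2 (u₀ x) (hM₀ x) _ (t3 x)
    rw [entropyFunctional_eq (t3 x)] at this
    refine this.trans (le_of_eq ?_)
    congr 1
    · refine setIntegral_congr_fun (measurableSet_halfBall R) fun q hq => ?_
      rw [h.fderiv_layer x q hq.1, h.fderiv_layer x q hq.1]
      simp only [hK, hQ, hκ, abs_sub_comm (u₀ x)]
      ring
    · simp only [hU, h.primitive_zero, mul_one, hν]
  -- The derivatives of the kernel in `p` and in `q` are opposite and cancel, so only derivatives of
  -- `ζ` remain.
  have d : doubled (halfBall R) κ (fun p => fderiv ℝ ζ p (0, 1)) u v (fun a b => |a - b|) +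
      doubled (halfBall R) κ (fun p => fderiv ℝ ζ p (1, 0)) u v (kruzhkovFlux f) =
      ∫ z, F1 z ∂(μ.prod μ) + ∫ z, F2 z ∂(μ.prod μ) := by
    have i1 : Integrable (fun z : (ℝ × ℝ) × (ℝ × ℝ) =>
        fderiv ℝ ζ z.1 (0, 1) * |u z.1 - v z.2| * κ (z.2 - z.1)) (μ.prod μ) :=
      ((((bζe _).comp _).mul ((bu.comp _).sub (bv.comp _)).abs).mul (bκ.comp _)).integrable
        (((((cζe _).measurable.comp measurable_fst)).mul (_root_.measurable_abs.comp (m1.sub m2))).mul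
          (cκ.measurable.comp (measurable_snd.sub measurable_fst)))
    have i2 : Integrable (fun z : (ℝ × ℝ) × (ℝ × ℝ) =>
        fderiv ℝ ζ z.1 (1, 0) * kruzhkovFlux f (u z.1) (v z.2) * κ (z.2 - z.1)) (μ.prod μ) :=
      ((((bζe _).comp _).mul (IsBdd.kruzhkovFlux hf (fun z => hM _) fun z => hvM _)).mul
        (bκ.comp _)).integrable
        (((((cζe _).measurable.comp measurable_fst)).mul (measurable_kruzhkovFlux hf m1 m2)).mul
          (cκ.measurable.comp (measurable_snd.sub measurable_fst)))
    rw [doubled, doubled, ← integral_add iF1 iF2, ← integral_add i1 i2]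
    refine integral_congr_ae (ae_of_all _ fun z => ?_)
    simp only [hF1, hF2, kruzhkovFlux_comm f (v z.2), abs_sub_comm (v z.2)]
    ring
  rw [d]
  linarith

end DoublingData

/-! ### Kernels -/

theorem exists_space_kernel {ε : ℝ} (hε : 0 < ε) :
    ∃ ρ : ℝ → ℝ, ContDiff ℝ ∞ ρ ∧ HasCompactSupport ρ ∧ (∀ x, 0 ≤ ρ x) ∧ ∫ x, ρ x = 1 ∧
      ∀ x, ρ x ≠ 0 → |x| ≤ ε := by
  let b : ContDiffBump (0 : ℝ) := ⟨ε / 2, ε, by positivity, by linarith⟩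
  refine ⟨b.normed volume, b.contDiff_normed, b.hasCompactSupport_normed,
    fun x => b.nonneg_normed x, b.integral_normed, fun x hx => ?_⟩
  have : x ∈ Function.support (b.normed volume) := hx
  rw [b.support_normed_eq, mem_ball_zero_iff] at this
  exact this.le

/-- A smooth descent from `1` to `0` over `[0, δ]` provides `N`, and minus its derivative provides
`η`. This makes `η` one-sided, which decides the sign of `q.2 - p.2` in the doubling. -/
theorem exists_time_kernel {δ : ℝ} (hδ : 0 < δ) :
    ∃ η N : ℝ → ℝ, (ContDiff ℝ ∞ η ∧ (∀ t, 0 ≤ η t) ∧ ∫ t, η t = 1 ∧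
      (∀ t, η t ≠ 0 → 0 < t ∧ t < δ)) ∧
      (ContDiff ℝ ∞ N ∧ (∀ t, 0 ≤ N t) ∧ (∀ t, N t ≤ 1) ∧ N 0 = 1 ∧
      (∀ t, N t ≠ 0 → -1 ≤ t ∧ t ≤ δ) ∧ ∀ t, 0 < t → HasDerivAt N (-η t) t) := by
  set N₀ : ℝ → ℝ := fun t => Real.smoothTransition (1 - t / δ) with hN₀
  have cN₀ : ContDiff ℝ ∞ N₀ := Real.smoothTransition.contDiff.comp (by fun_prop)
  have hd : ∀ t, HasDerivAt N₀ (deriv N₀ t) t := fun t =>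
    (cN₀.differentiable (by norm_num) t).hasDerivAt
  have anti : Antitone N₀ := fun s t hst => Real.smoothTransition.monotone (by gcongr)
  have one : ∀ t, t ≤ 0 → N₀ t = 1 := fun t ht => Real.smoothTransition.one_of_one_le (by
    have : t / δ ≤ 0 := div_nonpos_of_nonpos_of_nonneg ht hδ.le
    linarith)
  have zero : ∀ t, δ ≤ t → N₀ t = 0 := fun t ht => Real.smoothTransition.zero_of_nonpos (by
    have : 1 ≤ t / δ := (one_le_div hδ).2 ht
    linarith)
  have d0 : ∀ t, t ≤ 0 → deriv N₀ t = 0 := fun t ht =>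
    IsLocalMax.deriv_eq_zero (Eventually.of_forall fun s => by
      rw [one t ht]
      exact Real.smoothTransition.le_one _)
  have d1 : ∀ t, δ ≤ t → deriv N₀ t = 0 := fun t ht =>
    IsLocalMin.deriv_eq_zero (Eventually.of_forall fun s => by
      rw [zero t ht]
      exact Real.smoothTransition.nonneg _)
  have cη : ContDiff ℝ ∞ fun t => -deriv N₀ t := by
    have : ContDiff ℝ ∞ (deriv N₀) := (contDiff_infty_iff_deriv.1 cN₀).2
    exact this.neg
  have supp : ∀ t, -deriv N₀ t ≠ 0 → 0 < t ∧ t < δ := fun t ht =>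
    ⟨not_le.1 fun h => ht (by rw [d0 t h, neg_zero]), not_le.1 fun h => ht (by rw [d1 t h, neg_zero])⟩
  -- The additional factor is `1` for `t ≥ 0` and `0` for `t ≤ -1`; it only makes the support of `N`
  -- compact.
  refine ⟨fun t => -deriv N₀ t, fun t => N₀ t * Real.smoothTransition (t + 1),
    ⟨cη, fun t => neg_nonneg.2 anti.deriv_nonpos, ?_, supp⟩, ?_, ?_, ?_, ?_, ?_, ?_⟩
  · rw [← intervalIntegral.integral_eq_integral_of_support_subset (a := 0) (b := δ)
      fun t ht => ⟨(supp t ht).1, (supp t ht).2.le⟩, intervalIntegral.integral_neg,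
      intervalIntegral.integral_eq_sub_of_hasDerivAt (fun t _ => hd t)
        ((cN₀.continuous_deriv (by norm_num)).intervalIntegrable _ _), one 0 le_rfl, zero δ le_rfl]
    norm_num
  · exact cN₀.mul (Real.smoothTransition.contDiff.comp (by fun_prop))
  · exact fun t => mul_nonneg (Real.smoothTransition.nonneg _) (Real.smoothTransition.nonneg _)
  · exact fun t => mul_le_one₀ (Real.smoothTransition.le_one _) (Real.smoothTransition.nonneg _)
      (Real.smoothTransition.le_one _)
  · simp only [one 0 le_rfl, zero_add, Real.smoothTransition.one, mul_one]
  · refine fun t ht => ⟨not_lt.1 fun h => ?_, not_lt.1 fun h => ?_⟩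
    · exact right_ne_zero_of_mul ht (Real.smoothTransition.zero_of_nonpos (by linarith))
    · exact left_ne_zero_of_mul ht (zero t h.le)
  · intro t ht
    rw [neg_neg]
    refine (hd t).congr_of_eventuallyEq ?_
    filter_upwards [lt_mem_nhds ht] with s hs
    rw [Real.smoothTransition.one_of_one_le (by linarith), mul_one]

theorem IsKernel.mono {r r' : ℝ} {κ : ℝ × ℝ → ℝ} (h : IsKernel r κ) (hr : r ≤ r') : IsKernel r' κ :=
  { h with norm_le := fun p hp => (h.norm_le p hp).trans hr }

/-- One bound `B` for all slices lets a single `k` serve every frozen point of the doubling. The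
radius is prescribed, because it must match the domain of integration. -/
theorem IsTest.exists_slices_of_support {P : Type*} [NormedAddCommGroup P] [NormedSpace ℝ P]
    [ProperSpace P] {Ψ : (ℝ × ℝ) × P → ℝ} (hΨ : ContDiff ℝ ∞ Ψ) (h0 : ∀ z, 0 ≤ Ψ z) {R R' : ℝ}
    (hR : ∀ p y, Ψ (p, y) ≠ 0 → ‖p‖ ≤ R) (hR' : ∀ p y, Ψ (p, y) ≠ 0 → ‖y‖ ≤ R') :
    ∃ B : ℝ, ∀ y : P, IsTest R B fun p => Ψ (p, y) := by
  have hc : HasCompactSupport Ψ :=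
    HasCompactSupport.of_support_subset_isCompact
      ((isCompact_closedBall 0 R).prod (isCompact_closedBall 0 R')) fun z hz =>
      ⟨mem_closedBall_zero_iff.2 (hR z.1 z.2 hz), mem_closedBall_zero_iff.2 (hR' z.1 z.2 hz)⟩
  obtain ⟨_, B, h⟩ := IsTest.exists_slices hΨ hc h0
  exact ⟨B, fun y => { h y with support := fun p hp => hR p y hp }⟩

/-! ### The errors from the initial data -/

/-- The integrand lives in the layer `0 < t ≤ δ`, so it is of order `δ` for a fixed space kernel.
The bound `P` of `ρ'` is large when `ρ` is concentrated, hence `δ` has to be chosen after `ρ`. -/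
theorem initial_flux_le {f u₀ : ℝ → ℝ} {v ζ : ℝ × ℝ → ℝ} {ρ N : ℝ → ℝ} {R C Z P δ : ℝ}
    (hR : 0 ≤ R) (hδ : 0 ≤ δ) (hC0 : 0 ≤ C) (hZ0 : 0 ≤ Z) (hP0 : 0 ≤ P)
    (hC : ∀ q x, |kruzhkovFlux f (v q) (u₀ x)| ≤ C) (hZ : ∀ p, |ζ p| ≤ Z)
    (hP : ∀ x, |deriv ρ x| ≤ P) (hN : ∀ t, |N t| ≤ 1) (hNδ : ∀ t, N t ≠ 0 → t ≤ δ) :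
    ∫ z, kruzhkovFlux f (v z.2) (u₀ z.1) * (ζ (z.1, 0) * (deriv ρ (z.2.1 - z.1) * N z.2.2))
      ∂((volume.restrict (Icc (-R) R)).prod (volume.restrict (halfBall R))) ≤
    C * (Z * P) * (2 * R * (2 * R * δ)) := by
  set T : Set (ℝ × ℝ) := Icc (-R) R ×ˢ Icc 0 δ with hT
  have hTm : MeasurableSet T := measurableSet_Icc.prod measurableSet_Icc
  have hTv : volume T = ENNReal.ofReal (2 * R * δ) := by
    rw [hT, Measure.volume_eq_prod, Measure.prod_prod, Real.volume_Icc, Real.volume_Icc,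
      ← ENNReal.ofReal_mul (by linarith)]
    ring_nf
  have hi : Integrable (fun z : ℝ × (ℝ × ℝ) => C * (Z * P) * (1 * T.indicator 1 z.2))
      ((volume.restrict (Icc (-R) R)).prod (volume.restrict (halfBall R))) := by
    refine Integrable.const_mul ?_ _
    refine Integrable.mul_prod (f := fun _ => (1 : ℝ)) (integrable_const _) ?_
    exact (integrable_const (1 : ℝ)).indicator hTm
  have hae : ∀ᵐ z ∂((volume.restrict (Icc (-R) R)).prod (volume.restrict (halfBall R))),
      ‖kruzhkovFlux f (v z.2) (u₀ z.1) * (ζ (z.1, 0) * (deriv ρ (z.2.1 - z.1) * N z.2.2))‖ ≤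
        C * (Z * P) * (1 * T.indicator 1 z.2) := by
    rw [Measure.prod_restrict]
    refine (ae_restrict_iff' (measurableSet_Icc.prod (measurableSet_halfBall R))).2
      (ae_of_all _ fun z hz => ?_)
    by_cases h : z.2 ∈ T
    · rw [indicator_of_mem h, Pi.one_apply, mul_one, mul_one, Real.norm_eq_abs]
      refine (abs_mul_le_mul (hC _ _) (abs_mul_le_mul (hZ _) (abs_mul_le_mul (hP _) (hN _)))).trans
        (le_of_eq ?_)
      ring
    · have h0 : N z.2.2 = 0 := by
        by_contra hne
        have h1 := mem_closedBall_zero_iff.1 hz.2.2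
        have h2 : 0 < z.2.2 := hz.2.1
        exact h ⟨abs_le.1 ((norm_fst_le z.2).trans h1), h2.le, hNδ _ hne⟩
      rw [h0, indicator_of_notMem h]
      simp
  refine (Real.le_norm_self _).trans ((norm_integral_le_of_norm_le hi hae).trans ?_)
  rw [integral_const_mul, integral_prod_mul (fun _ : ℝ => (1 : ℝ)) (T.indicator 1),
    integral_indicator_one hTm]
  gcongr
  · simp only [integral_const, smul_eq_mul, mul_one, measureReal_restrict_apply_univ,
      Real.volume_real_Icc_of_le (neg_le_self hR)]
    linarith
  · refine ENNReal.toReal_le_of_le_ofReal (by positivity) ?_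
    rw [← hTv]
    exact Measure.restrict_apply_le _ _

/-- An average, weighted by `ρ`, of translation errors of `u₀` in `L¹` for shifts of at most `ε`. -/
theorem initial_data_le {u₀ : ℝ → ℝ} {ζ : ℝ × ℝ → ℝ} {ρ : ℝ → ℝ} {R Z τ ε : ℝ} (hτ : 0 ≤ τ)
    (hu₀ : Measurable u₀) (cρ : Continuous ρ) (hρ0 : ∀ x, 0 ≤ ρ x)
    (hρ1 : ∫ x, ρ x = 1) (hρi : Integrable ρ) (hρε : ∀ x, ρ x ≠ 0 → |x| ≤ ε) (cζ : Continuous ζ)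
    (hζ : ∀ p, 0 ≤ ζ p) (hZ0 : 0 ≤ Z)
    (hZ : ∀ p, |ζ p| ≤ Z)
    (htr : ∀ h : ℝ, ‖h‖ ≤ ε → ∫⁻ x, ‖(Icc (-R) R).indicator u₀ (x + h)
      - (Icc (-R) R).indicator u₀ x‖ₑ ≤ ENNReal.ofReal τ) :
    ∫ z, |u₀ z.2 - u₀ z.1| * (ζ (z.1, 0) * ρ (z.2 - z.1))
      ∂((volume.restrict (Icc (-R) R)).prod (volume.restrict (Icc (-R) R))) ≤ Z * τ := by
  set w := (Icc (-R) R).indicator u₀ with hw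
  have hwm : Measurable w := hu₀.indicator measurableSet_Icc
  have hm : Measurable fun z : ℝ × ℝ => |u₀ z.2 - u₀ z.1| * (ζ (z.1, 0) * ρ (z.2 - z.1)) := by
    refine (_root_.measurable_abs.comp ((hu₀.comp measurable_snd).sub (hu₀.comp measurable_fst))).mul
      ?_
    exact ((cζ.comp (by fun_prop)).mul (cρ.comp (by fun_prop))).measurable
  rw [integral_eq_lintegral_of_nonneg_ae (ae_of_all _ fun z =>
    mul_nonneg (abs_nonneg _) (mul_nonneg (hζ _) (hρ0 _))) hm.aestronglyMeasurable]
  refine ENNReal.toReal_le_of_le_ofReal (by positivity) ?_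
  rw [lintegral_prod _ hm.ennreal_ofReal.aemeasurable]
  calc ∫⁻ x in Icc (-R) R, ∫⁻ y in Icc (-R) R,
        ENNReal.ofReal (|u₀ y - u₀ x| * (ζ (x, 0) * ρ (y - x)))
      ≤ ∫⁻ x in Icc (-R) R, ∫⁻ y in Icc (-R) R,
        ‖w y - w x‖ₑ * (ENNReal.ofReal Z * ENNReal.ofReal (ρ (y - x))) := by
        refine setLIntegral_mono' measurableSet_Icc fun x hx =>
          setLIntegral_mono' measurableSet_Icc fun y hy => ?_
        rw [hw, indicator_of_mem hx, indicator_of_mem hy, ENNReal.ofReal_mul (abs_nonneg _),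
          ENNReal.ofReal_mul (hζ _), Real.enorm_eq_ofReal_abs]
        gcongr
        exact (le_abs_self _).trans (hZ _)
    _ ≤ ∫⁻ x, ∫⁻ y, ‖w y - w x‖ₑ * (ENNReal.ofReal Z * ENNReal.ofReal (ρ (y - x))) :=
        (setLIntegral_le_lintegral _ _).trans (lintegral_mono fun x => setLIntegral_le_lintegral _ _)
    _ = ∫⁻ x, ∫⁻ h, ‖w (x + h) - w x‖ₑ * (ENNReal.ofReal Z * ENNReal.ofReal (ρ h)) := by
        refine lintegral_congr fun x => ?_
        rw [← lintegral_add_left_eq_self _ x]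
        simp only [add_sub_cancel_left]
    _ = ∫⁻ h, ∫⁻ x, ‖w (x + h) - w x‖ₑ * (ENNReal.ofReal Z * ENNReal.ofReal (ρ h)) := by
        refine lintegral_lintegral_swap ?_
        have h1 : Measurable fun z : ℝ × ℝ => w (z.1 + z.2) - w z.1 :=
          (hwm.comp (measurable_fst.add measurable_snd)).sub (hwm.comp measurable_fst)
        exact (h1.enorm.mul (measurable_const.mul (ENNReal.measurable_ofReal.comp
          (cρ.measurable.comp measurable_snd)))).aemeasurable
    _ ≤ ∫⁻ h, ENNReal.ofReal τ * (ENNReal.ofReal Z * ENNReal.ofReal (ρ h)) := by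
        refine lintegral_mono fun h => ?_
        rw [lintegral_mul_const' _ _ (ENNReal.mul_ne_top ENNReal.ofReal_ne_top ENNReal.ofReal_ne_top)]
        rcases eq_or_ne (ρ h) 0 with h0 | h0
        · simp [h0]
        · exact mul_le_mul_left (htr h (hρε h h0)) _
    _ = ENNReal.ofReal (Z * τ) := by
        rw [lintegral_const_mul' _ _ ENNReal.ofReal_ne_top,
          lintegral_const_mul' _ _ ENNReal.ofReal_ne_top,
          ← ofReal_integral_eq_lintegral_ofReal hρi (ae_of_all _ hρ0), hρ1, ENNReal.ofReal_one,
          mul_one, ← ENNReal.ofReal_mul hτ, mul_comm]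

/-! ### Comparison of asymptotic solutions -/

theorem abs_kruzhkovFlux_sub_le {f : ℝ → ℝ} (hf : ContDiff ℝ 1 f) {M L : ℝ}
    (hL : ∀ v, |v| ≤ M → |deriv f v| ≤ L) {a a' b : ℝ} (ha : |a| ≤ M) (ha' : |a'| ≤ M)
    (hb : |b| ≤ M) : |kruzhkovFlux f a b - kruzhkovFlux f a' b| ≤ 2 * L * |a - a'| := by
  have hL0 : 0 ≤ L := (abs_nonneg _).trans (hL a ha)
  have mx : ∀ {x y : ℝ}, |x| ≤ M → |y| ≤ M → |max x y| ≤ M := fun {x y} hx hy => by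
    rcases max_choice x y with e | e <;> rw [e] <;> assumption
  have mn : ∀ {x y : ℝ}, |x| ≤ M → |y| ≤ M → |min x y| ≤ M := fun {x y} hx hy => by
    rcases min_choice x y with e | e <;> rw [e] <;> assumption
  have h1 := abs_sub_le_mul_of_deriv_le hf hL (mx ha hb) (mx ha' hb)
  have h2 := abs_sub_le_mul_of_deriv_le hf hL (mn ha hb) (mn ha' hb)
  have h3 : |max a b - max a' b| ≤ |a - a'| := by
    simpa using abs_max_sub_max_le_max a b a' b
  have h4 : |min a b - min a' b| ≤ |a - a'| := by
    simpa using abs_min_sub_min_le_max a b a' b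
  have h5 := mul_le_mul_of_nonneg_left h3 hL0
  have h6 := mul_le_mul_of_nonneg_left h4 hL0
  rw [kruzhkovFlux, kruzhkovFlux, sub_sub_sub_comm]
  refine (abs_sub _ _).trans ?_
  linarith

theorem integral_tensorKernel {ρ η : ℝ → ℝ} (h1 : ∫ x, ρ x = 1) (h2 : ∫ t, η t = 1) :
    ∫ h, tensorKernel ρ η h = 1 := by
  unfold tensorKernel
  rw [Measure.volume_eq_prod, integral_prod_mul, h1, h2, one_mul]

/-- Five errors of at most `θ / 6` are collected: two from undoubling, one from the initial
oscillation, one from the initial layer and one from the entropy inequalities. The choices are made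
in the order space kernel, time kernel, bound `B` of the test functions, `k`, and finally `m`. -/
theorem comparison_test {f u₀ : ℝ → ℝ} (hf : ContDiff ℝ 1 f) {M : ℝ}
    {u v : ℕ → ℝ × ℝ → ℝ} (hu : AsymptoticSolution f u₀ M u) (hv : AsymptoticSolution f u₀ M v)
    (hu₀ : Measurable u₀) (hM₀ : ∀ x, |u₀ x| ≤ M) {𝒱 : Ultrafilter ℕ} (h𝒱 : (𝒱 : Filter ℕ) ≤ atTop)
    {ζ : ℝ × ℝ → ℝ} {R : ℝ} (cζ : ContDiff ℝ ∞ ζ) (hζ0 : ∀ p, 0 ≤ ζ p) (hR0 : 0 ≤ R)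
    (hζR : ∀ p, ζ p ≠ 0 → ‖p‖ ≤ R) {θ : ℝ} (hθ : 0 < θ) :
    ∀ᶠ k in atTop, ∀ᶠ m in 𝒱, -θ ≤
      (∫ p in halfBall (R + 1), fderiv ℝ ζ p (0, 1) * |u k p - v m p|) +
      ∫ p in halfBall (R + 1), fderiv ℝ ζ p (1, 0) * kruzhkovFlux f (u k p) (v m p) := by
  have hM : 0 ≤ M := (abs_nonneg _).trans (hM₀ 0)
  have sζ : HasCompactSupport ζ :=
    HasCompactSupport.of_support_subset_isCompact (isCompact_closedBall 0 R)
      fun p hp => mem_closedBall_zero_iff.2 (hζR p hp)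
  have cζe : ∀ e, Continuous fun p => fderiv ℝ ζ p e := fun e =>
    (cζ.continuous_fderiv (by norm_num)).clm_apply continuous_const
  obtain ⟨W₁, hW₁⟩ := (sζ.fderiv_apply ℝ (0, 1)).exists_bound_of_continuous (cζe (0, 1))
  obtain ⟨W₂, hW₂⟩ := (sζ.fderiv_apply ℝ (1, 0)).exists_bound_of_continuous (cζe (1, 0))
  obtain ⟨Z, hZ⟩ := sζ.exists_bound_of_continuous cζ.continuous
  have hZ0 : 0 ≤ Z := (norm_nonneg _).trans (hZ 0)
  obtain ⟨L, hL0, hL⟩ := exists_deriv_bound hf M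
  have hD := measurableSet_halfBall (R + 1)
  have hDf := volume_halfBall_ne_top (R + 1)
  obtain ⟨r₁, hr₁, un₁⟩ := Undoubles.of_lipschitz (𝒱 := 𝒱) (g := fun a b => |a - b|) (L := 1)
    hD hDf hv.measurable hv.bound (by unfold Function.uncurry; fun_prop)
    (fun a a' b _ _ _ => by
      rw [one_mul]
      refine (abs_abs_sub_abs_le_abs_sub _ _).trans (le_of_eq ?_)
      rw [sub_sub_sub_cancel_right]) W₁ (θ / 6) (by positivity)
  obtain ⟨r₂, hr₂, un₂⟩ := Undoubles.of_lipschitz (𝒱 := 𝒱) (g := kruzhkovFlux f) (L := 2 * L)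
    hD hDf hv.measurable hv.bound (continuous_kruzhkovFlux hf.continuous)
    (fun a a' b ha ha' hb => abs_kruzhkovFlux_sub_le hf hL ha ha' hb) W₂ (θ / 6) (by positivity)
  set τ := θ / 6 / (Z + 1) with hτ
  have hτ0 : 0 < τ := by positivity
  have hZτ : Z * τ ≤ θ / 6 := by
    rw [hτ, ← mul_div_assoc, div_le_iff₀ (by positivity)]
    nlinarith
  have hu₀i : Integrable ((Icc (-(R + 1)) (R + 1)).indicator u₀) :=
    (integrable_indicator_iff measurableSet_Icc).2
      (integrable_of_measurable_of_bound hu₀ hM₀)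
  obtain ⟨r₃, hr₃, tr⟩ := exists_lintegral_translate_le volume hu₀i hτ0
  -- The last bound keeps the doubled variable within distance `1` of the support of `ζ`, which
  -- explains the radius `R + 1`.
  set ε := min (min r₁ r₂) (min r₃ 1) with hε
  have hε0 : 0 < ε := by positivity
  have hε1 : ε ≤ r₁ := (min_le_left _ _).trans (min_le_left _ _)
  have hε2 : ε ≤ r₂ := (min_le_left _ _).trans (min_le_right _ _)
  have hε3 : ε ≤ r₃ := (min_le_right _ _).trans (min_le_left _ _)
  have hε4 : ε ≤ 1 := (min_le_right _ _).trans (min_le_right _ _)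
  obtain ⟨ρ, cρ, sρ, hρ0, hρ1, hρε⟩ := exists_space_kernel hε0
  obtain ⟨P, hP⟩ := sρ.deriv.exists_bound_of_continuous (cρ.continuous_deriv (by norm_num))
  have hP0 : 0 ≤ P := (norm_nonneg _).trans (hP 0)
  set C := L * (2 * M) with hC
  have hC0 : 0 ≤ C := by positivity
  set A := C * (Z * P) * (2 * (R + 1) * (2 * (R + 1))) with hA
  have hA0 : 0 ≤ A := by positivity
  set δ := min ε (θ / 6 / (A + 1)) with hδ
  have hδ0 : 0 < δ := by positivity
  have hδε : δ ≤ ε := min_le_left _ _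
  have hAδ : A * δ ≤ θ / 6 := by
    calc A * δ ≤ A * (θ / 6 / (A + 1)) := by gcongr; exact min_le_right _ _
      _ ≤ θ / 6 := by
        rw [← mul_div_assoc, div_le_iff₀ (by positivity)]
        nlinarith
  obtain ⟨η, N, ⟨cη, hη0, hη1, hηδ⟩, cN, hN0, hN1, hN, hNδ, hNd⟩ := exists_time_kernel hδ0
  have sη : HasCompactSupport η := HasCompactSupport.of_support_subset_isCompact
    (isCompact_Icc (a := 0) (b := δ)) fun t ht => ⟨(hηδ t ht).1.le, (hηδ t ht).2.le⟩
  have sN : HasCompactSupport N := HasCompactSupport.of_support_subset_isCompact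
    (isCompact_Icc (a := -1) (b := δ)) fun t ht => hNδ t ht
  have data : DoublingData ζ ρ η N := ⟨cζ, sζ, cρ, sρ, hρ0, cη, sη, hη0,
    fun t ht => (hηδ t ht).1, cN, sN, hN, hNd⟩
  set κ := tensorKernel ρ η with hκdef
  have hκn : ∀ h, κ h ≠ 0 → ‖h‖ ≤ ε := fun h hh => by
    have h1 := hρε h.1 (left_ne_zero_of_mul hh)
    have h2 := hηδ h.2 (right_ne_zero_of_mul hh)
    refine max_le h1 ?_
    rw [Real.norm_eq_abs, abs_of_pos h2.1]
    exact h2.2.le.trans hδε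
  have hκ : IsKernel ε κ := ⟨data.contDiff_kernel.continuous, data.hasCompactSupport_kernel,
    data.kernel_nonneg, integral_tensorKernel hρ1 hη1, hκn⟩
  have hclose : ∀ p q : ℝ × ℝ, ζ p * κ (q - p) ≠ 0 → ‖p‖ ≤ R ∧ ‖q‖ ≤ R + 1 := fun p q h => by
    have h1 := hζR p (left_ne_zero_of_mul h)
    have h2 := hκn _ (right_ne_zero_of_mul h)
    refine ⟨h1, ?_⟩
    have h3 := norm_add_le p (q - p)
    rw [add_sub_cancel] at h3
    linarith
  obtain ⟨B₁, t₁⟩ := IsTest.exists_slices_of_support (P := ℝ × ℝ) (R := R + 1) (R' := R + 1)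
    (Ψ := fun z => ζ z.1 * κ (z.2 - z.1))
    ((cζ.comp contDiff_fst).mul (data.contDiff_kernel.comp (contDiff_snd.sub contDiff_fst)))
    (fun z => mul_nonneg (hζ0 _) (hκ.nonneg _))
    (fun p q h => (hclose p q h).1.trans (by linarith)) (fun p q h => (hclose p q h).2)
  obtain ⟨B₂, t₂⟩ := IsTest.exists_slices_of_support (P := ℝ × ℝ) (R := R + 1) (R' := R + 1)
    (Ψ := fun z => ζ z.2 * κ (z.1 - z.2))
    ((cζ.comp contDiff_snd).mul (data.contDiff_kernel.comp (contDiff_fst.sub contDiff_snd)))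
    (fun z => mul_nonneg (hζ0 _) (hκ.nonneg _))
    (fun q p h => (hclose p q h).2) (fun q p h => (hclose p q h).1.trans (by linarith))
  have hclose' : ∀ (q : ℝ × ℝ) (x : ℝ), ζ (x, 0) * (ρ (q.1 - x) * N q.2) ≠ 0 →
      ‖q‖ ≤ R + 1 ∧ ‖x‖ ≤ R + 1 := fun q x h => by
    have h1 : |x| ≤ R := (le_max_left |x| |(0 : ℝ)|).trans (hζR (x, 0) (left_ne_zero_of_mul h))
    have h2 := hρε _ (left_ne_zero_of_mul (right_ne_zero_of_mul h))
    have h3 := hNδ _ (right_ne_zero_of_mul (right_ne_zero_of_mul h))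
    rw [abs_le] at h1 h2
    refine ⟨max_le (abs_le.2 ⟨by linarith, by linarith⟩) (abs_le.2 ⟨by linarith, by linarith⟩),
      abs_le.2 ⟨by linarith, by linarith⟩⟩
  obtain ⟨B₃, t₃⟩ := IsTest.exists_slices_of_support (P := ℝ) (R := R + 1) (R' := R + 1)
    (Ψ := fun z => ζ (z.2, 0) * (ρ (z.1.1 - z.2) * N z.1.2))
    ((cζ.comp (by fun_prop)).mul ((cρ.comp (by fun_prop)).mul (cN.comp (by fun_prop))))
    (fun z => mul_nonneg (hζ0 _) (mul_nonneg (hρ0 _) (hN0 _)))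
    (fun q x h => (hclose' q x h).1) (fun q x h => (hclose' q x h).2)
  set B := max B₁ (max B₂ B₃) with hB
  set E := 2 * (volume.restrict (halfBall (R + 1))).real univ
    + (volume.restrict (Icc (-(R + 1)) (R + 1))).real univ with hE
  have hE0 : 0 ≤ E := by positivity
  set e := θ / 6 / (E + 1) with he
  have he0 : 0 < e := by positivity
  have heE : e * E ≤ θ / 6 := by
    rw [he, div_mul_eq_mul_div, div_le_iff₀ (by positivity)]
    nlinarith
  -- The undoubling holds for every `u k` with the same kernel, so `k` is constrained by the entropy
  -- inequalities alone.
  filter_upwards [hu.kruzhkov hf hu₀ hM₀ (R + 1) B e he0] with k hk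
  filter_upwards [h𝒱 (hv.kruzhkov hf hu₀ hM₀ (R + 1) B e he0),
    un₁ κ (hκ.mono hε1) (fun p => fderiv ℝ ζ p (0, 1)) (u k) (cζe _).measurable hW₁
      (hu.measurable k) (hu.bound k),
    un₂ κ (hκ.mono hε2) (fun p => fderiv ℝ ζ p (1, 0)) (u k) (cζe _).measurable hW₂
      (hu.measurable k) (hu.bound k)] with m hm j₁ j₂
  have main := data.doubled_ge (R := R + 1) (B := B) (e := e) hf.continuous hu₀ hM₀
    (hu.measurable k) (hu.bound k) (hv.measurable m) (hv.bound m)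
    (fun q => (t₁ q).mono le_rfl (le_max_left _ _))
    (fun p => (t₂ p).mono le_rfl ((le_max_left _ _).trans (le_max_right _ _)))
    (fun x => (t₃ x).mono le_rfl ((le_max_right _ _).trans (le_max_right _ _))) hk hm
  have q₁ := initial_flux_le (f := f) (u₀ := u₀) (v := v m) (ζ := ζ) (ρ := ρ) (N := N) (R := R + 1)
    (C := C) (Z := Z) (P := P) (δ := δ) (by linarith) hδ0.le hC0 hZ0 hP0
    (fun q x => (abs_kruzhkovFlux_le hf hL (hv.bound m q) (hM₀ x)).trans (by
      have h1 := (abs_sub (v m q) (u₀ x)).trans (add_le_add (hv.bound m q) (hM₀ x))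
      rw [hC]
      gcongr
      linarith)) hZ hP
    (fun t => by rw [abs_of_nonneg (hN0 t)]; exact hN1 t) (fun t ht => (hNδ t ht).2)
  have q₂ := initial_data_le (u₀ := u₀) (ζ := ζ) (ρ := ρ) (R := R + 1) (Z := Z) hτ0.le hu₀
    cρ.continuous hρ0 hρ1 (cρ.continuous.integrable_of_hasCompactSupport sρ) hρε cζ.continuous hζ0
    hZ0 hZ (fun h hh => tr h (hh.trans hε3))
  have q₃ : C * (Z * P) * (2 * (R + 1) * (2 * (R + 1) * δ)) = A * δ := by rw [hA]; ring
  rw [q₃] at q₁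
  rw [abs_le] at j₁ j₂
  linarith [j₁.1, j₁.2, j₂.1, j₂.2]

/-- A test function that decreases along all directions of propagation. -/
theorem exists_decreasing_test {L : ℝ} (hL : 0 ≤ L) {R₀ : ℝ} (hR₀ : 0 ≤ R₀) :
    ∃ (ζ : ℝ × ℝ → ℝ) (R : ℝ), ContDiff ℝ ∞ ζ ∧ (∀ p, 0 ≤ ζ p) ∧ R₀ ≤ R ∧
      (∀ p, ζ p ≠ 0 → ‖p‖ ≤ R) ∧
      (∀ p ∈ halfPlane, fderiv ℝ ζ p (0, 1) + L * |fderiv ℝ ζ p (1, 0)| ≤ 0) ∧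
      ∀ p ∈ halfBall R₀, fderiv ℝ ζ p (0, 1) + L * |fderiv ℝ ζ p (1, 0)| ≤ -1 := by
  -- On the half-ball of radius `R₀` the phase `σ` stays below `A - 1`, where `θ` has slope `-1`.
  set A : ℝ := √(1 + R₀ ^ 2) + (L + 1) * R₀ + 2 with hA
  have hA0 : 0 ≤ A := by positivity
  -- A smooth substitute for the positive part of `A - s`. Since `|∂ₓσ| ≤ 1` and `∂ₜσ = L + 1`, the
  -- expression to be bounded is at most `θ'(σ)`.
  set θ : ℝ → ℝ := fun s => (A - s) * Real.smoothTransition (A - s) with hθ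
  set σ : ℝ × ℝ → ℝ := fun p => √(1 + p.1 ^ 2) + (L + 1) * p.2 with hσ
  have cθ : ContDiff ℝ ∞ θ := (contDiff_const.sub contDiff_id).mul
    (Real.smoothTransition.contDiff.comp (contDiff_const.sub contDiff_id))
  have cσ : ContDiff ℝ ∞ σ := by
    refine ContDiff.add (ContDiff.sqrt (by fun_prop) fun p => ?_) (by fun_prop)
    positivity
  have hsq : ∀ x : ℝ, 1 ≤ √(1 + x ^ 2) := fun x => Real.one_le_sqrt.2 (by nlinarith)
  have hsq' : ∀ x : ℝ, |x| ≤ √(1 + x ^ 2) := fun x => Real.abs_le_sqrt (by linarith)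
  have θ0 : ∀ s, A ≤ s → θ s = 0 := fun s hs => by
    simp [hθ, Real.smoothTransition.zero_of_nonpos (sub_nonpos.2 hs)]
  have θn : ∀ s, 0 ≤ θ s := fun s => by
    rcases le_total A s with h | h
    · rw [θ0 s h]
    · exact mul_nonneg (sub_nonneg.2 h) (Real.smoothTransition.nonneg _)
  have θa : Antitone θ := fun s t hst => by
    rcases le_total A t with h | h
    · rw [θ0 t h]
      exact θn s
    · exact mul_le_mul (by linarith) (Real.smoothTransition.monotone (by linarith))
        (Real.smoothTransition.nonneg _) (by linarith)
  have θd : ∀ s, deriv θ s ≤ 0 := fun s => θa.deriv_nonpos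
  have θ1 : ∀ s, s < A - 1 → deriv θ s = -1 := fun s hs => by
    have : HasDerivAt θ (-1) s := by
      refine ((hasDerivAt_id s).const_sub A).congr_of_eventuallyEq ?_
      filter_upwards [gt_mem_nhds hs] with t ht
      simp [hθ, Real.smoothTransition.one_of_one_le (show 1 ≤ A - t by linarith)]
    exact this.deriv
  -- The cut-off in negative times is `1` for `t ≥ -1`, so it gives compact support and leaves the
  -- half-plane untouched.
  set ζ : ℝ × ℝ → ℝ := fun p => θ (σ p) * Real.smoothTransition (p.2 + 2) with hζ
  have cχ : ContDiff ℝ ∞ fun p : ℝ × ℝ => Real.smoothTransition (p.2 + 2) :=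
    Real.smoothTransition.contDiff.comp (by fun_prop)
  have key : ∀ p ∈ halfPlane, fderiv ℝ ζ p (0, 1) + L * |fderiv ℝ ζ p (1, 0)| ≤ deriv θ (σ p) := by
    intro p hp
    have hp0 : 0 < p.2 := hp
    have h1 : HasFDerivAt (fun p : ℝ × ℝ => √(1 + p.1 ^ 2))
        ((p.1 / √(1 + p.1 ^ 2)) • ContinuousLinearMap.fst ℝ ℝ ℝ) p := by
      have h2 : HasDerivAt (fun x : ℝ => √(1 + x ^ 2)) (p.1 / √(1 + p.1 ^ 2)) p.1 := by
        have h3 : HasDerivAt (fun x : ℝ => 1 + x ^ 2) (2 * p.1) p.1 := by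
          simpa using ((hasDerivAt_id p.1).pow 2).const_add 1
        refine (h3.sqrt (by positivity)).congr_deriv ?_
        rw [mul_div_mul_left _ _ two_ne_zero]
      exact h2.comp_hasFDerivAt p (hasFDerivAt_fst (𝕜 := ℝ) (p := p))
    have h2 : HasFDerivAt σ ((p.1 / √(1 + p.1 ^ 2)) • ContinuousLinearMap.fst ℝ ℝ ℝ +
        (L + 1) • ContinuousLinearMap.snd ℝ ℝ ℝ) p :=
      h1.add ((hasFDerivAt_snd (𝕜 := ℝ) (p := p)).const_mul (L + 1))
    have h3 : HasFDerivAt ζ (deriv θ (σ p) • ((p.1 / √(1 + p.1 ^ 2)) • ContinuousLinearMap.fst ℝ ℝ ℝ +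
        (L + 1) • ContinuousLinearMap.snd ℝ ℝ ℝ)) p := by
      refine (((cθ.differentiable (by norm_num) (σ p)).hasDerivAt.comp_hasFDerivAt p
        h2)).congr_of_eventuallyEq ?_
      have : ∀ᶠ q : ℝ × ℝ in 𝓝 p, 0 < q.2 := continuous_snd.continuousAt.eventually (lt_mem_nhds hp0)
      filter_upwards [this] with q hq
      simp [hζ, Real.smoothTransition.one_of_one_le (show 1 ≤ q.2 + 2 by linarith)]
    rw [h3.fderiv]
    have h4 : |p.1 / √(1 + p.1 ^ 2)| ≤ 1 := by
      rw [abs_div, abs_of_pos (one_pos.trans_le (hsq _)), div_le_one (one_pos.trans_le (hsq _))]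
      exact hsq' _
    have e1 : (deriv θ (σ p) • ((p.1 / √(1 + p.1 ^ 2)) • ContinuousLinearMap.fst ℝ ℝ ℝ +
        (L + 1) • ContinuousLinearMap.snd ℝ ℝ ℝ)) (0, 1) = deriv θ (σ p) * (L + 1) := by
      simp [-mul_eq_mul_left_iff]
    have e2 : (deriv θ (σ p) • ((p.1 / √(1 + p.1 ^ 2)) • ContinuousLinearMap.fst ℝ ℝ ℝ +
        (L + 1) • ContinuousLinearMap.snd ℝ ℝ ℝ)) (1, 0) =
        deriv θ (σ p) * (p.1 / √(1 + p.1 ^ 2)) := by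
      simp [-mul_eq_mul_left_iff]
    rw [e1, e2, abs_mul, abs_of_nonpos (θd (σ p))]
    have h5 : L * (-deriv θ (σ p) * |p.1 / √(1 + p.1 ^ 2)|) ≤ L * (-deriv θ (σ p) * 1) := by
      have := θd (σ p)
      gcongr
      linarith
    linarith
  -- On the support `σ < A` and `t > -2`, whence `|x| < A + 2 (L + 1)`.
  refine ⟨ζ, max R₀ (A + 2 * (L + 1)), (cθ.comp cσ).mul cχ,
    fun p => mul_nonneg (θn _) (Real.smoothTransition.nonneg _), le_max_left _ _, fun p hp => ?_,
    fun p hp => (key p hp).trans (θd _), fun p hp => (key p hp.1).trans (le_of_eq (θ1 _ ?_))⟩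
  · refine le_max_of_le_right ?_
    have h1 : σ p < A := not_le.1 fun h => left_ne_zero_of_mul hp (θ0 _ h)
    have h2 : -2 < p.2 := not_le.1 fun h => right_ne_zero_of_mul hp
      (Real.smoothTransition.zero_of_nonpos (by linarith))
    have h3 := hsq' p.1
    have h4 := hsq p.1
    simp only [hσ] at h1
    refine max_le ?_ ?_
    · rw [Real.norm_eq_abs]
      nlinarith
    · rw [Real.norm_eq_abs, abs_le]
      constructor <;> nlinarith
  · have h0 : 0 < p.2 := hp.1
    have h1 := mem_closedBall_zero_iff.1 hp.2
    have h2 : |p.1| ≤ R₀ := (norm_fst_le p).trans h1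
    have h3 : p.2 ≤ R₀ := (le_abs_self _).trans ((norm_snd_le p).trans h1)
    have h4 : √(1 + p.1 ^ 2) ≤ √(1 + R₀ ^ 2) := by
      refine Real.sqrt_le_sqrt ?_
      have := sq_le_sq' (abs_le.1 h2).1 (abs_le.1 h2).2
      linarith
    have h5 : (L + 1) * p.2 ≤ (L + 1) * R₀ := by gcongr
    simp only [hσ, hA]
    linarith

/-- Asymptotic solutions with the same initial data approach each other. -/
theorem comparison {f u₀ : ℝ → ℝ} (hf : ContDiff ℝ 1 f) {M : ℝ}
    {u v : ℕ → ℝ × ℝ → ℝ} (hu : AsymptoticSolution f u₀ M u) (hv : AsymptoticSolution f u₀ M v)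
    (hu₀ : Measurable u₀) (hM₀ : ∀ x, |u₀ x| ≤ M) {𝒱 : Ultrafilter ℕ} (h𝒱 : (𝒱 : Filter ℕ) ≤ atTop)
    {R₀ : ℝ} (hR₀ : 0 ≤ R₀) {θ : ℝ} (hθ : 0 < θ) :
    ∀ᶠ k in atTop, ∀ᶠ m in 𝒱, ∫ p in halfBall R₀, |u k p - v m p| ≤ θ := by
  obtain ⟨L, hL0, hL⟩ := exists_deriv_bound hf M
  obtain ⟨ζ, R, cζ, hζ0, hR, hζR, hle, hlt⟩ := exists_decreasing_test hL0 hR₀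
  filter_upwards [comparison_test hf hu hv hu₀ hM₀ h𝒱 cζ hζ0 (hR₀.trans hR) hζR hθ] with k hk
  filter_upwards [hk] with m hm
  have sζ : HasCompactSupport ζ :=
    HasCompactSupport.of_support_subset_isCompact (isCompact_closedBall 0 R)
      fun p hp => mem_closedBall_zero_iff.2 (hζR p hp)
  have cζe : ∀ e, Continuous fun p => fderiv ℝ ζ p e := fun e =>
    (cζ.continuous_fderiv (by norm_num)).clm_apply continuous_const
  have bζe : ∀ e, IsBdd fun p => fderiv ℝ ζ p e := fun e =>
    .of_hasCompactSupport (cζe e) (sζ.fderiv_apply ℝ e)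
  have bd : IsBdd fun p => |u k p - v m p| := (IsBdd.sub ⟨M, hu.bound k⟩ ⟨M, hv.bound m⟩).abs
  have md : Measurable fun p => |u k p - v m p| :=
    _root_.measurable_abs.comp ((hu.measurable k).sub (hv.measurable m))
  have i1 : IntegrableOn (fun p => fderiv ℝ ζ p (0, 1) * |u k p - v m p|) (halfBall (R + 1)) :=
    ((bζe _).mul bd).integrable ((cζe _).measurable.mul md)
  have i2 : IntegrableOn (fun p => fderiv ℝ ζ p (1, 0) * kruzhkovFlux f (u k p) (v m p))
      (halfBall (R + 1)) :=
    ((bζe _).mul (IsBdd.kruzhkovFlux hf.continuous (hu.bound k) (hv.bound m))).integrable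
      ((cζe _).measurable.mul
        (measurable_kruzhkovFlux hf.continuous (hu.measurable k) (hv.measurable m)))
  have hsub : halfBall R₀ ⊆ halfBall (R + 1) :=
    inter_subset_inter_right _ (Metric.closedBall_subset_closedBall (by linarith))
  have i3 : IntegrableOn (fun p => (halfBall R₀).indicator (fun p => -|u k p - v m p|) p)
      (halfBall (R + 1)) := by
    have : Integrable (fun p => |u k p - v m p|) (volume.restrict (halfBall (R + 1))) :=
      bd.integrable md
    exact this.neg.indicator (measurableSet_halfBall R₀)
  rw [← integral_add i1 i2] at hm
  -- The Kruzhkov flux is at most `L |u - v|`, so the integrand is at most `|u - v|` times `∂ₜζ + L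
  -- |∂ₓζ|`, a factor which is nonpositive everywhere and at most `-1` on the half-ball of interest.
  have h1 : ∫ p in halfBall (R + 1), (fderiv ℝ ζ p (0, 1) * |u k p - v m p| +
      fderiv ℝ ζ p (1, 0) * kruzhkovFlux f (u k p) (v m p)) ≤
      ∫ p in halfBall (R + 1), (halfBall R₀).indicator (fun p => -|u k p - v m p|) p := by
    refine setIntegral_mono_on (i1.add i2) i3 (measurableSet_halfBall _) fun p hp => ?_
    have h2 := abs_kruzhkovFlux_le hf hL (hu.bound k p) (hv.bound m p)
    have h3 : fderiv ℝ ζ p (1, 0) * kruzhkovFlux f (u k p) (v m p) ≤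
        L * |fderiv ℝ ζ p (1, 0)| * |u k p - v m p| := by
      refine (le_abs_self _).trans ?_
      rw [abs_mul]
      calc |fderiv ℝ ζ p (1, 0)| * |kruzhkovFlux f (u k p) (v m p)| ≤
          |fderiv ℝ ζ p (1, 0)| * (L * |u k p - v m p|) := by gcongr
        _ = _ := by ring
    have h4 := abs_nonneg (u k p - v m p)
    by_cases hp' : p ∈ halfBall R₀
    · rw [indicator_of_mem hp']
      nlinarith [hlt p hp']
    · rw [indicator_of_notMem hp']
      nlinarith [hle p hp.1]
  rw [setIntegral_indicator (measurableSet_halfBall R₀), inter_eq_self_of_subset_right hsub,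
    integral_neg] at h1
  linarith

/-! ### Cell averages -/

theorem setOf_floor_eq {dx : ℝ} (hdx : 0 < dx) (j : ℤ) :
    {x : ℝ | ⌊x / dx⌋ = j} = Ico (j * dx) ((j + 1) * dx) := by
  ext x
  rw [mem_ofPred_eq, Int.floor_eq_iff, le_div_iff₀ hdx, div_lt_iff₀ hdx, mem_Ico]

theorem volume_cell {dx : ℝ} (hdx : 0 < dx) (j : ℤ) :
    volume.real {x : ℝ | ⌊x / dx⌋ = j} = dx := by
  rw [setOf_floor_eq hdx, Real.volume_real_Ico_of_le (by nlinarith)]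
  ring

theorem measurableSet_cell {dx : ℝ} (hdx : 0 < dx) (j : ℤ) : MeasurableSet {x : ℝ | ⌊x / dx⌋ = j} := by
  rw [setOf_floor_eq hdx]
  exact measurableSet_Ico

theorem volume_cell_ne_top {dx : ℝ} (hdx : 0 < dx) (j : ℤ) :
    volume {x : ℝ | ⌊x / dx⌋ = j} ≠ ⊤ := by
  rw [setOf_floor_eq hdx]
  exact measure_Ico_lt_top.ne

theorem abs_sub_le_of_floor_eq {dx x z : ℝ} (hdx : 0 < dx) (h : ⌊x / dx⌋ = ⌊z / dx⌋) :
    |x - z| ≤ dx := by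
  have hx : x ∈ Ico (⌊z / dx⌋ * dx) ((⌊z / dx⌋ + 1) * dx) := by
    rw [← setOf_floor_eq hdx]
    exact h
  have hz : z ∈ Ico (⌊z / dx⌋ * dx) ((⌊z / dx⌋ + 1) * dx) := by
    rw [← setOf_floor_eq hdx]
    rfl
  rw [abs_le]
  constructor <;> linarith [hx.1, hx.2, hz.1, hz.2]

/-- The cell with index `j + 1` begins at `j * dx`, hence the shift between the floor and the index.
-/
theorem cellAverage_eq {dx : ℝ} (hdx : 0 < dx) (u₀ : ℝ → ℝ) (j : ℤ) :
    cellAverage u₀ dx (j + 1) = (1 / dx) * ∫ x in {x : ℝ | ⌊x / dx⌋ = j}, u₀ x := by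
  rw [cellAverage, setOf_floor_eq hdx, integral_Ico_eq_integral_Ioc,
    intervalIntegral.integral_of_le]
  · push_cast
    ring_nf
  · push_cast
    nlinarith

theorem integrableOn_cell {dx M : ℝ} (hdx : 0 < dx) {w : ℝ → ℝ} (hw : Measurable w)
    (hM : ∀ x, |w x| ≤ M) (j : ℤ) : IntegrableOn w {x : ℝ | ⌊x / dx⌋ = j} :=
  Measure.integrableOn_of_bounded (volume_cell_ne_top hdx j) hw.aestronglyMeasurable
    (ae_of_all _ hM)

theorem abs_cellAverage_le {dx M : ℝ} (hdx : 0 < dx) {u₀ : ℝ → ℝ}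
    (hM : ∀ x, |u₀ x| ≤ M) (j : ℤ) : |cellAverage u₀ dx j| ≤ M := by
  obtain ⟨i, rfl⟩ : ∃ i, j = i + 1 := ⟨j - 1, by ring⟩
  rw [cellAverage_eq hdx, abs_mul, abs_of_pos (by positivity), one_div, inv_mul_le_iff₀ hdx,
    ← Real.norm_eq_abs]
  refine (norm_setIntegral_le_of_norm_le_const (volume_cell_ne_top hdx i).lt_top
    (fun x _ => hM x)).trans (le_of_eq ?_)
  rw [volume_cell hdx]
  ring

/-- Jensen's inequality for the averages over cells. -/
theorem map_cellAverage_le {f V G u₀ : ℝ → ℝ} {dx M : ℝ} (hdx : 0 < dx) (hV : IsEntropyPair f V G)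
    (hu₀ : Measurable u₀) (hM : ∀ x, |u₀ x| ≤ M) (j : ℤ) :
    V (cellAverage u₀ dx (j + 1)) ≤ (1 / dx) * ∫ x in {x : ℝ | ⌊x / dx⌋ = j}, V (u₀ x) := by
  set m := cellAverage u₀ dx (j + 1) with hm
  obtain ⟨C, hC⟩ := exists_bound_of_continuous hV.continuous M
  have i0 := integrableOn_cell hdx hu₀ hM j
  have i1 : IntegrableOn (fun x => V (u₀ x)) {x : ℝ | ⌊x / dx⌋ = j} :=
    integrableOn_cell hdx (hV.continuous.measurable.comp hu₀) (fun x => hC _ (hM x)) j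
  have i2 : ∀ c : ℝ, IntegrableOn (fun _ => c) {x : ℝ | ⌊x / dx⌋ = j} := fun c =>
    integrableOn_cell hdx measurable_const (M := |c|) (fun _ => le_rfl) j
  -- Jensen's inequality follows by integrating the tangent line at the mean, whose linear part
  -- averages to zero.
  have tangent : ∀ y, V m + deriv V m * (y - m) ≤ V y := by
    intro y
    have hconv := hV.strictConvex.convexOn
    rcases lt_trichotomy y m with h | h | h
    · have := hconv.slope_le_of_hasDerivAt (mem_univ y) (mem_univ m) h (hV.hasDerivAt m)
      rw [slope_def_field, div_le_iff₀ (sub_pos.2 h)] at this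
      linarith
    · rw [h]
      simp
    · have := hconv.le_slope_of_hasDerivAt (mem_univ m) (mem_univ y) h (hV.hasDerivAt m)
      rw [slope_def_field, le_div_iff₀ (sub_pos.2 h)] at this
      linarith
  have i3 : IntegrableOn (fun x => deriv V m * (u₀ x - m)) {x : ℝ | ⌊x / dx⌋ = j} :=
    (i0.fun_sub (i2 m)).const_mul _
  have h1 : ∫ x in {x : ℝ | ⌊x / dx⌋ = j}, (V m + deriv V m * (u₀ x - m)) ≤
      ∫ x in {x : ℝ | ⌊x / dx⌋ = j}, V (u₀ x) :=
    integral_mono ((i2 _).fun_add i3) i1 fun x => tangent _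
  have h2 : ∫ x in {x : ℝ | ⌊x / dx⌋ = j}, u₀ x = dx * m := by
    rw [hm, cellAverage_eq hdx]
    field_simp
  rw [integral_add (i2 _) i3, integral_const_mul,
    integral_sub i0 (i2 m), h2, setIntegral_const, setIntegral_const, volume_cell hdx] at h1
  simp only [smul_eq_mul, sub_self, mul_zero, add_zero] at h1
  rw [one_div, ← div_eq_inv_mul, le_div_iff₀ hdx]
  linarith

/-- After Jensen's inequality, Fubini transfers the averaging from `V (u₀)` to the test function,
which differs from its cell averages by at most `B * dx`. -/
theorem initial_average_le {f V G u₀ g : ℝ → ℝ} {dx M N R B : ℝ} (hdx : 0 < dx) (hdx1 : dx ≤ 1)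
    (hV : IsEntropyPair f V G) (hN : ∀ v, |v| ≤ M → |V v| ≤ N) (hu₀ : Measurable u₀)
    (hM : ∀ x, |u₀ x| ≤ M) (hg : Continuous g) (hg0 : ∀ x, 0 ≤ g x) (hR0 : 0 ≤ R)
    (hR : ∀ x, g x ≠ 0 → |x| ≤ R) (hB0 : 0 ≤ B) (hB : ∀ x y, |g x - g y| ≤ B * |x - y|) :
    ∫ x, V (cellAverage u₀ dx (⌊x / dx⌋ + 1)) * g x ≤
      (∫ x, V (u₀ x) * g x) + N * (B * dx) * (2 * (R + 1)) := by
  -- With `dx ≤ 1`, a cell that meets the support of `g` is contained in `I`.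
  set I := Icc (-(R + 1)) (R + 1) with hI
  have hN0 : 0 ≤ N := (abs_nonneg _).trans (hN _ (hM 0))
  have hout : ∀ x, x ∉ I → g x = 0 := fun x hx => by
    by_contra hne
    have := abs_le.1 (hR x hne)
    exact hx ⟨by linarith, by linarith⟩
  set S : Set (ℝ × ℝ) := {z | ⌊z.1 / dx⌋ = ⌊z.2 / dx⌋} with hS
  have hSm : MeasurableSet S :=
    measurableSet_eq_fun (Int.measurable_floor.comp (measurable_fst.div_const dx))
      (Int.measurable_floor.comp (measurable_snd.div_const dx))
  have sg : HasCompactSupport g := HasCompactSupport.of_support_subset_isCompact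
    (isCompact_Icc (a := -R) (b := R)) fun x hx => abs_le.1 (hR x hx)
  have bg : IsBdd g := .of_hasCompactSupport hg sg
  have bV : IsBdd fun x => V (u₀ x) := ⟨N, fun x => hN _ (hM x)⟩
  have mV : Measurable fun x => V (u₀ x) := hV.continuous.measurable.comp hu₀
  have bS : IsBdd (S.indicator (1 : ℝ × ℝ → ℝ)) := ⟨1, fun z => by
    by_cases hz : z ∈ S <;> simp [hz]⟩
  have mS : Measurable (S.indicator (1 : ℝ × ℝ → ℝ)) := measurable_one.indicator hSm
  have iP : Integrable (fun z : ℝ × ℝ => (1 / dx) * (S.indicator 1 z * V (u₀ z.2)) * g z.1)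
      ((volume.restrict I).prod (volume.restrict I)) :=
    (((IsBdd.const _).mul (bS.mul (bV.comp _))).mul (bg.comp _)).integrable
      ((measurable_const.mul (mS.mul (mV.comp measurable_snd))).mul
        (hg.measurable.comp measurable_fst))
  have mA : Measurable fun x : ℝ => cellAverage u₀ dx (⌊x / dx⌋ + 1) :=
    (measurable_from_top (f := fun j : ℤ => cellAverage u₀ dx (j + 1))).comp
      (Int.measurable_floor.comp (measurable_id.div_const dx))
  have step1 : ∫ x, V (cellAverage u₀ dx (⌊x / dx⌋ + 1)) * g x ≤
      ∫ x in I, ∫ z in I, (1 / dx) * (S.indicator 1 (x, z) * V (u₀ z)) * g x := by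
    rw [← setIntegral_eq_integral_of_forall_compl_eq_zero (s := I) fun x hx => by
      rw [hout x hx, mul_zero]]
    refine integral_mono ?_ iP.integral_prod_left fun x => ?_
    · exact (IsBdd.mul ⟨N, fun x => hN _ (abs_cellAverage_le hdx hM _)⟩ bg).integrable
        ((hV.continuous.measurable.comp mA).mul hg.measurable)
    simp only
    rcases eq_or_ne (g x) 0 with h0 | h0
    · simp [h0]
    have hx := abs_le.1 (hR x h0)
    rw [integral_mul_const, integral_const_mul]
    refine mul_le_mul_of_nonneg_right ((map_cellAverage_le hdx hV hu₀ hM _).trans (le_of_eq ?_))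
      (hg0 x)
    congr 1
    have e : ∀ z, S.indicator (1 : ℝ × ℝ → ℝ) (x, z) * V (u₀ z) =
        ({z : ℝ | ⌊z / dx⌋ = ⌊x / dx⌋}).indicator (fun z => V (u₀ z)) z := fun z => by
      by_cases h : ⌊z / dx⌋ = ⌊x / dx⌋
      · simp [hS, h]
      · simp [hS, h, Ne.symm h]
    simp only [e]
    rw [setIntegral_indicator (measurableSet_cell hdx _), inter_eq_self_of_subset_right]
    intro z hz
    have := abs_le.1 (abs_sub_le_of_floor_eq hdx hz)
    exact ⟨by linarith, by linarith⟩
  -- Belonging to the same cell is a symmetric relation, so exchanging the integrals produces the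
  -- cell average of `g` around `z`.
  have step2 : ∫ x in I, ∫ z in I, (1 / dx) * (S.indicator 1 (x, z) * V (u₀ z)) * g x ≤
      ∫ z in I, (V (u₀ z) * g z + N * (B * dx)) := by
    rw [integral_integral_swap iP]
    refine integral_mono iP.integral_prod_right ?_ fun z => ?_
    · exact ((bV.mul bg).add (IsBdd.const _)).integrable ((mV.mul hg.measurable).add measurable_const)
    simp only
    have e : ∀ x, (1 / dx) * (S.indicator (1 : ℝ × ℝ → ℝ) (x, z) * V (u₀ z)) * g x =
        V (u₀ z) * (1 / dx) * ({x : ℝ | ⌊x / dx⌋ = ⌊z / dx⌋}).indicator g x := fun x => by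
      by_cases h : ⌊x / dx⌋ = ⌊z / dx⌋
      · rw [indicator_of_mem (show (x, z) ∈ S from h), indicator_of_mem
          (show x ∈ {x : ℝ | ⌊x / dx⌋ = ⌊z / dx⌋} from h), Pi.one_apply]
        ring
      · rw [indicator_of_notMem (show (x, z) ∉ S from h), indicator_of_notMem
          (show x ∉ {x : ℝ | ⌊x / dx⌋ = ⌊z / dx⌋} from h)]
        ring
    simp only [e]
    rw [integral_const_mul]
    have i1 : IntegrableOn g {x : ℝ | ⌊x / dx⌋ = ⌊z / dx⌋} := by
      obtain ⟨C, hC⟩ := bg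
      exact integrableOn_cell hdx hg.measurable hC _
    have e2 : ∫ x in I, ({x : ℝ | ⌊x / dx⌋ = ⌊z / dx⌋}).indicator g x =
        ∫ x in {x : ℝ | ⌊x / dx⌋ = ⌊z / dx⌋}, g x := by
      rw [setIntegral_eq_integral_of_forall_compl_eq_zero, integral_indicator
        (measurableSet_cell hdx _)]
      intro x hx
      by_cases h : x ∈ {x : ℝ | ⌊x / dx⌋ = ⌊z / dx⌋}
      · rw [indicator_of_mem h, hout x hx]
      · rw [indicator_of_notMem h]
    have e3 : |(1 / dx) * (∫ x in I, ({x : ℝ | ⌊x / dx⌋ = ⌊z / dx⌋}).indicator g x) - g z| ≤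
        B * dx := by
      have e4 : g z = (1 / dx) * ∫ x in {x : ℝ | ⌊x / dx⌋ = ⌊z / dx⌋}, g z := by
        rw [setIntegral_const, volume_cell hdx, smul_eq_mul]
        field_simp
      have i2 : IntegrableOn (fun _ => g z) {x : ℝ | ⌊x / dx⌋ = ⌊z / dx⌋} :=
        integrableOn_cell hdx measurable_const (M := |g z|) (fun _ => le_rfl) _
      rw [e2]
      rw [e4]
      rw [← mul_sub, ← integral_sub i1 i2, abs_mul, abs_of_pos (by positivity), one_div,
        inv_mul_le_iff₀ hdx, ← Real.norm_eq_abs]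
      refine (norm_setIntegral_le_of_norm_le_const (C := B * dx) (volume_cell_ne_top hdx _).lt_top
        (fun x hx => (hB x z).trans ?_)).trans (le_of_eq ?_)
      · gcongr
        exact abs_sub_le_of_floor_eq hdx hx
      · rw [volume_cell hdx]
        ring
    have e5 := abs_le.1 (abs_mul_le_mul (hN _ (hM z)) e3)
    linarith [e5.2]
  refine step1.trans (step2.trans (le_of_eq ?_))
  have i3 : Integrable (fun z => V (u₀ z) * g z) (volume.restrict I) :=
    (bV.mul bg).integrable (mV.mul hg.measurable)
  rw [integral_add i3 (integrable_const _), setIntegral_const,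
    setIntegral_eq_integral_of_forall_compl_eq_zero (s := I) fun x hx => by
      rw [hout x hx, mul_zero], Real.volume_real_Icc_of_le (by linarith), smul_eq_mul]
  ring

/-! ### The entropy inequalities of the discrete solutions -/

theorem IsBdd.integrable_of_support {h : ℝ × ℝ → ℝ} (hh : IsBdd h) (hm : Measurable h) {R : ℝ}
    (hR : ∀ p, R < ‖p‖ → h p = 0) : Integrable h := by
  rw [← integrableOn_iff_integrable_of_support_subset (s := Metric.closedBall 0 R)]
  · have : IsFiniteMeasure (volume.restrict (Metric.closedBall (0 : ℝ × ℝ) R)) :=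
      ⟨by simpa using (isCompact_closedBall (0 : ℝ × ℝ) R).measure_lt_top⟩
    exact hh.integrable hm
  · intro p hp
    rw [mem_closedBall_zero_iff]
    by_contra! hlt
    exact hp (hR p hlt)

theorem IsTest.isBdd {R B : ℝ} {ψ : ℝ × ℝ → ℝ} (hψ : IsTest R B ψ) : IsBdd ψ :=
  .of_hasCompactSupport hψ.continuous hψ.hasCompactSupport

theorem IsTest.integrable_mul_translate {R B : ℝ} {ψ : ℝ × ℝ → ℝ} (hψ : IsTest R B ψ)
    {A : ℝ × ℝ → ℝ} (hA : IsBdd A) (mA : Measurable A) (h : ℝ × ℝ) :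
    Integrable fun p => A p * ψ (p - h) := by
  refine (hA.mul (hψ.isBdd.comp fun p => p - h)).integrable_of_support
    (mA.mul (hψ.continuous.comp (by fun_prop)).measurable) (R := R + ‖h‖) fun p hp => ?_
  rw [hψ.eq_zero, mul_zero]
  linarith [norm_sub_norm_le p h]

theorem integral_mul_translate (A ψ : ℝ × ℝ → ℝ) (h : ℝ × ℝ) :
    ∫ p, A p * ψ (p - h) = ∫ p, A (p + h) * ψ p := by
  rw [← integral_add_right_eq_self _ h]
  simp only [add_sub_cancel_right]

/-- Summation by parts in continuous form: translation invariance of the integral moves the shifts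
off `ψ`, and leaves the pointwise inequality multiplied by `ψ ≥ 0`. -/
theorem discrete_integral_nonneg {R B l : ℝ} {ψ A A' g : ℝ × ℝ → ℝ} (hψ : IsTest R B ψ)
    (hA : IsBdd A) (mA : Measurable A) (hA' : IsBdd A') (mA' : Measurable A') (hg : IsBdd g)
    (mg : Measurable g) {e h₁ h₂ : ℝ × ℝ}
    (hle : ∀ p, A' (p + e) - A p + l * (g (p + h₂) - g (p + h₁)) ≤ 0) :
    0 ≤ ∫ p, (A p * ψ p - A' p * ψ (p - e) + l * (g p * ψ (p - h₁) - g p * ψ (p - h₂))) := by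
  have i0 : Integrable fun p => A p * ψ p := by
    simpa using hψ.integrable_mul_translate hA mA 0
  have i1 := hψ.integrable_mul_translate hA' mA' e
  have i2 := hψ.integrable_mul_translate hg mg h₁
  have i3 := hψ.integrable_mul_translate hg mg h₂
  have j : ∀ {A : ℝ × ℝ → ℝ} (_ : IsBdd A) (_ : Measurable A) (h : ℝ × ℝ),
      Integrable fun p => A (p + h) * ψ p := fun hA mA h => by
    simpa using hψ.integrable_mul_translate (hA.comp fun p => p + h)
      (mA.comp (measurable_add_const h)) 0
  have j1 := j hA' mA' e
  have j2 := j hg mg h₁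
  have j3 := j hg mg h₂
  rw [integral_add (i0.sub' i1) ((i2.sub' i3).const_mul l), integral_sub i0 i1,
    integral_const_mul, integral_sub i2 i3, integral_mul_translate, integral_mul_translate,
    integral_mul_translate, ← integral_sub i0 j1, ← integral_sub j2 j3, ← integral_const_mul,
    ← integral_add (i0.sub' j1) ((j2.sub' j3).const_mul l)]
  refine integral_nonneg fun p => ?_
  have := mul_nonneg (neg_nonneg.2 (hle p)) (hψ.nonneg p)
  simp only [Pi.zero_apply]
  linarith

theorem IsTest.taylor {R B : ℝ} {ψ : ℝ × ℝ → ℝ} (hψ : IsTest R B ψ) (hB : 0 ≤ B) (p h : ℝ × ℝ) :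
    |ψ (p - h) - ψ p + fderiv ℝ ψ p h| ≤ B * ‖h‖ ^ 2 := by
  have := (convex_closedBall p ‖h‖).norm_image_sub_le_of_norm_fderiv_le' (f := ψ) (𝕜 := ℝ)
    (φ := fderiv ℝ ψ p) (C := B * ‖h‖) (x := p) (y := p - h)
    (fun x _ => hψ.contDiff.differentiable (by norm_num) x)
    (fun x hx => (hψ.lipschitz_fderiv x p).trans (by
      gcongr
      rwa [mem_closedBall_iff_norm] at hx))
    (Metric.mem_closedBall_self (norm_nonneg h)) (by simp)
  rw [sub_sub_cancel_left, map_neg, sub_neg_eq_add, norm_neg, Real.norm_eq_abs] at this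
  linarith

theorem measurable_piecewiseConstant (dt dx : ℝ) (w : ℕ → ℤ → ℝ) :
    Measurable (piecewiseConstant dt dx w) := by
  have h1 : Measurable fun p : ℝ × ℝ => (⌊p.2 / dt⌋₊, ⌊p.1 / dx⌋) :=
    (Nat.measurable_floor.comp (measurable_snd.div_const dt)).prodMk
      (Int.measurable_floor.comp (measurable_fst.div_const dx))
  exact (measurable_of_countable fun z : ℕ × ℤ => w z.1 (z.2 + 1)).comp h1

theorem piecewiseConstant_add_time {dt : ℝ} (hdt : 0 < dt) (dx : ℝ) (w : ℕ → ℤ → ℝ) {p : ℝ × ℝ}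
    (hp : 0 ≤ p.2) :
    piecewiseConstant dt dx w (p + (0, dt)) = w (⌊p.2 / dt⌋₊ + 1) (⌊p.1 / dx⌋ + 1) := by
  rw [piecewiseConstant, Prod.fst_add, Prod.snd_add, add_zero, add_div, div_self hdt.ne',
    Nat.floor_add_one (by positivity)]

theorem piecewiseConstant_add_space (dt : ℝ) {dx : ℝ} (hdx : 0 < dx) (w : ℕ → ℤ → ℝ) (p : ℝ × ℝ)
    (i : ℤ) :
    piecewiseConstant dt dx w (p + (i * dx, 0)) = w ⌊p.2 / dt⌋₊ (⌊p.1 / dx⌋ + 1 + i) := by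
  rw [piecewiseConstant, Prod.fst_add, Prod.snd_add, add_zero, add_div,
    mul_div_assoc, div_self hdx.ne', mul_one, Int.floor_add_intCast]
  congr 1
  ring

theorem setOf_nonneg_ae_eq_halfPlane :
    ({p : ℝ × ℝ | 0 ≤ p.2} : Set (ℝ × ℝ)) =ᵐ[volume] halfPlane := by
  have h0 : volume ((univ : Set ℝ) ×ˢ ({0} : Set ℝ)) = 0 := by
    rw [Measure.volume_eq_prod, Measure.prod_prod, Real.volume_singleton, mul_zero]
  filter_upwards [compl_mem_ae_iff.2 h0] with p hp
  have hp' : p.2 ≠ 0 := fun h => hp ⟨mem_univ _, h⟩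
  exact propext ⟨fun h => lt_of_le_of_ne h hp'.symm, fun h => le_of_lt h⟩

/-- The inequalities between cells are pointwise inequalities between the piecewise constant
function and its translates by one cell. They are tested with `ψ`, and Taylor's formula turns the
differences of `ψ` into derivatives. -/
theorem discrete_entropy {f V G u₀ : ℝ → ℝ} {dt dx M N R B : ℝ} {a : ℤ} (ha : a = 0 ∨ a = 1)
    (hdt : 0 < dt) (hdt1 : dt ≤ 1) (hdx : 0 < dx) (hdx1 : dx ≤ 1) (hV : IsEntropyPair f V G)
    (hN : ∀ v, |v| ≤ M → |V v| ≤ N ∧ |G v| ≤ N) (hu₀ : Measurable u₀) (hM : ∀ x, |u₀ x| ≤ M)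
    {w : ℕ → ℤ → ℝ} (hw0 : w 0 = cellAverage u₀ dx) (hw : ∀ n j, |w n j| ≤ M)
    (hstep : ∀ n j, V (w (n + 1) j) ≤
      V (w n j) - dt / dx * (G (w n (j + a)) - G (w n (j + a - 1))))
    {ψ : ℝ × ℝ → ℝ} (hψ : IsTest R B ψ) (hR : 0 ≤ R) (hB : 0 ≤ B) :
    -(N * B * (volume.real (Metric.closedBall (0 : ℝ × ℝ) (R + 1)) + 2 * (R + 1)) *
      (dt + 2 * dx)) ≤ entropyFunctional V G u₀ (piecewiseConstant dt dx w) ψ := by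
  set ub := piecewiseConstant dt dx w with hub
  set H : Set (ℝ × ℝ) := {p | 0 ≤ p.2} with hH
  set T : Set (ℝ × ℝ) := {p | 0 ≤ p.2 ∧ p.2 < dt} with hT
  set K := Metric.closedBall (0 : ℝ × ℝ) (R + 1) with hK
  set J := Icc (-(R + 1)) (R + 1) ×ˢ Ico (0 : ℝ) dt with hJ
  have mub : Measurable ub := measurable_piecewiseConstant _ _ _
  have bub : ∀ p, |ub p| ≤ M := fun p => hw _ _
  have mH : MeasurableSet H := measurableSet_le measurable_const measurable_snd
  have mT : MeasurableSet T := mH.inter (measurableSet_lt measurable_snd measurable_const)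
  have mK : MeasurableSet K := Metric.isClosed_closedBall.measurableSet
  have mJ : MeasurableSet J := measurableSet_Icc.prod measurableSet_Ico
  have hN0 : 0 ≤ N := (abs_nonneg _).trans (hN _ (hM 0)).1
  set A : ℝ × ℝ → ℝ := H.indicator fun p => V (ub p) with hA
  set g : ℝ × ℝ → ℝ := H.indicator fun p => G (ub p) with hg
  -- Everything is extended by zero to negative times. `S` is the first time layer; subtracting it
  -- from `A` removes the jump at `t = 0`, and its pairing with `ψ` becomes the initial term.
  set S : ℝ × ℝ → ℝ := T.indicator fun p => V (ub p) with hS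
  have mV : Measurable fun p => V (ub p) := hV.continuous.measurable.comp mub
  have mG : Measurable fun p => G (ub p) := hV.continuous_flux.measurable.comp mub
  have ind : ∀ (Y : Set (ℝ × ℝ)) (k : ℝ × ℝ → ℝ), (∀ p, |k p| ≤ N) → ∀ p, |Y.indicator k p| ≤ N :=
    fun Y k hk p => by
      by_cases hp : p ∈ Y
      · rw [indicator_of_mem hp]
        exact hk p
      · rw [indicator_of_notMem hp, abs_zero]
        exact hN0
  have bA : ∀ p, |A p| ≤ N := ind _ _ fun p => (hN _ (bub p)).1
  have bg : ∀ p, |g p| ≤ N := ind _ _ fun p => (hN _ (bub p)).2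
  have bS : ∀ p, |S p| ≤ N := ind _ _ fun p => (hN _ (bub p)).1
  have mA : Measurable A := mV.indicator mH
  have mg : Measurable g := mG.indicator mH
  have mS : Measurable S := mV.indicator mT
  set e : ℝ × ℝ := (0, dt) with he
  set h₁ : ℝ × ℝ := (((a - 1 : ℤ) : ℝ) * dx, 0) with hh₁
  set h₂ : ℝ × ℝ := ((a : ℝ) * dx, 0) with hh₂
  have ne : ‖e‖ = dt := by rw [he, Prod.norm_mk, norm_zero, Real.norm_of_nonneg hdt.le,
    max_eq_right hdt.le]
  have n1 : ‖h₁‖ ≤ dx := by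
    rw [hh₁, Prod.norm_mk, norm_zero, norm_mul, Real.norm_of_nonneg hdx.le]
    rcases ha with rfl | rfl <;> simp [hdx.le]
  have n2 : ‖h₂‖ ≤ dx := by
    rw [hh₂, Prod.norm_mk, norm_zero, norm_mul, Real.norm_of_nonneg hdx.le]
    rcases ha with rfl | rfl <;> simp [hdx.le]
  -- For `p.2 ≥ 0` the pointwise inequality is `hstep`. For `p.2 < 0` a time step leads at most into
  -- the first layer, where `A - S` vanishes, so all terms are zero.
  have key := discrete_integral_nonneg (l := dt / dx) hψ ⟨N, bA⟩ mA
    (IsBdd.sub ⟨N, bA⟩ ⟨N, bS⟩) (mA.sub mS) ⟨N, bg⟩ mg (e := e) (h₁ := h₁) (h₂ := h₂) (by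
      intro p
      by_cases hp : 0 ≤ p.2
      · have q1 : p + h₁ ∈ H := by simpa [hH, hh₁] using hp
        have q2 : p + h₂ ∈ H := by simpa [hH, hh₂] using hp
        have q3 : p + e ∈ H := by
          change 0 ≤ p.2 + dt
          positivity
        have q4 : p + e ∉ T := fun h => by
          have : p.2 + dt < dt := h.2
          linarith
        have q5 : p ∈ H := hp
        rw [hA, hS, hg, indicator_of_mem q1, indicator_of_mem q2, indicator_of_mem q3,
          indicator_of_notMem q4, indicator_of_mem q5, hub, he, hh₁, hh₂,
          piecewiseConstant_add_time hdt _ _ hp, piecewiseConstant_add_space _ hdx,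
          piecewiseConstant_add_space _ hdx, piecewiseConstant]
        have := hstep ⌊p.2 / dt⌋₊ (⌊p.1 / dx⌋ + 1)
        rw [add_sub_assoc] at this
        linarith
      · have q1 : p + h₁ ∉ H := by simpa [hH, hh₁] using hp
        have q2 : p + h₂ ∉ H := by simpa [hH, hh₂] using hp
        have q5 : p ∉ H := hp
        have q3 : A (p + e) = S (p + e) := by
          by_cases h : p + e ∈ H
          · have h' : p + e ∈ T := ⟨h, by
              change p.2 + dt < dt
              linarith⟩
            rw [hA, hS, indicator_of_mem h, indicator_of_mem h']
          · have h' : p + e ∉ T := fun h' => h h'.1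
            rw [hA, hS, indicator_of_notMem h, indicator_of_notMem h']
        simp only [q3]
        rw [hA, hg, indicator_of_notMem q1, indicator_of_notMem q2, indicator_of_notMem q5]
        simp)
  -- Errors divided by `dt`: on `K` the Taylor remainders of one time shift and two space shifts, on
  -- `J` the cost of replacing `ψ (p - e)` by its value at the initial time.
  set E : ℝ × ℝ → ℝ := fun p => K.indicator 1 p * (N * B * (dt + 2 * dx)) +
    J.indicator 1 p * (N * B) with hE
  have point : ∀ p, A p * ψ p - (A p - S p) * ψ (p - e) +
      dt / dx * (g p * ψ (p - h₁) - g p * ψ (p - h₂)) ≤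
      dt * ((A p * fderiv ℝ ψ p (0, 1) + g p * fderiv ℝ ψ p (1, 0)) + E p) + S p * ψ (p.1, 0) := by
    intro p
    by_cases hp : R + 1 < ‖p‖
    · have z : ∀ h : ℝ × ℝ, ‖h‖ ≤ 1 → ψ (p - h) = 0 := fun h hh =>
        hψ.eq_zero (by linarith [norm_sub_norm_le p h])
      have hpK : p ∉ K := by
        rw [hK, mem_closedBall_zero_iff]
        exact not_le.2 hp
      rw [hψ.eq_zero (by linarith : R < ‖p‖), z e (by linarith), z h₁ (by linarith),
        z h₂ (by linarith), hψ.fderiv_eq_zero (by linarith : R < ‖p‖), hE]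
      simp only [indicator_of_notMem hpK, zero_apply]
      have hSψ : S p * ψ (p.1, 0) = 0 := by
        by_cases h : p ∈ T
        · rw [hψ.eq_zero, mul_zero]
          have h2 : ‖p.2‖ ≤ 1 := by
            rw [Real.norm_of_nonneg h.1]
            linarith [h.2]
          rw [Prod.norm_mk, norm_zero, max_eq_left (norm_nonneg _)]
          rw [Prod.norm_def] at hp
          rcases lt_max_iff.1 hp with h3 | h3 <;> linarith
        · rw [hS, indicator_of_notMem h, zero_mul]
      rw [hSψ]
      have : 0 ≤ J.indicator (1 : ℝ × ℝ → ℝ) p := indicator_nonneg (fun _ _ => zero_le_one) _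
      simp only [mul_zero, sub_self, add_zero, zero_mul, zero_add]
      positivity
    · have hpK : p ∈ K := by
        rw [hK, mem_closedBall_zero_iff]
        exact not_lt.1 hp
      have t0 := hψ.taylor hB p e
      have t1 := hψ.taylor hB p h₁
      have t2 := hψ.taylor hB p h₂
      have e0 : fderiv ℝ ψ p e = dt * fderiv ℝ ψ p (0, 1) := by
        rw [show e = dt • ((0 : ℝ), (1 : ℝ)) by simp [he], map_smul, smul_eq_mul]
      have e1 : fderiv ℝ ψ p h₁ = fderiv ℝ ψ p h₂ - dx * fderiv ℝ ψ p (1, 0) := by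
        rw [show h₁ = h₂ - dx • ((1 : ℝ), (0 : ℝ)) by simp [hh₁, hh₂]; ring, map_sub, map_smul,
          smul_eq_mul]
      rw [ne, e0] at t0
      have s0 := abs_mul_le_mul (bA p) t0
      have t1' := t1.trans (by gcongr : _ ≤ B * dx ^ 2)
      have t2' := t2.trans (by gcongr : _ ≤ B * dx ^ 2)
      rw [e1] at t1'
      have s1 := abs_mul_le_mul (bg p) t1'
      have s2 := abs_mul_le_mul (bg p) t2'
      have s3 : S p * ψ (p - e) - S p * ψ (p.1, 0) ≤ dt * (J.indicator 1 p * (N * B)) := by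
        by_cases h : p ∈ T
        · have hpJ : p ∈ J := by
            refine ⟨?_, h.1, h.2⟩
            rw [hK, mem_closedBall_zero_iff] at hpK
            exact abs_le.1 ((norm_fst_le p).trans hpK)
          rw [indicator_of_mem hpJ, Pi.one_apply, ← mul_sub]
          have l1 : |ψ (p - e) - ψ (p.1, 0)| ≤ B * dt := by
            refine (hψ.lipschitz _ _).trans ?_
            gcongr
            rw [he, Prod.norm_def]
            simp only [Prod.fst_sub, Prod.snd_sub, sub_zero, sub_self, norm_zero, Real.norm_eq_abs]
            refine max_le hdt.le ?_
            rw [abs_le]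
            constructor <;> linarith [h.1, h.2]
          have := abs_le.1 (abs_mul_le_mul (bS p) l1)
          linarith [this.2]
        · have : 0 ≤ J.indicator (1 : ℝ × ℝ → ℝ) p := indicator_nonneg (fun _ _ => zero_le_one) _
          rw [hS, indicator_of_notMem h, zero_mul, zero_mul, sub_zero]
          positivity
      have s4 : dt / dx * (g p * ψ (p - h₁) - g p * ψ (p - h₂)) ≤
          dt * (g p * fderiv ℝ ψ p (1, 0)) + dt * (N * B * (2 * dx)) := by
        rw [abs_le] at s1 s2
        have : g p * ψ (p - h₁) - g p * ψ (p - h₂) ≤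
            dx * (g p * fderiv ℝ ψ p (1, 0) + N * B * (2 * dx)) := by
          linarith [s1.2, s2.1]
        calc _ ≤ dt / dx * (dx * (g p * fderiv ℝ ψ p (1, 0) + N * B * (2 * dx))) := by gcongr
          _ = _ := by field_simp
      rw [abs_le] at s0
      simp only [hE]
      rw [indicator_of_mem hpK, Pi.one_apply]
      linarith [s0.1]
  have iΦ : Integrable fun p => A p * fderiv ℝ ψ p (0, 1) + g p * fderiv ℝ ψ p (1, 0) :=
    ((hψ.integrable_fderiv (0, 1)).bdd_mul mA.aestronglyMeasurable (ae_of_all _ bA)).add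
      ((hψ.integrable_fderiv (1, 0)).bdd_mul mg.aestronglyMeasurable (ae_of_all _ bg))
  have vK : volume K ≠ ⊤ := (isCompact_closedBall (0 : ℝ × ℝ) (R + 1)).measure_lt_top.ne
  have vJ : volume J = ENNReal.ofReal (2 * (R + 1) * dt) := by
    rw [hJ, Measure.volume_eq_prod, Measure.prod_prod, Real.volume_Icc, Real.volume_Ico,
      ← ENNReal.ofReal_mul (by linarith)]
    congr 1
    ring
  have iK : Integrable (K.indicator (1 : ℝ × ℝ → ℝ)) :=
    (integrable_indicator_iff mK).2 (integrableOn_const vK)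
  have iJ : Integrable (J.indicator (1 : ℝ × ℝ → ℝ)) :=
    (integrable_indicator_iff mJ).2 (integrableOn_const (by rw [vJ]; exact ENNReal.ofReal_ne_top))
  have iE : Integrable E := (iK.mul_const _).add (iJ.mul_const _)
  have vE : ∫ p, E p = volume.real K * (N * B * (dt + 2 * dx)) + 2 * (R + 1) * dt * (N * B) := by
    rw [hE, integral_add (iK.mul_const _) (iJ.mul_const _), integral_mul_const, integral_mul_const,
      integral_indicator_one mK, integral_indicator_one mJ, measureReal_def (s := J), vJ,
      ENNReal.toReal_ofReal (by positivity)]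
  have eS : ∀ p : ℝ × ℝ, S p * ψ (p.1, 0) = (V (cellAverage u₀ dx (⌊p.1 / dx⌋ + 1)) * ψ (p.1, 0)) *
      (Ico 0 dt).indicator (1 : ℝ → ℝ) p.2 := fun p => by
    by_cases h : p ∈ T
    · have h0 : ⌊p.2 / dt⌋₊ = 0 := Nat.floor_eq_zero.2 ((div_lt_one hdt).2 h.2)
      rw [hS, indicator_of_mem h, indicator_of_mem (show p.2 ∈ Ico 0 dt from h), hub,
        piecewiseConstant, h0, hw0, Pi.one_apply, mul_one]
    · rw [hS, indicator_of_notMem h, indicator_of_notMem (show p.2 ∉ Ico 0 dt from h), zero_mul,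
        mul_zero]
  have mA₀ : Measurable fun x : ℝ => cellAverage u₀ dx (⌊x / dx⌋ + 1) :=
    (measurable_from_top (f := fun j : ℤ => cellAverage u₀ dx (j + 1))).comp
      (Int.measurable_floor.comp (measurable_id.div_const dx))
  have i0 : Integrable fun x : ℝ => V (cellAverage u₀ dx (⌊x / dx⌋ + 1)) * ψ (x, 0) :=
    integrable_comp_mul hV.continuous mA₀ (fun x => abs_cellAverage_le hdx hM _)
      hψ.integrable_initial
  have iI : Integrable ((Ico 0 dt).indicator (1 : ℝ → ℝ)) :=
    (integrable_indicator_iff measurableSet_Ico).2 (integrableOn_const measure_Ico_lt_top.ne)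
  have iS : Integrable fun p : ℝ × ℝ => S p * ψ (p.1, 0) := by
    simp only [eS]
    exact i0.mul_prod iI
  have vS : ∫ p : ℝ × ℝ, S p * ψ (p.1, 0) =
      dt * ∫ x, V (cellAverage u₀ dx (⌊x / dx⌋ + 1)) * ψ (x, 0) := by
    simp only [eS]
    rw [Measure.volume_eq_prod, integral_prod_mul (fun x : ℝ =>
      V (cellAverage u₀ dx (⌊x / dx⌋ + 1)) * ψ (x, 0)), integral_indicator_one measurableSet_Ico,
      Real.volume_real_Ico_of_le hdt.le, sub_zero, mul_comm]
  have hinit := initial_average_le (g := fun x => ψ (x, 0)) hdx hdx1 hV (fun v hv => (hN v hv).1) hu₀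
    hM hψ.continuous_initial (fun x => hψ.nonneg _) hR
    (fun x hx => (norm_fst_le (x, (0 : ℝ))).trans (hψ.support _ hx)) hB (fun x y => by
      refine (hψ.lipschitz _ _).trans (le_of_eq ?_)
      rw [Prod.mk_sub_mk, sub_self, Prod.norm_mk, norm_zero, max_eq_left (norm_nonneg _),
        Real.norm_eq_abs])
  have vΦ : ∫ p, (A p * fderiv ℝ ψ p (0, 1) + g p * fderiv ℝ ψ p (1, 0)) =
      ∫ p in halfPlane, (V (ub p) * fderiv ℝ ψ p (0, 1) + G (ub p) * fderiv ℝ ψ p (1, 0)) := by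
    rw [← setIntegral_congr_set setOf_nonneg_ae_eq_halfPlane, ← integral_indicator mH]
    refine integral_congr_ae (ae_of_all _ fun p => ?_)
    by_cases h : p ∈ H
    · simp only [hA, hg, indicator_of_mem h]
    · simp only [hA, hg, indicator_of_notMem h, zero_mul, add_zero]
  have iL : ∀ h : ℝ × ℝ, Integrable fun p => g p * ψ (p - h) :=
    hψ.integrable_mul_translate ⟨N, bg⟩ mg
  have iΦE : Integrable fun p =>
      (A p * fderiv ℝ ψ p (0, 1) + g p * fderiv ℝ ψ p (1, 0)) + E p := iΦ.add iE
  have total := integral_mono (((show Integrable fun p => A p * ψ p by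
      simpa using hψ.integrable_mul_translate ⟨N, bA⟩ mA 0).sub'
        (hψ.integrable_mul_translate (IsBdd.sub ⟨N, bA⟩ ⟨N, bS⟩) (mA.sub mS) e)).add
      (((iL h₁).sub' (iL h₂)).const_mul (dt / dx))) ((iΦE.const_mul dt).add iS) point
  rw [integral_add (iΦE.const_mul dt) iS, integral_const_mul, integral_add iΦ iE, vS, vE, vΦ,
    ← mul_add] at total
  have fin := nonneg_of_mul_nonneg_right (key.trans total) hdt
  rw [entropyFunctional]
  -- The initial terms contribute `dt + dx` times `N * B * (2 * (R + 1))`; this surplus rounds it up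
  -- to the common factor `dt + 2 * dx`.
  have : 0 ≤ N * B * (2 * (R + 1)) * dx := by positivity
  linarith

/-- The solutions of a scheme with upwind entropy inequalities are asymptotic solutions. -/
theorem asymptoticSolution_of_discrete {f u₀ : ℝ → ℝ} {M : ℝ} {a : ℤ} (ha : a = 0 ∨ a = 1)
    (hu₀ : Measurable u₀) (hM : ∀ x, |u₀ x| ≤ M) {dt dx : ℕ → ℝ} (hdt : ∀ k, 0 < dt k)
    (hdx : ∀ k, 0 < dx k) (hdt0 : Tendsto dt atTop (𝓝 0)) (hdx0 : Tendsto dx atTop (𝓝 0))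
    {w : ℕ → ℕ → ℤ → ℝ} (hw0 : ∀ k, w k 0 = cellAverage u₀ (dx k)) (hw : ∀ k n j, |w k n j| ≤ M)
    (hstep : ∀ k n j V G, IsEntropyPair f V G → V (w k (n + 1) j) ≤
      V (w k n j) - dt k / dx k * (G (w k n (j + a)) - G (w k n (j + a - 1)))) :
    AsymptoticSolution f u₀ M fun k => piecewiseConstant (dt k) (dx k) (w k) where
  measurable k := measurable_piecewiseConstant _ _ _
  bound k p := hw _ _ _
  entropy R B N ε hε := by
    set C := N * max B 0 *
      (volume.real (Metric.closedBall (0 : ℝ × ℝ) (max R 0 + 1)) + 2 * (max R 0 + 1)) with hC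
    have h0 : Tendsto (fun k => C * (dt k + 2 * dx k)) atTop (𝓝 (C * (0 + 2 * 0))) :=
      (hdt0.add (hdx0.const_mul 2)).const_mul C
    rw [mul_zero, add_zero, mul_zero] at h0
    filter_upwards [h0.eventually (gt_mem_nhds hε), hdt0.eventually (gt_mem_nhds one_pos),
      hdx0.eventually (gt_mem_nhds one_pos)] with k hk hk1 hk2 V G hVG hN ψ hψ
    have := discrete_entropy ha (hdt k) hk1.le (hdx k) hk2.le hVG hN hu₀ hM (hw0 k) (hw k)
      (fun n j => hstep k n j V G hVG) (hψ.mono (le_max_left R 0) (le_max_left B 0))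
      (le_max_right _ _) (le_max_right _ _)
    linarith

theorem UpwindData.asymptoticSolution {f φ g : ℝ → ℝ} {ς : ℝ} {a : ℤ} (h : UpwindData f φ g ς a)
    {u₀ : ℝ → ℝ} {M : ℝ} (hu₀ : Measurable u₀) (hM : ∀ x, |u₀ x| ≤ M) {dt dx : ℕ → ℝ}
    (hdt : ∀ k, 0 < dt k) (hdx : ∀ k, 0 < dx k) (hdt0 : Tendsto dt atTop (𝓝 0))
    (hdx0 : Tendsto dx atTop (𝓝 0))
    (hS : ∀ k, ∃ S ∈ convexityRegions, ∀ (n : ℕ) (j : ℤ),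
      discreteSolution f φ u₀ (dt k) (dx k) n j ∈ S)
    (hcfl : ∀ (k n : ℕ) (j : ℤ), CFLAt f φ (dt k) (dx k)
      (discreteSolution f φ u₀ (dt k) (dx k) n) j) :
    AsymptoticSolution f u₀ M fun k =>
      piecewiseConstant (dt k) (dx k) (discreteSolution f φ u₀ (dt k) (dx k)) := by
  have max_principle := fun k n j =>
    let ⟨S, hS, hu⟩ := hS k
    h.max_principle (hdt k) (hdx k) hS (j := j) (fun i _ _ => hu n i) fun i _ _ => hcfl k n i
  refine asymptoticSolution_of_discrete (a := a) ?_ hu₀ hM hdt hdx hdt0 hdx0 (fun k => rfl)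
    (fun k n => ?_) fun k n j V G hV => ?_
  · rcases h.cases with ⟨-, -, h, -⟩ | ⟨-, -, h, -⟩
    exacts [Or.inl h, Or.inr h]
  · induction n with
    | zero => exact abs_cellAverage_le (hdx k) hM
    | succ n ih =>
      intro j
      have := max_principle k n j
      rw [discreteSolution]
      have h1 := abs_le.1 (ih (j - 1))
      have h2 := abs_le.1 (ih j)
      have h3 := abs_le.1 (ih (j + 1))
      exact abs_le.2 ⟨(le_min (le_min h1.1 h2.1) h3.1).trans this.1,
        this.2.trans (max_le (max_le h1.2 h2.2) h3.2)⟩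
  · obtain ⟨S, hS, hu⟩ := hS k
    have := (h.one_step (hdt k) (hdx k) hS (j := j) (fun i _ _ => hu n i)
      fun i _ _ => hcfl k n i).2 V G hV
    rw [h.upwindValue_eq, h.upwindValue_eq, sub_add_eq_add_sub] at this
    exact this

/-! ### Classical solutions as asymptotic solutions -/

/-- Truncation at the essential supremum changes nothing almost everywhere, and supplies the bounds
at every point that asymptotic solutions require. -/
theorem exists_bounded_representative {α : Type*} [MeasurableSpace α] {μ : Measure α} {h : α → ℝ}
    (hh : MemLp h ⊤ μ) : ∃ (k : α → ℝ) (C : ℝ), Measurable k ∧ (∀ x, |k x| ≤ C) ∧ h =ᵐ[μ] k := by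
  set C := (eLpNormEssSup h μ).toReal with hC
  have hC0 : 0 ≤ C := ENNReal.toReal_nonneg
  have hfin : eLpNormEssSup h μ ≠ ⊤ := by
    have := hh.2
    rw [eLpNorm_exponent_top] at this
    exact this.ne
  refine ⟨fun x => max (-C) (min C (hh.1.mk h x)), C, measurable_const.max
    (measurable_const.min hh.1.stronglyMeasurable_mk.measurable), fun x => ?_, ?_⟩
  · exact abs_le.2 ⟨le_max_left _ _, max_le (by linarith) (min_le_left _ _)⟩
  · filter_upwards [hh.1.ae_eq_mk, ae_le_eLpNormEssSup (f := h) (μ := μ)] with x h1 h2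
    have h3 : |h x| ≤ C := by
      rw [← ENNReal.ofReal_toReal hfin, ← ofReal_norm] at h2
      exact (ENNReal.ofReal_le_ofReal_iff hC0).1 h2
    rw [← h1, min_eq_right (abs_le.1 h3).2, max_eq_right (abs_le.1 h3).1]

theorem IsClassicalSolution.congr {f u₀ v₀ : ℝ → ℝ} {u v : ℝ × ℝ → ℝ}
    (h : IsClassicalSolution f u₀ u) (h₀ : u₀ =ᵐ[volume] v₀)
    (huv : u =ᵐ[volume.restrict halfPlane] v) : IsClassicalSolution f v₀ v where
  bounded := h.bounded.ae_eq huv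
  weak ψ hψ hc := by
    refine Eq.trans ?_ (h.weak ψ hψ hc)
    congr 1
    · exact integral_congr_ae (huv.mono fun p hp => by simp only [hp])
    · exact integral_congr_ae (h₀.mono fun x hx => by simp only [hx])
  entropy V G hV ψ hψ hc h0 := by
    refine (h.entropy V G hV ψ hψ hc h0).trans (le_of_eq ?_)
    congr 1
    · exact integral_congr_ae (huv.mono fun p hp => by simp only [hp])
    · exact integral_congr_ae (h₀.mono fun x hx => by simp only [hx])

theorem IsClassicalSolution.asymptoticSolution {f u₀ : ℝ → ℝ} {v : ℝ × ℝ → ℝ}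
    (h : IsClassicalSolution f u₀ v) (hv : Measurable v) {M : ℝ} (hM : ∀ p, |v p| ≤ M) :
    AsymptoticSolution f u₀ M fun _ => v where
  measurable _ := hv
  bound _ := hM
  entropy _ _ _ _ hε := Eventually.of_forall fun _ V G hV _ ψ hψ =>
    (neg_nonpos.2 hε.le).trans (h.entropy V G hV ψ hψ.contDiff hψ.hasCompactSupport hψ.nonneg)

/-- With a constant second sequence the statement along the ultrafilter does not depend on its
index, so it holds outright. -/
theorem AsymptoticSolution.eventually_integral_le {f u₀ : ℝ → ℝ} (hf : ContDiff ℝ 1 f) {M : ℝ}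
    {u : ℕ → ℝ × ℝ → ℝ} {v : ℝ × ℝ → ℝ} (hu : AsymptoticSolution f u₀ M u)
    (hv : IsClassicalSolution f u₀ v) (mv : Measurable v) (hvM : ∀ p, |v p| ≤ M)
    (hu₀ : Measurable u₀) (hM₀ : ∀ x, |u₀ x| ≤ M) {R θ : ℝ} (hR : 0 ≤ R) (hθ : 0 < θ) :
    ∀ᶠ k in atTop, ∫ p in halfBall R, |u k p - v p| ≤ θ := by
  have h := comparison hf hu (hv.asymptoticSolution mv hvM) hu₀ hM₀ (𝒱 := Ultrafilter.of atTop)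
    (Ultrafilter.of_le _) hR hθ
  filter_upwards [h] with k hk
  exact hk.exists.choose_spec

/-- Two late members of the sequence are both close to a common third one, whose index is chosen far
along the ultrafilter. -/
theorem AsymptoticSolution.eventually_integral_sub_le {f u₀ : ℝ → ℝ} (hf : ContDiff ℝ 1 f) {M : ℝ}
    {u : ℕ → ℝ × ℝ → ℝ} (hu : AsymptoticSolution f u₀ M u)
    (hu₀ : Measurable u₀) (hM₀ : ∀ x, |u₀ x| ≤ M) {R θ : ℝ} (hR : 0 ≤ R) (hθ : 0 < θ) :
    ∀ᶠ k in atTop, ∀ n, k ≤ n → ∀ m, k ≤ m → ∫ p in halfBall R, |u n p - u m p| ≤ θ := by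
  have h := comparison hf hu hu hu₀ hM₀ (𝒱 := Ultrafilter.of atTop)
    (Ultrafilter.of_le _) hR (half_pos hθ)
  obtain ⟨k, hk⟩ := eventually_atTop.1 h
  filter_upwards [eventually_ge_atTop k] with k' hk' n hn m hm
  obtain ⟨l, hl1, hl2⟩ := ((hk n (hk'.trans hn)).and (hk m (hk'.trans hm))).exists
  have i : ∀ a b, Integrable (fun p => |u a p - u b p|) (volume.restrict (halfBall R)) := fun a b =>
    (IsBdd.abs (IsBdd.sub ⟨M, hu.bound a⟩ ⟨M, hu.bound b⟩)).integrable
      (measurable_norm.comp ((hu.measurable a).sub (hu.measurable b)))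
  have : ∫ p in halfBall R, |u n p - u m p| ≤
      ∫ p in halfBall R, (|u n p - u l p| + |u m p - u l p|) :=
    integral_mono (i n m) ((i n l).add (i m l)) fun p => by
      simp only
      rw [abs_sub_comm (u m p)]
      exact abs_sub_le _ _ _
  rw [integral_add (i n l) (i m l)] at this
  linarith

/-! ### Existence of a limit and passage to the limit -/

theorem iUnion_halfBall : ⋃ R : ℕ, halfBall R = halfPlane := by
  ext p
  simp only [halfBall, mem_iUnion, mem_inter_iff, mem_closedBall_zero_iff]
  exact ⟨fun ⟨_, h, _⟩ => h, fun h => (exists_nat_ge ‖p‖).imp fun R hR => ⟨h, hR⟩⟩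

theorem eLpNorm_one_halfBall {h : ℝ × ℝ → ℝ} (hm : Measurable h) (hb : IsBdd h) (R : ℝ) :
    eLpNorm h 1 (volume.restrict (halfBall R)) =
      ENNReal.ofReal (∫ p in halfBall R, |h p|) := by
  rw [eLpNorm_one_eq_lintegral_enorm, ← ofReal_integral_norm_eq_lintegral_enorm (hb.integrable hm)]
  rfl

/-- A diagonal extraction: from the `N`-th index on, the distances on the half-ball of radius `N`
are at most `2⁻ᴺ`. Summability yields convergence almost everywhere on each half-ball. -/
theorem AsymptoticSolution.exists_limit {f u₀ : ℝ → ℝ} (hf : ContDiff ℝ 1 f) {M : ℝ}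
    {u : ℕ → ℝ × ℝ → ℝ} (hu : AsymptoticSolution f u₀ M u)
    (hu₀ : Measurable u₀) (hM₀ : ∀ x, |u₀ x| ≤ M) :
    ∃ (v : ℝ × ℝ → ℝ) (κ : ℕ → ℕ), Measurable v ∧ (∀ p, |v p| ≤ M) ∧ StrictMono κ ∧
      ∀ᵐ p ∂volume.restrict halfPlane, Tendsto (fun n => u (κ n) p) atTop (𝓝 (v p)) := by
  obtain ⟨κ, hκ, hκ'⟩ := extraction_forall_of_eventually fun N : ℕ =>
    hu.eventually_integral_sub_le hf hu₀ hM₀ (R := N) (by positivity)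
      (show (0 : ℝ) < 1 / 2 ^ N by positivity)
  have hM : 0 ≤ M := (abs_nonneg _).trans (hM₀ 0)
  have conv : ∀ R : ℕ, ∀ᵐ p ∂volume.restrict (halfBall R),
      ∃ l, Tendsto (fun n => u (κ (n + R)) p) atTop (𝓝 l) := by
    intro R
    refine Lp.ae_tendsto_of_cauchy_eLpNorm (p := 1) (B := fun N => 2 * 2⁻¹ ^ N)
      (fun n => (hu.measurable _).aestronglyMeasurable) le_rfl ?_ fun N n m hn hm => ?_
    · rw [ENNReal.tsum_mul_left, ENNReal.tsum_geometric, ENNReal.one_sub_inv_two, inv_inv]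
      exact ENNReal.mul_ne_top (by simp) (by simp)
    · have hsub : halfBall R ⊆ halfBall ((N + R : ℕ) : ℝ) :=
        inter_subset_inter_right _ (Metric.closedBall_subset_closedBall (by push_cast; linarith))
      have h1 := hκ' (N + R) (κ (n + R)) (hκ.monotone (by lia)) (κ (m + R)) (hκ.monotone (by lia))
      refine (eLpNorm_mono_measure _ (Measure.restrict_mono hsub le_rfl)).trans_lt ?_
      have e := eLpNorm_one_halfBall ((hu.measurable (κ (n + R))).sub (hu.measurable (κ (m + R))))
        (IsBdd.sub ⟨M, hu.bound _⟩ ⟨M, hu.bound _⟩) ((N + R : ℕ) : ℝ)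
      rw [e]
      -- The shift by `R` makes the controlled half-ball contain the one of radius `R`; the factor
      -- `2` provides the strict inequality that the Cauchy criterion asks for.
      have h2 : (1 : ℝ) / 2 ^ (N + R) < 2 * 2⁻¹ ^ N := by
        rw [one_div, ← inv_pow, pow_add]
        have h3 : (2⁻¹ : ℝ) ^ R ≤ 1 := pow_le_one₀ (by norm_num) (by norm_num)
        have h4 : (0 : ℝ) < 2⁻¹ ^ N := by positivity
        nlinarith
      have h5 : (2 * 2⁻¹ ^ N : ℝ≥0∞) = ENNReal.ofReal (2 * 2⁻¹ ^ N) := by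
        rw [ENNReal.ofReal_mul (by norm_num), ENNReal.ofReal_pow (by norm_num),
          ENNReal.ofReal_inv_of_pos (by norm_num)]
        simp
      rw [h5]
      exact (ENNReal.ofReal_lt_ofReal_iff (by positivity)).2 (h1.trans_lt h2)
  have conv' : ∀ᵐ p ∂volume.restrict halfPlane, ∃ l, Tendsto (fun n => u (κ n) p) atTop (𝓝 l) := by
    rw [← iUnion_halfBall, ae_restrict_iUnion_iff]
    intro R
    filter_upwards [conv R] with p ⟨l, hl⟩
    exact ⟨l, (tendsto_add_atTop_iff_nat R).1 hl⟩
  obtain ⟨v, mv, hv⟩ := measurable_limit_of_tendsto_metrizable_ae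
    (fun n => (hu.measurable (κ n)).aemeasurable) conv'
  refine ⟨fun p => max (-M) (min M (v p)), κ, measurable_const.max (measurable_const.min mv),
    fun p => abs_le.2 ⟨le_max_left _ _, max_le (by linarith) (min_le_left _ _)⟩, hκ, ?_⟩
  filter_upwards [hv] with p hp
  have h1 := le_of_tendsto' hp fun n => (abs_le.1 (hu.bound (κ n) p)).2
  have h2 := ge_of_tendsto' hp fun n => (abs_le.1 (hu.bound (κ n) p)).1
  rwa [min_eq_right h1, max_eq_right h2]

theorem tendsto_entropyFunctional {V G u₀ : ℝ → ℝ} {M R B : ℝ} {u : ℕ → ℝ × ℝ → ℝ}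
    {v ψ : ℝ × ℝ → ℝ} (hV : Continuous V) (hG : Continuous G) (hu : ∀ n, Measurable (u n))
    (hM : ∀ n p, |u n p| ≤ M)
    (h : ∀ᵐ p ∂volume.restrict halfPlane, Tendsto (fun n => u n p) atTop (𝓝 (v p)))
    (hψ : IsTest R B ψ) :
    Tendsto (fun n => entropyFunctional V G u₀ (u n) ψ) atTop
      (𝓝 (entropyFunctional V G u₀ v ψ)) := by
  obtain ⟨C, hC⟩ := exists_bound_of_continuous hV M
  obtain ⟨D, hD⟩ := exists_bound_of_continuous hG M
  refine Tendsto.add_const _ (tendsto_integral_of_dominated_convergence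
    (fun p => C * |fderiv ℝ ψ p (0, 1)| + D * |fderiv ℝ ψ p (1, 0)|) (fun n => ?_) ?_ (fun n => ?_) ?_)
  · exact (integrable_entropy hψ hV hG (hu n) (hM n) _ Measure.restrict_le_self).1
  · exact (((hψ.integrable_fderiv _).abs.const_mul C).add
      ((hψ.integrable_fderiv _).abs.const_mul D)).integrableOn
  · refine ae_of_all _ fun p => (abs_add_le _ _).trans (add_le_add ?_ ?_)
    · exact abs_mul_le_mul (hC _ (hM n p)) le_rfl
    · exact abs_mul_le_mul (hD _ (hM n p)) le_rfl
  · filter_upwards [h] with p hp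
    exact (((hV.tendsto _).comp hp).mul_const _).add (((hG.tendsto _).comp hp).mul_const _)

/-- For a fixed pair and a fixed test function the errors vanish along the subsequence, and
dominated convergence handles the functional. -/
theorem AsymptoticSolution.entropy_limit {f u₀ : ℝ → ℝ} {M : ℝ} {u : ℕ → ℝ × ℝ → ℝ}
    (hu : AsymptoticSolution f u₀ M u) {v : ℝ × ℝ → ℝ} {κ : ℕ → ℕ} (hκ : StrictMono κ)
    (h : ∀ᵐ p ∂volume.restrict halfPlane, Tendsto (fun n => u (κ n) p) atTop (𝓝 (v p)))
    {V G : ℝ → ℝ} (hV : IsEntropyPair f V G) {R B : ℝ} {ψ : ℝ × ℝ → ℝ} (hψ : IsTest R B ψ) :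
    0 ≤ entropyFunctional V G u₀ v ψ := by
  obtain ⟨C, hC⟩ := exists_bound_of_continuous hV.continuous M
  obtain ⟨D, hD⟩ := exists_bound_of_continuous hV.continuous_flux M
  have lim := tendsto_entropyFunctional (u₀ := u₀) hV.continuous hV.continuous_flux
    (fun n => hu.measurable (κ n)) (fun n => hu.bound (κ n)) h hψ
  refine le_of_forall_pos_le_add fun ε hε => ?_
  have := ge_of_tendsto lim ((hκ.tendsto_atTop.eventually (hu.entropy R B (max C D) ε hε)).mono
    fun n hn => hn V G hV (fun a ha => ⟨(hC a ha).trans (le_max_left _ _),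
      (hD a ha).trans (le_max_right _ _)⟩) ψ hψ)
  linarith

/-! ### The weak equation -/

/-- Linear functions are not strictly convex and so are not admissible entropies; a small multiple
of the square corrects this, for slopes of either sign. -/
theorem exists_entropyPair_near_linear {f : ℝ → ℝ} (hf : ContDiff ℝ 1 f) (M : ℝ) :
    ∃ C : ℝ, ∀ s ε : ℝ, 0 < ε → ∃ V G : ℝ → ℝ, IsEntropyPair f V G ∧
      ∀ a, |a| ≤ M → |V a - s * a| ≤ ε * C ∧ |G a - s * f a| ≤ ε * C := by
  have hcont : Continuous fun x => 2 * x * deriv f x :=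
    (by fun_prop : Continuous fun x : ℝ => 2 * x).mul (hf.continuous_deriv le_rfl)
  set Q : ℝ → ℝ := fun a => ∫ x in (0 : ℝ)..a, 2 * x * deriv f x with hQ
  have hQd : ∀ x, HasDerivAt Q (2 * x * deriv f x) x := fun x =>
    (hcont.integral_hasStrictDerivAt 0 x).hasDerivAt
  obtain ⟨C, hC⟩ := exists_bound_of_continuous (continuous_pow 2 : Continuous fun x : ℝ => x ^ 2) M
  obtain ⟨D, hD⟩ := exists_bound_of_continuous
    (continuous_iff_continuousAt.2 fun x => (hQd x).continuousAt : Continuous Q) M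
  refine ⟨max C D, fun s ε hε => ⟨fun x => s * x + ε * x ^ 2, fun x => s * f x + ε * Q x, ?_,
    fun a ha => ?_⟩⟩
  · have hVd : ∀ x, HasDerivAt (fun x => s * x + ε * x ^ 2) (s + ε * (2 * x)) x := fun x => by
      refine (((hasDerivAt_id x).const_mul s).add
        (((hasDerivAt_id x).pow 2).const_mul ε)).congr_deriv ?_
      simp
    have hVd' : deriv (fun x => s * x + ε * x ^ 2) = fun x => s + ε * (2 * x) :=
      funext fun x => (hVd x).deriv
    refine ⟨StrictMono.strictConvexOn_univ_of_deriv (by fun_prop) ?_,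
      fun x => (hVd x).differentiableAt, fun x => ?_⟩
    · rw [hVd']
      intro x y hxy
      simp only
      gcongr
    · rw [hVd']
      refine ((((hf.differentiable (by norm_num) x).hasDerivAt).const_mul s).add
        ((hQd x).const_mul ε)).congr_deriv ?_
      ring
  · rw [add_sub_cancel_left, add_sub_cancel_left, abs_mul, abs_mul, abs_of_pos hε]
    exact ⟨by gcongr; exact (hC a ha).trans (le_max_left _ _),
      by gcongr; exact (hD a ha).trans (le_max_right _ _)⟩

theorem weak_of_nonneg {f u₀ : ℝ → ℝ} (hf : ContDiff ℝ 1 f) {M : ℝ} {v : ℝ × ℝ → ℝ}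
    (mv : Measurable v) (hM : ∀ p, |v p| ≤ M) (hu₀ : Measurable u₀) (hM₀ : ∀ x, |u₀ x| ≤ M)
    {R B : ℝ} {ψ : ℝ × ℝ → ℝ} (hψ : IsTest R B ψ)
    (h : ∀ V G, IsEntropyPair f V G → 0 ≤ entropyFunctional V G u₀ v ψ) :
    entropyFunctional (fun a => a) f u₀ v ψ = 0 := by
  obtain ⟨C, hC⟩ := exists_entropyPair_near_linear hf M
  -- The two signs `s = 1` and `s = -1` turn the inequality into an equality.
  have key : ∀ s : ℝ, 0 ≤ s * entropyFunctional (fun a => a) f u₀ v ψ := by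
    intro s
    have e : s * entropyFunctional (fun a => a) f u₀ v ψ =
        entropyFunctional (fun a => s * a) (fun a => s * f a) u₀ v ψ := by
      simp only [entropyFunctional, mul_assoc, ← mul_add, integral_const_mul]
    rw [e]
    refine le_of_forall_pos_le_add fun δ hδ => ?_
    set A := |C| * testMass ψ + 1 with hA
    have hA0 : 0 < A := by
      have := testMass_nonneg ψ
      positivity
    obtain ⟨V, G, hV, hVG⟩ := hC s (δ / A) (by positivity)
    have h1 := entropyFunctional_sub_le (V := V) (G := G) (V' := fun a => s * a)
      (G' := fun a => s * f a) hψ hV.continuous hV.continuous_flux (by fun_prop)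
      (continuous_const.mul hf.continuous) mv hM hu₀ hM₀ (fun a ha => (hVG a ha).1)
      (fun a ha => (hVG a ha).2)
    have h2 := h V G hV
    have h3 : δ / A * C * testMass ψ ≤ δ := by
      rw [mul_assoc, div_mul_eq_mul_div, div_le_iff₀ hA0]
      gcongr
      have := mul_le_mul_of_nonneg_right (le_abs_self C) (testMass_nonneg ψ)
      linarith
    have h4 := (abs_le.1 h1).2
    linarith
  have h1 := key 1
  have h2 := key (-1)
  linarith

/-- The weak equation allows test functions of any sign. Adding a large multiple of a bump that is
`1` on the support makes such a function nonnegative. -/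
theorem exists_isTest_add {ψ : ℝ × ℝ → ℝ} (hψ : ContDiff ℝ ∞ ψ) (hc : HasCompactSupport ψ) :
    ∃ (χ : ℝ × ℝ → ℝ) (R B R' B' : ℝ), IsTest R B χ ∧ IsTest R' B' fun p => ψ p + χ p := by
  obtain ⟨r, hr⟩ := hc.isCompact.isBounded.subset_closedBall 0
  obtain ⟨C, hC⟩ := IsBdd.of_hasCompactSupport hψ.continuous hc
  have hC0 : 0 ≤ C := (abs_nonneg _).trans (hC 0)
  let b : ContDiffBump (0 : ℝ × ℝ) := ⟨|r| + 1, |r| + 2, by positivity, by linarith⟩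
  have hχ : ContDiff ℝ ∞ fun p => C * b p := contDiff_const.mul b.contDiff
  have hχc : HasCompactSupport fun p => C * b p := b.hasCompactSupport.mul_left
  have hχ0 : ∀ p, 0 ≤ C * b p := fun p => mul_nonneg hC0 b.nonneg
  obtain ⟨R, B, h1⟩ := IsTest.exists_of_contDiff hχ hχc hχ0
  obtain ⟨R', B', h2⟩ := IsTest.exists_of_contDiff (hψ.add hχ) (hc.add hχc) fun p => by
    by_cases hp : ψ p = 0
    · simp only [hp, zero_add]
      exact hχ0 p
    · have hb : b p = 1 := b.one_of_mem_closedBall (Metric.closedBall_subset_closedBall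
        (by simp only [b]; linarith [le_abs_self r]) (hr (subset_tsupport _ hp)))
      simp only [hb, mul_one]
      linarith [(abs_le.1 (hC p)).1]
  exact ⟨_, R, B, R', B', h1, h2⟩

theorem entropyFunctional_add_test {V G u₀ : ℝ → ℝ} {v ψ χ : ℝ × ℝ → ℝ} {M R B R' B' : ℝ}
    (hV : Continuous V) (hG : Continuous G) (mv : Measurable v) (hM : ∀ p, |v p| ≤ M)
    (hu₀ : Measurable u₀) (hM₀ : ∀ x, |u₀ x| ≤ M) (hψ : ContDiff ℝ ∞ ψ) (hχ : IsTest R B χ)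
    (hadd : IsTest R' B' fun p => ψ p + χ p) :
    entropyFunctional V G u₀ v ψ =
      entropyFunctional V G u₀ v (fun p => ψ p + χ p) - entropyFunctional V G u₀ v χ := by
  have i1 := integrable_entropy hadd hV hG mv hM (volume.restrict halfPlane) Measure.restrict_le_self
  have i2 := integrable_entropy hχ hV hG mv hM (volume.restrict halfPlane) Measure.restrict_le_self
  have j1 := integrable_comp_mul hV hu₀ hM₀ hadd.integrable_initial
  have j2 := integrable_comp_mul hV hu₀ hM₀ hχ.integrable_initial
  have hd : ∀ p, fderiv ℝ (fun p => ψ p + χ p) p = fderiv ℝ ψ p + fderiv ℝ χ p := fun p =>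
    fderiv_fun_add (hψ.differentiable (by norm_num) p) (hχ.contDiff.differentiable (by norm_num) p)
  simp only [entropyFunctional]
  rw [add_sub_add_comm, ← integral_sub i1 i2, ← integral_sub j1 j2]
  congr 1
  · refine integral_congr_ae (ae_of_all _ fun p => ?_)
    simp only [hd, add_apply]
    ring
  · refine integral_congr_ae (ae_of_all _ fun x => ?_)
    simp only
    ring

theorem isClassicalSolution_of_entropy {f u₀ : ℝ → ℝ} (hf : ContDiff ℝ 1 f) {M : ℝ} {v : ℝ × ℝ → ℝ}
    (mv : Measurable v) (hM : ∀ p, |v p| ≤ M) (hu₀ : Measurable u₀) (hM₀ : ∀ x, |u₀ x| ≤ M)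
    (h : ∀ V G, IsEntropyPair f V G → ∀ R B ψ, IsTest R B ψ → 0 ≤ entropyFunctional V G u₀ v ψ) :
    IsClassicalSolution f u₀ v where
  bounded := memLp_top_of_bound mv.aestronglyMeasurable M (ae_of_all _ hM)
  weak ψ hψ hc := by
    obtain ⟨χ, R, B, R', B', h1, h2⟩ := exists_isTest_add hψ hc
    change entropyFunctional (fun a => a) f u₀ v ψ = 0
    rw [entropyFunctional_add_test continuous_id' hf.continuous mv hM hu₀ hM₀ hψ h1 h2,
      weak_of_nonneg hf mv hM hu₀ hM₀ h1 fun V G hV => h V G hV _ _ _ h1,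
      weak_of_nonneg hf mv hM hu₀ hM₀ h2 fun V G hV => h V G hV _ _ _ h2, sub_zero]
  entropy V G hV ψ hψ hc h0 := by
    obtain ⟨R, B, hψ'⟩ := IsTest.exists_of_contDiff hψ hc h0
    exact h V G hV R B ψ hψ'

theorem AsymptoticSolution.exists_isClassicalSolution {f u₀ : ℝ → ℝ} (hf : ContDiff ℝ 1 f) {M : ℝ}
    {u : ℕ → ℝ × ℝ → ℝ} (hu : AsymptoticSolution f u₀ M u) (hu₀ : Measurable u₀)
    (hM₀ : ∀ x, |u₀ x| ≤ M) :
    ∃ v : ℝ × ℝ → ℝ, Measurable v ∧ (∀ p, |v p| ≤ M) ∧ IsClassicalSolution f u₀ v := by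
  obtain ⟨v, κ, mv, hM, hκ, hv⟩ := hu.exists_limit hf hu₀ hM₀
  exact ⟨v, mv, hM, isClassicalSolution_of_entropy hf mv hM hu₀ hM₀ fun V G hV R B ψ hψ =>
    hu.entropy_limit hκ hv hV hψ⟩

/-- Uniqueness of the classical solution. -/
theorem IsClassicalSolution.ae_eq {f u₀ : ℝ → ℝ} (hf : ContDiff ℝ 1 f) {M : ℝ}
    {u v : ℝ × ℝ → ℝ} (hu : IsClassicalSolution f u₀ u) (hv : IsClassicalSolution f u₀ v)
    (mu : Measurable u) (mv : Measurable v) (huM : ∀ p, |u p| ≤ M) (hvM : ∀ p, |v p| ≤ M)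
    (hu₀ : Measurable u₀) (hM₀ : ∀ x, |u₀ x| ≤ M) : u =ᵐ[volume.restrict halfPlane] v := by
  rw [← iUnion_halfBall, EventuallyEq, ae_restrict_iUnion_iff]
  intro R
  have h0 : ∫ p in halfBall R, |u p - v p| = 0 := by
    refine le_antisymm (le_of_forall_pos_le_add fun θ hθ => ?_) (integral_nonneg fun _ => abs_nonneg _)
    rw [zero_add]
    exact ((hu.asymptoticSolution mu huM).eventually_integral_le hf hv mv hvM hu₀ hM₀
      (Nat.cast_nonneg R) hθ).exists.choose_spec
  have i : Integrable (fun p => |u p - v p|) (volume.restrict (halfBall R)) :=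
    (IsBdd.abs (IsBdd.sub ⟨M, huM⟩ ⟨M, hvM⟩)).integrable (measurable_norm.comp (mu.sub mv))
  filter_upwards [(integral_eq_zero_iff_of_nonneg (fun _ => abs_nonneg _) i).1 h0] with p hp
  exact sub_eq_zero.1 (abs_eq_zero.1 hp)

/-! ### Convergence on compact sets -/

theorem AsymptoticSolution.tendsto_eLpNorm {f u₀ : ℝ → ℝ} (hf : ContDiff ℝ 1 f) {M : ℝ}
    {u : ℕ → ℝ × ℝ → ℝ} {v : ℝ × ℝ → ℝ} (hu : AsymptoticSolution f u₀ M u)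
    (hv : IsClassicalSolution f u₀ v) (mv : Measurable v) (hvM : ∀ p, |v p| ≤ M)
    (hu₀ : Measurable u₀) (hM₀ : ∀ x, |u₀ x| ≤ M) {K : Set (ℝ × ℝ)} (hK : IsCompact K)
    (hK0 : K ⊆ {p | 0 ≤ p.2}) :
    Tendsto (fun k => eLpNorm (fun p => u k p - v p) 1 (volume.restrict K)) atTop (𝓝 0) := by
  obtain ⟨R, hR⟩ := hK.isBounded.subset_closedBall 0
  -- A compact set may touch the line `t = 0`, which is a null set.
  have hle : volume.restrict K ≤ volume.restrict (halfBall (max R 0)) := by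
    have e : volume.restrict ({p : ℝ × ℝ | 0 ≤ p.2} ∩ Metric.closedBall 0 (max R 0)) =
        volume.restrict (halfBall (max R 0)) :=
      Measure.restrict_congr_set (setOf_nonneg_ae_eq_halfPlane.inter (ae_eq_refl _))
    rw [← e]
    exact Measure.restrict_mono (subset_inter hK0
      (hR.trans (Metric.closedBall_subset_closedBall (le_max_left _ _)))) le_rfl
  rw [ENNReal.tendsto_nhds_zero]
  intro ε hε
  obtain ⟨θ, hθ, hθε⟩ : ∃ θ : ℝ, 0 < θ ∧ ENNReal.ofReal θ ≤ ε := by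
    obtain ⟨r, hr, hrε⟩ := ENNReal.lt_iff_exists_nnreal_btwn.1 hε
    exact ⟨r, by exact_mod_cast hr, by rw [ENNReal.ofReal_coe_nnreal]; exact hrε.le⟩
  filter_upwards [hu.eventually_integral_le hf hv mv hvM hu₀ hM₀ (le_max_right R 0) hθ] with k hk
  refine (eLpNorm_mono_measure _ hle).trans ?_
  rw [eLpNorm_one_halfBall (h := fun p => u k p - v p) ((hu.measurable k).sub mv)
    (IsBdd.sub ⟨M, hu.bound k⟩ ⟨M, hvM⟩)]
  exact (ENNReal.ofReal_le_ofReal hk).trans hθε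

theorem discreteSolution_congr {u₀ v₀ : ℝ → ℝ} (h : u₀ =ᵐ[volume] v₀) (f φ : ℝ → ℝ) (dt dx : ℝ) :
    discreteSolution f φ u₀ dt dx = discreteSolution f φ v₀ dt dx := by
  funext n
  induction n with
  | zero =>
    funext j
    rw [discreteSolution, discreteSolution, cellAverage, cellAverage,
      intervalIntegral.integral_congr_ae (h.mono fun x hx _ => hx)]
  | succ n ih => rw [discreteSolution, discreteSolution, ih]

theorem UpwindData.contDiff {f φ g : ℝ → ℝ} {ς : ℝ} {a : ℤ} (h : UpwindData f φ g ς a) :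
    ContDiff ℝ 1 f := by
  have hg := h.concaveConvex.contDiff.of_le (m := 1) (by norm_num)
  rcases h.cases with ⟨rfl, -⟩ | ⟨rfl, -⟩
  · exact hg
  · simpa using hg.neg

/-- Convergence of the scheme to the unique classical solution. -/
theorem UpwindData.convergence {f φ g : ℝ → ℝ} {ς : ℝ} {a : ℤ} (h : UpwindData f φ g ς a)
    {u₀ : ℝ → ℝ} {dt dx : ℕ → ℝ} (hu₀ : MemLp u₀ ⊤ volume)
    (hdt : ∀ k, 0 < dt k) (hdx : ∀ k, 0 < dx k) (hdt0 : Tendsto dt atTop (𝓝 0))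
    (hdx0 : Tendsto dx atTop (𝓝 0))
    (hS : ∀ k, ∃ S ∈ convexityRegions, ∀ (n : ℕ) (j : ℤ),
      discreteSolution f φ u₀ (dt k) (dx k) n j ∈ S)
    (hcfl : ∀ (k n : ℕ) (j : ℤ), CFLAt f φ (dt k) (dx k)
      (discreteSolution f φ u₀ (dt k) (dx k) n) j) :
    ∃ u : ℝ × ℝ → ℝ, IsClassicalSolution f u₀ u ∧
      (∀ v : ℝ × ℝ → ℝ, IsClassicalSolution f u₀ v → v =ᵐ[volume.restrict halfPlane] u) ∧
      ∀ K : Set (ℝ × ℝ), IsCompact K → K ⊆ {p | 0 ≤ p.2} →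
        Tendsto (fun k => eLpNorm (fun p => piecewiseConstant (dt k) (dx k)
          (discreteSolution f φ u₀ (dt k) (dx k)) p - u p) 1 (volume.restrict K)) atTop (𝓝 0) := by
  obtain ⟨v₀, M, mv₀, hM, hae⟩ := exists_bounded_representative hu₀
  -- The scheme sees `u₀` only through integrals over cells, so the bounded representative produces
  -- the same discrete solutions.
  simp only [discreteSolution_congr hae] at hS hcfl ⊢
  have hf := h.contDiff
  have hw := h.asymptoticSolution mv₀ hM hdt hdx hdt0 hdx0 hS hcfl
  obtain ⟨u, mu, huM, hu⟩ := hw.exists_isClassicalSolution hf mv₀ hM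
  refine ⟨u, hu.congr hae.symm (ae_eq_refl u), fun v hv => ?_, fun K hK hK0 =>
    hw.tendsto_eLpNorm hf hu mu huM mv₀ hM hK hK0⟩
  obtain ⟨v', M', mv', hM', hae'⟩ := exists_bounded_representative hv.bounded
  -- A competing solution comes with its own bound, and uniqueness is applied with the larger of the
  -- two.
  exact hae'.trans ((hv.congr hae hae').ae_eq hf hu mv' mu (M := max M M')
    (fun p => (hM' p).trans (le_max_right _ _)) (fun p => (huM p).trans (le_max_left _ _)) mv₀
    fun x => (hM x).trans (le_max_left _ _))

end ReconScheme

end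

/-! ### The one-step properties, the variation bound and the convergence -/

theorem mainTheorem2 (f U F φ : ℝ → ℝ)
    (hUF : ReconScheme.IsEntropyPair f U F)
    (hf : (ReconScheme.ConcaveConvex f ∧ ReconScheme.IsKineticConcaveConvex f U F φ) ∨
      (ReconScheme.ConvexConcave f ∧ ReconScheme.IsKineticConvexConcave f U F φ))
    (hmono : (∀ v : ℝ, 0 ≤ deriv f v) ∨ (∀ v : ℝ, deriv f v ≤ 0)) :
    -- one time step, five values in one region of convexity
    (∀ (dt dx : ℝ) (u : ℤ → ℝ) (j : ℤ), 0 < dt → 0 < dx →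
      ∀ S ∈ ReconScheme.convexityRegions, (∀ i : ℤ, j - 2 ≤ i → i ≤ j + 2 → u i ∈ S) →
      -- no reconstruction is triggered, except possibly at the inflection point
      (∀ i : ℤ, j - 1 ≤ i → i ≤ j + 1 → u i ≠ 0 → ¬ ReconScheme.Reconstructs φ u i) ∧
      ((∀ i : ℤ, j - 1 ≤ i → i ≤ j + 1 → ReconScheme.CFLAt f φ dt dx u i) →
        -- the scheme coincides with the upwind scheme
        ReconScheme.reconstructionStep f φ dt dx u j = ReconScheme.upwindStep f dt dx u j ∧
        -- maximum principle
        min (min (u (j - 1)) (u j)) (u (j + 1)) ≤ ReconScheme.reconstructionStep f φ dt dx u j ∧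
        ReconScheme.reconstructionStep f φ dt dx u j ≤ max (max (u (j - 1)) (u j)) (u (j + 1)) ∧
        -- discrete entropy inequalities
        (∀ V G : ℝ → ℝ, ReconScheme.IsEntropyPair f V G →
          V (ReconScheme.reconstructionStep f φ dt dx u j) ≤
            V (u j) - dt / dx * (ReconScheme.upwindValue f G u j
              - ReconScheme.upwindValue f G u (j - 1))))) ∧
    -- one time step, all values in one region of convexity: the total variation does not increase
    (∀ (dt dx : ℝ) (u : ℤ → ℝ), 0 < dt → 0 < dx →
      ∀ S ∈ ReconScheme.convexityRegions, (∀ i : ℤ, u i ∈ S) →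
      (∀ i : ℤ, ReconScheme.CFLAt f φ dt dx u i) →
      eVariationOn (ReconScheme.reconstructionStep f φ dt dx u) univ ≤ eVariationOn u univ) ∧
    -- convergence
    (∀ (u₀ : ℝ → ℝ) (dt dx : ℕ → ℝ), MemLp u₀ ⊤ volume →
      (∀ k, 0 < dt k) → (∀ k, 0 < dx k) → Tendsto dt atTop (𝓝 0) → Tendsto dx atTop (𝓝 0) →
      (∀ k, ∃ S ∈ ReconScheme.convexityRegions, ∀ (n : ℕ) (j : ℤ),
        ReconScheme.discreteSolution f φ u₀ (dt k) (dx k) n j ∈ S) →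
      (∀ (k n : ℕ) (j : ℤ), ReconScheme.CFLAt f φ (dt k) (dx k)
        (ReconScheme.discreteSolution f φ u₀ (dt k) (dx k) n) j) →
      ∃ u : ℝ × ℝ → ℝ, ReconScheme.IsClassicalSolution f u₀ u ∧
        (∀ v : ℝ × ℝ → ℝ, ReconScheme.IsClassicalSolution f u₀ v →
          v =ᵐ[volume.restrict ReconScheme.halfPlane] u) ∧
        ∀ K : Set (ℝ × ℝ), IsCompact K → K ⊆ {p | 0 ≤ p.2} →
          Tendsto (fun k => eLpNorm (fun p => ReconScheme.piecewiseConstant (dt k) (dx k)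
            (ReconScheme.discreteSolution f φ u₀ (dt k) (dx k)) p - u p) 1
            (volume.restrict K)) atTop (𝓝 0)) := by
  obtain ⟨g, ς, a, h⟩ := ReconScheme.exists_upwindData hUF hf hmono
  refine ⟨fun dt dx u j hdt hdx S hS hu => ⟨fun i h1 h2 h0 => ?_, fun hcfl => ?_⟩,
    fun dt dx u hdt hdx S hS hu hcfl => h.variation_le hdt hdx hS hu hcfl,
    fun u₀ dt dx hu₀ hdt hdx hdt0 hdx0 hS hcfl => h.convergence hu₀ hdt hdx hdt0 hdx0 hS hcfl⟩
  · exact h.kinetic.not_reconstructs hS (hu _ (by lia) (by lia)) (hu _ (by lia) (by lia))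
      (hu _ (by lia) (by lia)) h0
  · have hmax := h.max_principle hdt hdx hS hu hcfl
    exact ⟨h.reconstructionStep_eq hdt hdx hS hu hcfl, hmax.1, hmax.2,
      (h.one_step hdt hdx hS hu hcfl).2⟩
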